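/- Let $n,m$ be integers with $1\le m<n/2$, and write $B_r=\{x\in\mathbb R^n:|x|<r\}$. **The singular set.** Let $\Lambda\subset B_{1/2}$ be a compact set which either has upper Minkowski dimension $\overline{\dim}_M(\Lambda)<\frac{n-2m}{2}$, or is a smooth (embedded, boundaryless) $k$-dimensional closed submanifold of $\mathbb R^n$ for some integer $0\le k\le\frac{n-2m}{2}$. Here, for a compact set $E\subset\mathbb R^n$, $$\overline{\dim}_M(E)=\inf\Big\{\lambda\ge0:\ \limsup_{r\to0^+}\mathcal M^\lambda_r(E)=0\Big\},\qquad \mathcal M^\lambda_r(E)=\inf\Big\{l\,r^\lambda:\ E\subset\bigcup_{k=1}^lB(x_k,r),\ x_k\in E\Big\}.$$ **The equation.** Let $K$ be a positive continuous function on $\overline B_2$ and let $u\in C^{2m}(\overline B_2\setminus\Lambda)$ satisfy $$(-\Delta)^mu=K(x)\,u^{\frac{n+2m}{n-2m}},\qquad u>0\qquad\text{in }B_2\setminus\Lambda .$$ (No sign condition is imposed on $(-\Delta)^su$, $1\le s\le m-1$.) **The Green function.** Let $G_m(x,y)$ be the Green function of $(-\Delta)^m$ on $B_2$ under the Navier boundary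 condition: for each $x\in B_2$ the function $G_m(x,\cdot)$ is integrable on $B_2$ and smooth on $\overline B_2\setminus\{x\}$, and $$(-\Delta)^mG_m(x,\cdot)=\delta_x\ \text{ in }B_2\text{ (as distributions)},\qquad G_m(x,\cdot)=-\Delta G_m(x,\cdot)=\dots=(-\Delta)^{m-1}G_m(x,\cdot)=0\ \text{ on }\partial B_2 .$$ For $1\le i\le m$, $x\in B_2$, $y\in\partial B_2$ put $$H_i(x,y)=-\frac{\partial}{\partial\nu_y}(-\Delta_y)^{m-i}G_m(x,y),$$ where $\nu_y=y/2$ is the outward unit normal to $\partial B_2$ at $y$. **Claim.** Such a function $G_m$ exists, and for every such $G_m$ and every $x\in B_2\setminus\Lambda$ all integrals below converge absolutely and $$u(x)=\int_{B_2}G_m(x,y)\,K(y)\,u(y)^{\frac{n+2m}{n-2m}}\,dy+\sum_{i=1}^m\int_{\partial B_2}H_i(x,y)\,(-\Delta)^{i-1}u(y)\,dS_y .$$ -/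

import Mathlib

open MeasureTheory Metric Set Filter Topology
open scoped ENNReal ContDiff

noncomputable section

namespace SingularPoly

/-- `ℝⁿ` with its Euclidean norm. -/
abbrev E (n : ℕ) : Type := EuclideanSpace ℝ (Fin n)

/-- `(-Δ)^j f` on a set `s` (one-sided derivatives are taken at points of `s` which are not
interior, so that for `f` of class `C^{2j}` up to the boundary this is the continuous extension
of `(-Δ)^j f` to the boundary). At interior points of `s` this is the usual `(-Δ)^j f`. -/
def negLaplacianPow {n : ℕ} (s : Set (E n)) (j : ℕ) (f : E n → ℝ) : E n → ℝ :=
  (fun (g : E n → ℝ) (x : E n) => -InnerProductSpace.laplacianWithin g s x)^[j] f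

/-- The `d`-dimensional Minkowski `r`-content of `S`: the infimum of `l * r ^ d` over all coverings
of `S` by `l` open balls of radius `r` with centers in `S`. -/
def minkowskiContent {n : ℕ} (d r : ℝ) (S : Set (E n)) : ℝ≥0∞ :=
  ⨅ (l : ℕ) (_ : ∃ c : Fin l → E n, (∀ k, c k ∈ S) ∧ S ⊆ ⋃ k, ball (c k) r),
    (l : ℝ≥0∞) * ENNReal.ofReal (r ^ d)

/-- The upper Minkowski dimension (of a compact set). -/
def upperMinkowskiDim {n : ℕ} (S : Set (E n)) : ℝ :=
  sInf {d : ℝ | 0 ≤ d ∧ limsup (fun r : ℝ => minkowskiContent d r S) (𝓝[>] (0 : ℝ)) = 0}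

/-- `S` is a smooth embedded `k`-dimensional submanifold (without boundary) of `ℝⁿ`: around each of
its points there is a smooth diffeomorphism between open sets of `ℝⁿ` which flattens `S` to
`ℝᵏ × {0}`. -/
def IsSmoothSubmanifold {n : ℕ} (k : ℕ) (S : Set (E n)) : Prop :=
  k ≤ n ∧ ∀ p ∈ S, ∃ Φ : OpenPartialHomeomorph (E n) (E n), p ∈ Φ.source ∧
    ContDiffOn ℝ ∞ Φ Φ.source ∧ ContDiffOn ℝ ∞ Φ.symm Φ.target ∧
    ∀ q ∈ Φ.source, (q ∈ S ↔ ∀ i : Fin n, k ≤ (i : ℕ) → Φ q i = 0)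

/-- `G` is the Green function of `(-Δ)^m` on `B_2` under the Navier boundary condition: for each
pole `x ∈ B_2`, `(-Δ)^m G(x, ·) = δ_x` in `B_2` in the sense of distributions, and
`(-Δ)^j G(x, ·) = 0` on `∂B_2` for `j = 0, …, m - 1`, where `G(x, ·)` is integrable on `B_2` and
smooth up to the boundary away from the pole. (The value `G x x` at the pole is irrelevant.) -/
structure IsNavierGreenFunction (n m : ℕ) (G : E n → E n → ℝ) : Prop where
  smooth : ∀ x ∈ ball (0 : E n) 2, ContDiffOn ℝ ∞ (G x) (closedBall 0 2 \ {x})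
  integrable : ∀ x ∈ ball (0 : E n) 2, IntegrableOn (G x) (ball 0 2)
  dirac : ∀ x ∈ ball (0 : E n) 2, ∀ φ : E n → ℝ, ContDiff ℝ ∞ φ → HasCompactSupport φ →
    tsupport φ ⊆ ball 0 2 →
    ∫ y in ball (0 : E n) 2, G x y * negLaplacianPow univ m φ y = φ x
  boundary : ∀ x ∈ ball (0 : E n) 2, ∀ j < m, ∀ y ∈ sphere (0 : E n) 2,
    negLaplacianPow (closedBall 0 2 \ {x}) j (G x) y = 0

/-- The boundary kernel `H_i(x, y) = -∂/∂ν_y (-Δ_y)^{m-i} G(x, y)` for `x ∈ B_2`, `y ∈ ∂B_2`, where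
`ν_y = y / 2` is the outward unit normal to `∂B_2` at `y`. -/
def boundaryKernel {n : ℕ} (m : ℕ) (G : E n → E n → ℝ) (i : ℕ) (x y : E n) : ℝ :=
  -fderivWithin ℝ (negLaplacianPow (closedBall 0 2 \ {x}) (m - i) (G x))
    (closedBall 0 2 \ {x}) y ((1 / 2 : ℝ) • y)

/-- The surface measure on the sphere `∂B_2 ⊆ ℝⁿ`: the image of the surface measure of the unit
sphere under `z ↦ 2 z`, multiplied by `2 ^ (n - 1)`. -/
def surfaceMeasure (n : ℕ) : Measure (E n) :=
  (2 : ℝ≥0∞) ^ (n - 1) •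
    ((volume : Measure (E n)).toSphere).map (fun (z : sphere (0 : E n) 1) => (2 : ℝ) • (z : E n))

end SingularPoly

end

/-!
# Green representation of positive solutions with a small singular set

Write `u = v + W`, where `v = η u` with a cutoff `η` equal to `1` near `Λ` and supported in `B_2`
away from the pole `x`. The function `W` is of class `C^{2m}` up to the boundary, and the
representation formula for it (`IsNavierGreenFunction.representation`) follows from Green's identity
on the ball and the distributional equation of the Green function. What remains is to show that
`F = (-Δ)^m v`, which is defined off the null set `Λ`, is integrable and satisfies `∫ G(x, ·) F = 0`,
that is, that the equation has no singular part on `Λ`.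

This is `IsSingularSupersolution.integrable` and `IsSingularSupersolution.integral_mul_eq_zero`.
Let `p = (n+2m)/(n-2m)`, with conjugate exponent `p' = (n+2m)/(4m)`, and let `ζ` be a cutoff which
vanishes in the `ε`-neighbourhood of `Λ` and is `1` off the `3ε`-neighbourhood. For a test function
`g` with `v (-Δ)^m g = 0`, integration by parts gives
`∫ ζ^{n+2m} g F = ∫ v (-Δ)^m (ζ^{n+2m} g)`, and the integrand on the right is bounded by
`C ε^{-2m} ζ^n v` and supported in the `4ε`-neighbourhood of `Λ`. By Young's inequality with a
parameter `t` the integral is at most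
`C (t^p ∫ ζ^{n+2m} v^p + t^{-p'} ε^{-2mp'} |Λ_{4ε}|)`. Under both hypotheses on `Λ` the
neighbourhoods have volume `O(ε^{(n+2m)/2})`, and `2mp' = (n+2m)/2`, so that the last term is
`O(t^{-p'})`; near `Λ` the equation bounds `v^p` by `F`. With `g = 1` on the support of `v` and `t`
small, the first term is absorbed, and `F` is integrable. With `g = G(x, ·)` on the support of `v`,
the first term tends to `0` as `ε → 0`, and then `t → ∞` gives `∫ G(x, ·) F = 0`. No sign of the
intermediate powers of the Laplacian is needed.

The Green function is constructed as `c (|y - x|^{2m-n} - h)` (`exists_isNavierGreenFunction`).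
That `|y - x|^{2m-n}` is a fundamental solution is seen by regularizing it to
`(|y - x|² + ε²)^{m-n/2}`. The regular part `h` solves a chain of Dirichlet problems on the ball whose
boundary values are powers of `|y - x|²`, which agree on `∂B_2` with powers of a quadratic function
vanishing only at the reflection of `x` (`exists_regularPart`). All functions that occur are finite
sums of `|y|^{2j}` times harmonic functions on a ball larger than `B_2`, and for such right-hand
sides the Dirichlet problem is solved explicitly by a radial integral (`IsAlmansi.exists_dirichlet`);
this gives smoothness up to the boundary without elliptic regularity theory.
-/

namespace SingularPoly

/-! ### Powers of the Laplacian -/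

section

variable {n : ℕ}

/-- The `i`-th standard basis vector of `ℝⁿ`. -/
noncomputable abbrev bv (i : Fin n) : E n := EuclideanSpace.single i (1 : ℝ)

lemma laplacianWithin_eq_sum (f : E n → ℝ) (s : Set (E n)) (x : E n) :
    InnerProductSpace.laplacianWithin f s x =
      ∑ i, fderivWithin ℝ (fderivWithin ℝ f s) s x (bv i) (bv i) := by
  rw [InnerProductSpace.laplacianWithin,
    InnerProductSpace.canonicalCovariantTensor_eq_sum (E n) (EuclideanSpace.basisFun (Fin n) ℝ)]
  simp [tensorIteratedFDerivWithinTwo, bilinearIteratedFDerivWithinTwo]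

lemma negLaplacianPow_zero (s : Set (E n)) (f : E n → ℝ) : negLaplacianPow s 0 f = f := rfl

lemma negLaplacianPow_succ (s : Set (E n)) (j : ℕ) (f : E n → ℝ) :
    negLaplacianPow s (j + 1) f = negLaplacianPow s 1 (negLaplacianPow s j f) := by
  simp only [negLaplacianPow, Function.iterate_succ_apply', Function.iterate_zero, id]

lemma negLaplacianPow_succ' (s : Set (E n)) (j : ℕ) (f : E n → ℝ) :
    negLaplacianPow s (j + 1) f = negLaplacianPow s j (negLaplacianPow s 1 f) := by
  simp only [negLaplacianPow, Function.iterate_succ_apply, Function.iterate_zero, id]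

lemma negLaplacianPow_one (s : Set (E n)) (f : E n → ℝ) (x : E n) :
    negLaplacianPow s 1 f x = -∑ i, fderivWithin ℝ (fderivWithin ℝ f s) s x (bv i) (bv i) := by
  simp only [negLaplacianPow, Function.iterate_succ_apply', Function.iterate_zero, id,
    laplacianWithin_eq_sum]

lemma negLaplacianPow_one_univ (f : E n → ℝ) (x : E n) :
    negLaplacianPow univ 1 f x = -∑ i, fderiv ℝ (fderiv ℝ f) x (bv i) (bv i) := by
  simp only [negLaplacianPow_one, fderivWithin_univ]

lemma fderivWithin_eqOn_of_inter_eq {F : Type*} [NormedAddCommGroup F] [NormedSpace ℝ F]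
    {s t U : Set (E n)} (hU : IsOpen U) (hst : s ∩ U = t ∩ U)
    {f g : E n → F} (hfg : EqOn f g (s ∩ U)) :
    EqOn (fderivWithin ℝ f s) (fderivWithin ℝ g t) (s ∩ U) := by
  intro x hx
  have h1 : s =ᶠ[𝓝 x] t := by
    filter_upwards [hU.mem_nhds hx.2] with y hy
    have := Set.ext_iff.1 hst y
    simp only [mem_inter_iff, hy, and_true] at this
    exact propext this
  rw [← fderivWithin_congr_set h1]
  refine Filter.EventuallyEq.fderivWithin_eq ?_ (hfg hx)
  filter_upwards [self_mem_nhdsWithin, mem_nhdsWithin_of_mem_nhds (hU.mem_nhds hx.2)] with y h1 h2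
  exact hfg ⟨h1, h2⟩

/-- Iterated Laplacians are local: they only see the function and the set in a neighbourhood. -/
lemma negLaplacianPow_congr {s t U : Set (E n)} (hU : IsOpen U) (hst : s ∩ U = t ∩ U)
    {f g : E n → ℝ} (hfg : EqOn f g (s ∩ U)) (j : ℕ) :
    EqOn (negLaplacianPow s j f) (negLaplacianPow t j g) (s ∩ U) := by
  induction j with
  | zero => exact hfg
  | succ j ih =>
    intro x hx
    rw [negLaplacianPow_succ s j, negLaplacianPow_succ t j, negLaplacianPow_one,
      negLaplacianPow_one]
    have h2 := fderivWithin_eqOn_of_inter_eq hU hst (fderivWithin_eqOn_of_inter_eq hU hst ih) hx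
    rw [h2]

lemma negLaplacianPow_congr_of_eqOn {s U : Set (E n)} (hU : IsOpen U)
    {f g : E n → ℝ} (hfg : EqOn f g (s ∩ U)) (j : ℕ) :
    EqOn (negLaplacianPow s j f) (negLaplacianPow s j g) (s ∩ U) :=
  negLaplacianPow_congr hU rfl hfg j

/-- On an open subset `U` of `s`, `(-Δ)^j` relative to `s` is the usual one. -/
lemma negLaplacianPow_eqOn_univ {s U : Set (E n)} (hU : IsOpen U) (hUs : U ⊆ s)
    {f g : E n → ℝ} (hfg : EqOn f g U) (j : ℕ) :
    EqOn (negLaplacianPow s j f) (negLaplacianPow univ j g) U := by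
  have h : s ∩ U = univ ∩ U := by rw [inter_eq_right.2 hUs, univ_inter]
  have h2 := negLaplacianPow_congr hU h (f := f) (g := g)
    (by rw [inter_eq_right.2 hUs]; exact hfg) j
  rwa [inter_eq_right.2 hUs] at h2

lemma contDiffOn_negLaplacianPow_one {s : Set (E n)} (hs : UniqueDiffOn ℝ s)
    {N : WithTop ℕ∞} {f : E n → ℝ} (hf : ContDiffOn ℝ (N + 2) f s) :
    ContDiffOn ℝ N (negLaplacianPow s 1 f) s := by
  have h1 : ContDiffOn ℝ (N + 1) (fderivWithin ℝ f s) s :=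
    hf.fderivWithin hs (by rw [add_assoc, one_add_one_eq_two])
  have h2 : ContDiffOn ℝ N (fderivWithin ℝ (fderivWithin ℝ f s) s) s := h1.fderivWithin hs le_rfl
  have h3 : negLaplacianPow s 1 f =
      fun x => -∑ i, fderivWithin ℝ (fderivWithin ℝ f s) s x (bv i) (bv i) := by
    ext x; exact negLaplacianPow_one s f x
  rw [h3]
  refine ContDiffOn.neg (ContDiffOn.sum fun i _ => ?_)
  exact (h2.clm_apply contDiffOn_const).clm_apply contDiffOn_const

lemma contDiffOn_negLaplacianPow {s : Set (E n)} (hs : UniqueDiffOn ℝ s) (j : ℕ)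
    {N M : WithTop ℕ∞} {f : E n → ℝ} (hf : ContDiffOn ℝ M f s) (hM : N + 2 * j ≤ M) :
    ContDiffOn ℝ N (negLaplacianPow s j f) s := by
  induction j generalizing N with
  | zero => exact hf.of_le (by simpa using hM)
  | succ j ih =>
    rw [negLaplacianPow_succ]
    apply contDiffOn_negLaplacianPow_one hs
    apply ih
    refine le_trans (le_of_eq ?_) hM
    push_cast; ring

lemma contDiff_negLaplacianPow {j : ℕ} {f : E n → ℝ} {N M : WithTop ℕ∞} (hf : ContDiff ℝ M f)
    (hM : N + 2 * j ≤ M) : ContDiff ℝ N (negLaplacianPow univ j f) := by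
  rw [← contDiffOn_univ] at *
  exact contDiffOn_negLaplacianPow uniqueDiffOn_univ j hf hM

lemma contDiff_infty_negLaplacianPow {j : ℕ} {f : E n → ℝ} (hf : ContDiff ℝ ∞ f) :
    ContDiff ℝ ∞ (negLaplacianPow univ j f) :=
  contDiff_negLaplacianPow hf (by
    have h : ((∞ : WithTop ℕ∞)) + 2 * (j : WithTop ℕ∞) = ((⊤ + 2 * j : ℕ∞) : WithTop ℕ∞) := by
      push_cast; rfl
    rw [h, top_add])

lemma contDiffOn_infty_negLaplacianPow {s : Set (E n)} (hs : UniqueDiffOn ℝ s) {j : ℕ}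
    {f : E n → ℝ} (hf : ContDiffOn ℝ ∞ f s) :
    ContDiffOn ℝ ∞ (negLaplacianPow s j f) s :=
  contDiffOn_negLaplacianPow hs j hf (by
    have h : ((∞ : WithTop ℕ∞)) + 2 * (j : WithTop ℕ∞) = ((⊤ + 2 * j : ℕ∞) : WithTop ℕ∞) := by
      push_cast; rfl
    rw [h, top_add])

lemma negLaplacianPow_const_smul {s : Set (E n)} (hs : UniqueDiffOn ℝ s) (c : ℝ) (f : E n → ℝ)
    (j : ℕ) :
    EqOn (negLaplacianPow s j (fun x => c * f x)) (fun x => c * negLaplacianPow s j f x) s := by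
  induction j with
  | zero => intro x _; rfl
  | succ j ih =>
    intro x hx
    have h0 := negLaplacianPow_congr_of_eqOn isOpen_univ (s := s)
      (by rw [inter_univ]; exact ih) 1 ⟨hx, trivial⟩
    rw [negLaplacianPow_succ s j, h0]
    simp only [negLaplacianPow_succ s j]
    set g := negLaplacianPow s j f
    have h1 : EqOn (fderivWithin ℝ (fun x => c * g x) s) (fun x => c • fderivWithin ℝ g s x) s := by
      intro y hy
      exact fderivWithin_const_smul_field (𝕜 := ℝ) (f := g) (s := s) (x := y) c (hs y hy)
    have h2 : fderivWithin ℝ (fderivWithin ℝ (fun x => c * g x) s) s x =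
        c • fderivWithin ℝ (fderivWithin ℝ g s) s x := by
      rw [fderivWithin_congr h1 (h1 hx)]
      exact fderivWithin_const_smul_field (𝕜 := ℝ) (f := fderivWithin ℝ g s) c (hs x hx)
    rw [negLaplacianPow_one, negLaplacianPow_one, h2]
    simp [Finset.mul_sum]

lemma negLaplacianPow_zero_fun (s : Set (E n)) (j : ℕ) :
    negLaplacianPow s j (fun _ => (0 : ℝ)) = fun _ => 0 := by
  induction j with
  | zero => rfl
  | succ j ih =>
    rw [negLaplacianPow_succ s j, ih]
    ext x
    have h : fderivWithin ℝ (fun _ : E n => (0 : ℝ)) s = fun _ => 0 := by ext1 y; simp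
    rw [negLaplacianPow_one, h]
    simp

lemma negLaplacianPow_add {s : Set (E n)} (hs : UniqueDiffOn ℝ s) (j : ℕ)
    {f g : E n → ℝ} (hf : ContDiffOn ℝ ((2 * j : ℕ) : WithTop ℕ∞) f s)
    (hg : ContDiffOn ℝ ((2 * j : ℕ) : WithTop ℕ∞) g s) :
    EqOn (negLaplacianPow s j (fun x => f x + g x))
      (fun x => negLaplacianPow s j f x + negLaplacianPow s j g x) s := by
  induction j with
  | zero => intro x _; rfl
  | succ j ih =>
    have e : ((2 * (j + 1) : ℕ) : WithTop ℕ∞) = 2 + 2 * (j : WithTop ℕ∞) := by push_cast; ring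
    have hle : ((2 * j : ℕ) : WithTop ℕ∞) ≤ ((2 * (j + 1) : ℕ) : WithTop ℕ∞) := by
      exact_mod_cast (by omega : 2 * j ≤ 2 * (j + 1))
    have ih' := ih (hf.of_le hle) (hg.of_le hle)
    have hF : ContDiffOn ℝ 2 (negLaplacianPow s j f) s :=
      contDiffOn_negLaplacianPow hs j hf e.ge
    have hG : ContDiffOn ℝ 2 (negLaplacianPow s j g) s :=
      contDiffOn_negLaplacianPow hs j hg e.ge
    intro x hx
    have h1 := negLaplacianPow_congr_of_eqOn isOpen_univ (s := s)
      (by rw [inter_univ]; exact ih') 1 ⟨hx, trivial⟩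
    rw [negLaplacianPow_succ, h1]
    simp only [negLaplacianPow_succ _ j]
    have h := ContDiffWithinAt.laplacianWithin_add (hF x hx) (hG x hx) hs hx
    simp only [negLaplacianPow, Function.iterate_succ_apply', Function.iterate_zero, id] at h ⊢
    rw [← neg_add, ← h]
    rfl

lemma negLaplacianPow_sub {s : Set (E n)} (hs : UniqueDiffOn ℝ s) (j : ℕ)
    {f g : E n → ℝ} (hf : ContDiffOn ℝ ((2 * j : ℕ) : WithTop ℕ∞) f s)
    (hg : ContDiffOn ℝ ((2 * j : ℕ) : WithTop ℕ∞) g s) :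
    EqOn (negLaplacianPow s j (fun x => f x - g x))
      (fun x => negLaplacianPow s j f x - negLaplacianPow s j g x) s := by
  intro x hx
  have h1 := negLaplacianPow_add hs j hf (g := fun x => (-1) * g x)
    (contDiffOn_const.mul hg) hx
  have h2 := negLaplacianPow_const_smul hs (-1) g j hx
  beta_reduce at h1 h2 ⊢
  rw [h2] at h1
  simpa only [neg_one_mul, ← sub_eq_add_neg] using h1

lemma negLaplacianPow_eq_zero_of_notMem_tsupport {f : E n → ℝ} {j : ℕ} {x : E n}
    (hx : x ∉ tsupport f) : negLaplacianPow univ j f x = 0 := by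
  have h := negLaplacianPow_congr_of_eqOn (s := univ) (f := f) (g := fun _ => 0)
    (isClosed_tsupport f).isOpen_compl
    (fun y hy => image_eq_zero_of_notMem_tsupport hy.2) j ⟨trivial, hx⟩
  rw [h, negLaplacianPow_zero_fun]

lemma tsupport_negLaplacianPow_subset (f : E n → ℝ) (j : ℕ) :
    tsupport (negLaplacianPow univ j f) ⊆ tsupport f := by
  refine closure_minimal ?_ (isClosed_tsupport f)
  intro x hx
  by_contra h
  exact hx (negLaplacianPow_eq_zero_of_notMem_tsupport h)

lemma uniqueDiffOn_closedBall_sdiff {t : Set (E n)} (ht : IsClosed t) :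
    UniqueDiffOn ℝ (closedBall (0 : E n) 2 \ t) := by
  rw [sdiff_eq]
  refine UniqueDiffOn.inter ?_ ht.isOpen_compl
  refine uniqueDiffOn_convex (convex_closedBall _ _) ?_
  rw [interior_closedBall _ (by norm_num)]
  exact ⟨0, by simp⟩

lemma uniqueDiffOn_closedBall_two : UniqueDiffOn ℝ (closedBall (0 : E n) 2) := by
  simpa using uniqueDiffOn_closedBall_sdiff (n := n) isClosed_empty

end

/-! ### Integration by parts against test functions -/

section

variable {n : ℕ}

lemma continuous_mul_of_tsupport_subset {Ω : Set (E n)} (hΩ : IsOpen Ω) {a b : E n → ℝ}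
    (ha : Continuous a) (hs : tsupport a ⊆ Ω) (hb : ContinuousOn b Ω) :
    Continuous fun y => a y * b y := by
  refine continuous_of_tsupport fun y hy => ?_
  have hy' : y ∈ Ω := hs (closure_mono (Function.support_mul_subset_left a b) hy)
  exact ha.continuousAt.mul (hb.continuousAt (hΩ.mem_nhds hy'))

lemma integrable_mul_of_tsupport_subset {Ω : Set (E n)} (hΩ : IsOpen Ω) {a b : E n → ℝ}
    (ha : Continuous a) (hac : HasCompactSupport a) (hs : tsupport a ⊆ Ω)
    (hb : ContinuousOn b Ω) : Integrable fun y => a y * b y :=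
  (continuous_mul_of_tsupport_subset hΩ ha hs hb).integrable_of_hasCompactSupport hac.mul_right

lemma tsupport_fderiv_apply_subset {f : E n → ℝ} (v : E n) :
    tsupport (fun y => fderiv ℝ f y v) ⊆ tsupport f := by
  refine closure_minimal ?_ (isClosed_tsupport f)
  intro x hx
  by_contra h
  apply hx
  have h2 : fderiv ℝ f x = 0 := by
    by_contra h3
    exact h (support_fderiv_subset ℝ h3)
  simp [h2]

lemma hasCompactSupport_fderiv_apply {f : E n → ℝ} (hf : HasCompactSupport f) (v : E n) :
    HasCompactSupport (fun y => fderiv ℝ f y v) :=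
  hf.of_isClosed_subset (isClosed_tsupport _) (tsupport_fderiv_apply_subset v)

/-- Integration by parts in one direction, against a test function supported where `f` is `C¹`. -/
lemma integral_mul_fderiv_of_tsupport_subset {Ω : Set (E n)} (hΩ : IsOpen Ω) {ψ f : E n → ℝ}
    (hψ : ContDiff ℝ 1 ψ) (hψc : HasCompactSupport ψ) (hs : tsupport ψ ⊆ Ω)
    (hf : ContDiffOn ℝ 1 f Ω) (v : E n) :
    ∫ y, ψ y * fderiv ℝ f y v = -∫ y, fderiv ℝ ψ y v * f y := by
  have hψ' : Continuous fun y => fderiv ℝ ψ y v :=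
    (hψ.continuous_fderiv one_ne_zero).clm_apply continuous_const
  have hf' : ContinuousOn (fun y => fderiv ℝ f y v) Ω :=
    ((hf.continuousOn_fderiv_of_isOpen hΩ le_rfl)).clm_apply continuousOn_const
  refine integral_mul_fderiv_eq_neg_fderiv_mul_of_integrable ?_ ?_ ?_ ?_ ?_
  · exact integrable_mul_of_tsupport_subset hΩ hψ' (hasCompactSupport_fderiv_apply hψc v)
      ((tsupport_fderiv_apply_subset v).trans hs) hf.continuousOn
  · exact integrable_mul_of_tsupport_subset hΩ hψ.continuous hψc hs hf'
  · exact integrable_mul_of_tsupport_subset hΩ hψ.continuous hψc hs hf.continuousOn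
  · intro x _; exact hψ.differentiable one_ne_zero x
  · intro x hx
    exact (hf.differentiableOn one_ne_zero).differentiableAt (hΩ.mem_nhds (hs hx))

lemma fderiv_fderiv_apply {f : E n → ℝ} {x : E n} (hf : DifferentiableAt ℝ (fderiv ℝ f) x)
    (v w : E n) : fderiv ℝ (fun y => fderiv ℝ f y v) x w = fderiv ℝ (fderiv ℝ f) x w v := by
  rw [fderiv_clm_apply hf (differentiableAt_const v)]
  simp

lemma differentiableOn_fderiv {Ω : Set (E n)} (hΩ : IsOpen Ω) {f : E n → ℝ}
    (hf : ContDiffOn ℝ 2 f Ω) {x : E n} (hx : x ∈ Ω) : DifferentiableAt ℝ (fderiv ℝ f) x := by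
  have h : ContDiffOn ℝ 1 (fderiv ℝ f) Ω :=
    hf.fderiv_of_isOpen hΩ (by rw [one_add_one_eq_two])
  exact (h.differentiableOn one_ne_zero).differentiableAt (hΩ.mem_nhds hx)

lemma integral_mul_negLaplacianPow_one {Ω : Set (E n)} (hΩ : IsOpen Ω) {ψ f : E n → ℝ}
    (hψ : ContDiff ℝ 2 ψ) (hψc : HasCompactSupport ψ) (hs : tsupport ψ ⊆ Ω)
    (hf : ContDiffOn ℝ 2 f Ω) :
    ∫ y, ψ y * negLaplacianPow univ 1 f y = ∫ y, negLaplacianPow univ 1 ψ y * f y := by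
  have hψ1 : ContDiff ℝ 1 (fderiv ℝ ψ) := hψ.fderiv_right (by rw [one_add_one_eq_two])
  have hf1 : ContDiffOn ℝ 1 (fderiv ℝ f) Ω :=
    hf.fderiv_of_isOpen hΩ (by rw [one_add_one_eq_two])
  have e1 : ∀ y, ψ y * negLaplacianPow univ 1 f y =
      -∑ i, ψ y * fderiv ℝ (fun z => fderiv ℝ f z (bv i)) y (bv i) := by
    intro y
    by_cases hy : y ∈ tsupport ψ
    · rw [negLaplacianPow_one_univ, mul_neg, Finset.mul_sum]
      congr 1
      refine Finset.sum_congr rfl fun i _ => ?_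
      rw [fderiv_fderiv_apply (differentiableOn_fderiv hΩ hf (hs hy))]
    · simp [image_eq_zero_of_notMem_tsupport hy]
  have e2 : ∀ y, negLaplacianPow univ 1 ψ y * f y =
      -∑ i, fderiv ℝ (fun z => fderiv ℝ ψ z (bv i)) y (bv i) * f y := by
    intro y
    rw [negLaplacianPow_one_univ, neg_mul, Finset.sum_mul]
    congr 1
    refine Finset.sum_congr rfl fun i _ => ?_
    rw [fderiv_fderiv_apply ((hψ1.differentiable one_ne_zero) y)]
  have hψi : ∀ i : Fin n, ContDiff ℝ 1 fun z => fderiv ℝ ψ z (bv i) :=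
    fun i => hψ1.clm_apply contDiff_const
  have hfi : ∀ i : Fin n, ContDiffOn ℝ 1 (fun z => fderiv ℝ f z (bv i)) Ω :=
    fun i => hf1.clm_apply contDiffOn_const
  have hsi : ∀ i : Fin n, tsupport (fun z => fderiv ℝ ψ z (bv i)) ⊆ Ω :=
    fun i => (tsupport_fderiv_apply_subset _).trans hs
  simp only [e1, e2]
  rw [integral_neg, integral_neg, integral_finsetSum, integral_finsetSum]
  · congr 1
    refine Finset.sum_congr rfl fun i _ => ?_
    rw [integral_mul_fderiv_of_tsupport_subset hΩ (hψ.of_le one_le_two) hψc hs (hfi i),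
      ← integral_neg]
    have h := integral_mul_fderiv_of_tsupport_subset hΩ (hψi i)
      (hasCompactSupport_fderiv_apply hψc _) (hsi i) (hf.of_le one_le_two) (bv i)
    rw [integral_neg, h, neg_neg]
  · intro i _
    refine integrable_mul_of_tsupport_subset hΩ ?_
      (hasCompactSupport_fderiv_apply (hasCompactSupport_fderiv_apply hψc _) _)
      ((tsupport_fderiv_apply_subset _).trans (hsi i)) hf.continuousOn
    exact ((hψi i).continuous_fderiv one_ne_zero).clm_apply continuous_const
  · intro i _
    refine integrable_mul_of_tsupport_subset hΩ hψ.continuous hψc hs ?_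
    exact ((hfi i).continuousOn_fderiv_of_isOpen hΩ le_rfl).clm_apply continuousOn_const

/-- Self-adjointness of `(-Δ)^m` against a test function supported where `f` is `C^{2m}`. -/
lemma integral_mul_negLaplacianPow {Ω : Set (E n)} (hΩ : IsOpen Ω) (m : ℕ) {ψ f : E n → ℝ}
    (hψ : ContDiff ℝ ∞ ψ) (hψc : HasCompactSupport ψ) (hs : tsupport ψ ⊆ Ω)
    (hf : ContDiffOn ℝ ((2 * m : ℕ) : WithTop ℕ∞) f Ω) :
    ∫ y, ψ y * negLaplacianPow univ m f y = ∫ y, negLaplacianPow univ m ψ y * f y := by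
  induction m generalizing ψ with
  | zero => rfl
  | succ m ih =>
    have e : ((2 * (m + 1) : ℕ) : WithTop ℕ∞) = 2 + 2 * (m : WithTop ℕ∞) := by push_cast; ring
    have hle : ((2 * m : ℕ) : WithTop ℕ∞) ≤ ((2 * (m + 1) : ℕ) : WithTop ℕ∞) := by
      exact_mod_cast (by omega : 2 * m ≤ 2 * (m + 1))
    have hfm : ContDiffOn ℝ 2 (negLaplacianPow univ m f) Ω :=
      (contDiffOn_negLaplacianPow hΩ.uniqueDiffOn m hf e.ge).congr fun y hy =>
        (negLaplacianPow_eqOn_univ hΩ subset_rfl (fun _ _ => rfl) m hy).symm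
    rw [negLaplacianPow_succ univ m f,
      integral_mul_negLaplacianPow_one hΩ (contDiff_infty.1 hψ 2) hψc hs hfm,
      negLaplacianPow_succ' univ m ψ]
    exact ih (contDiff_infty_negLaplacianPow hψ)
      (hψc.of_isClosed_subset (isClosed_tsupport _) (tsupport_negLaplacianPow_subset ψ 1))
      ((tsupport_negLaplacianPow_subset ψ 1).trans hs) (hf.of_le hle)

end

/-! ### Mollification -/

section

variable {n : ℕ}

open scoped Convolution

lemma fderiv_convolution_apply {ρ g : E n → ℝ} (hρ : LocallyIntegrable ρ)
    (hg : ContDiff ℝ 1 g)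
    (hgc : HasCompactSupport g) (v x : E n) :
    fderiv ℝ (ρ ⋆[ContinuousLinearMap.lsmul ℝ ℝ, volume] g) x v =
      (ρ ⋆[ContinuousLinearMap.lsmul ℝ ℝ, volume] fun y => fderiv ℝ g y v) x := by
  rw [(hgc.hasFDerivAt_convolution_right (ContinuousLinearMap.lsmul ℝ ℝ)
    hρ hg x).fderiv]
  exact convolution_precompR_apply (ContinuousLinearMap.lsmul ℝ ℝ) hρ
    (hgc.fderiv ℝ) (hg.continuous_fderiv one_ne_zero) x v

lemma negLaplacianPow_one_convolution {ρ g : E n → ℝ} (hρ : ContDiff ℝ ∞ ρ)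
    (hρc : HasCompactSupport ρ) (hg : ContDiff ℝ 2 g) (hgc : HasCompactSupport g) :
    negLaplacianPow univ 1 (ρ ⋆[ContinuousLinearMap.lsmul ℝ ℝ, volume] g) =
      ρ ⋆[ContinuousLinearMap.lsmul ℝ ℝ, volume] (negLaplacianPow univ 1 g) := by
  ext x
  have hsm : ContDiff ℝ ∞ (ρ ⋆[ContinuousLinearMap.lsmul ℝ ℝ, volume] g) :=
    hρc.contDiff_convolution_left _ hρ hg.continuous.locallyIntegrable
  have hg1 : ContDiff ℝ 1 (fderiv ℝ g) := hg.fderiv_right (by rw [one_add_one_eq_two])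
  have hgi : ∀ i : Fin n, ContDiff ℝ 1 fun z => fderiv ℝ g z (bv i) :=
    fun i => hg1.clm_apply contDiff_const
  have e1 : ∀ i : Fin n, fderiv ℝ (fderiv ℝ (ρ ⋆[ContinuousLinearMap.lsmul ℝ ℝ, volume] g)) x
      (bv i) (bv i) = (ρ ⋆[ContinuousLinearMap.lsmul ℝ ℝ, volume]
        fun y => fderiv ℝ (fun z => fderiv ℝ g z (bv i)) y (bv i)) x := by
    intro i
    rw [← fderiv_fderiv_apply (differentiableOn_fderiv isOpen_univ
      (contDiff_infty.1 hsm 2).contDiffOn (mem_univ x))]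
    rw [← fderiv_convolution_apply hρ.continuous.locallyIntegrable (hgi i) (hasCompactSupport_fderiv_apply hgc _)]
    congr 2
    ext y
    exact fderiv_convolution_apply hρ.continuous.locallyIntegrable (hg.of_le one_le_two) hgc _ _
  rw [negLaplacianPow_one_univ]
  simp only [e1]
  have hint : ∀ i : Fin n, Integrable fun t => ρ t *
      fderiv ℝ (fun z => fderiv ℝ g z (bv i)) (x - t) (bv i) := by
    intro i
    refine Continuous.integrable_of_hasCompactSupport ?_ hρc.mul_right
    refine hρ.continuous.mul ?_
    exact (((hgi i).continuous_fderiv one_ne_zero).comp (continuous_const.sub continuous_id)).clm_apply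
      continuous_const
  simp only [convolution_def, ContinuousLinearMap.lsmul_apply, smul_eq_mul]
  rw [← integral_finsetSum _ fun i _ => hint i, ← integral_neg]
  congr 1
  ext t
  rw [negLaplacianPow_one_univ, mul_neg, Finset.mul_sum]
  congr 1
  refine Finset.sum_congr rfl fun i _ => ?_
  rw [fderiv_fderiv_apply ((hg1.differentiable one_ne_zero) _)]

lemma negLaplacianPow_convolution {ρ : E n → ℝ} (hρ : ContDiff ℝ ∞ ρ)
    (hρc : HasCompactSupport ρ) (m : ℕ) {g : E n → ℝ}
    (hg : ContDiff ℝ ((2 * m : ℕ) : WithTop ℕ∞) g) (hgc : HasCompactSupport g) :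
    negLaplacianPow univ m (ρ ⋆[ContinuousLinearMap.lsmul ℝ ℝ, volume] g) =
      ρ ⋆[ContinuousLinearMap.lsmul ℝ ℝ, volume] (negLaplacianPow univ m g) := by
  induction m with
  | zero => rfl
  | succ m ih =>
    have e : ((2 * (m + 1) : ℕ) : WithTop ℕ∞) = 2 + 2 * (m : WithTop ℕ∞) := by push_cast; ring
    have hle : ((2 * m : ℕ) : WithTop ℕ∞) ≤ ((2 * (m + 1) : ℕ) : WithTop ℕ∞) := by
      exact_mod_cast (by omega : 2 * m ≤ 2 * (m + 1))
    rw [negLaplacianPow_succ univ m, ih (hg.of_le hle), negLaplacianPow_succ univ m]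
    exact negLaplacianPow_one_convolution hρ hρc (contDiff_negLaplacianPow hg e.ge)
      (hgc.of_isClosed_subset (isClosed_tsupport _) (tsupport_negLaplacianPow_subset g m))

/-- A distributional identity `(-Δ)^m g = δ_x` extends from smooth test functions to test functions
of class `C^{2m}`, by mollification. -/
lemma integral_mul_negLaplacianPow_eq_of_contDiff {g : E n → ℝ} {x : E n} {m : ℕ}
    (hg : IntegrableOn g (ball 0 2))
    (h : ∀ φ : E n → ℝ, ContDiff ℝ ∞ φ → HasCompactSupport φ → tsupport φ ⊆ ball 0 2 →
      ∫ y in ball (0 : E n) 2, g y * negLaplacianPow univ m φ y = φ x)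
    {φ : E n → ℝ} (hφ : ContDiff ℝ ((2 * m : ℕ) : WithTop ℕ∞) φ) (hφc : HasCompactSupport φ)
    (hs : tsupport φ ⊆ ball 0 2) :
    ∫ y in ball (0 : E n) 2, g y * negLaplacianPow univ m φ y = φ x := by
  obtain ⟨δ, hδ, hδs⟩ := hφc.isCompact.exists_cthickening_subset_open isOpen_ball hs
  have hδk : ∀ k : ℕ, 0 < δ / (k + 1) := fun k => by positivity
  let b : ℕ → ContDiffBump (0 : E n) := fun k =>
    ⟨δ / (k + 1) / 2, δ / (k + 1), half_pos (hδk k), half_lt_self (hδk k)⟩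
  have hb : Tendsto (fun k => (b k).rOut) atTop (𝓝 0) := by
    have := tendsto_const_div_atTop_nhds_zero_nat δ
    exact (tendsto_add_atTop_iff_nat (f := fun k : ℕ => δ / (k : ℝ)) 1).2 this |>.congr
      fun k => by simp [b]
  -- the mollifiers have radius at most `δ`, so that `ρ k ⋆ φ` is still supported in the open ball
  set ρ : ℕ → E n → ℝ := fun k => (b k).normed volume with hρdef
  have hρ : ∀ k, ContDiff ℝ ∞ (ρ k) := fun k => (b k).contDiff_normed
  have hρc : ∀ k, HasCompactSupport (ρ k) := fun k => (b k).hasCompactSupport_normed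
  set H := negLaplacianPow univ m φ with hH
  have hHc : Continuous H := (contDiff_negLaplacianPow (N := 0) (j := m) hφ (by simp)).continuous
  have hHs : HasCompactSupport H :=
    hφc.of_isClosed_subset (isClosed_tsupport _) (tsupport_negLaplacianPow_subset φ m)
  obtain ⟨M, hM⟩ := hHc.bounded_above_of_compact_support hHs
  have key : ∀ k, ∫ y in ball (0 : E n) 2, g y *
      (ρ k ⋆[ContinuousLinearMap.lsmul ℝ ℝ, volume] H) y =
        (ρ k ⋆[ContinuousLinearMap.lsmul ℝ ℝ, volume] φ) x := by
    intro k
    rw [hH, ← negLaplacianPow_convolution (hρ k) (hρc k) m hφ hφc]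
    refine h _ ((hρc k).contDiff_convolution_left _ (hρ k) hφ.continuous.locallyIntegrable)
      ((hρc k).convolution _ hφc) ?_
    refine subset_trans (closure_minimal ?_ isClosed_cthickening) hδs
    intro z hz
    obtain ⟨a, ha, c, hc, rfl⟩ := support_convolution_subset (ContinuousLinearMap.lsmul ℝ ℝ) hz
    rw [hρdef, (b k).support_normed_eq] at ha
    refine mem_cthickening_of_dist_le _ c _ _ (subset_closure hc) ?_
    have h1 : dist a 0 < δ / (k + 1) := ha
    have h2 : δ / (k + 1) ≤ δ := div_le_self hδ.le (by linarith [k.cast_nonneg (α := ℝ)])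
    simp only [dist_zero_right] at h1
    simp only [dist_eq_norm, add_sub_cancel_right]
    linarith
  have lim1 : Tendsto (fun k => (ρ k ⋆[ContinuousLinearMap.lsmul ℝ ℝ, volume] φ) x) atTop
      (𝓝 (φ x)) :=
    ContDiffBump.convolution_tendsto_right_of_continuous hb hφ.continuous x
  have lim2 : Tendsto (fun k => ∫ y in ball (0 : E n) 2, g y *
      (ρ k ⋆[ContinuousLinearMap.lsmul ℝ ℝ, volume] H) y) atTop
      (𝓝 (∫ y in ball (0 : E n) 2, g y * H y)) := by
    refine tendsto_integral_of_dominated_convergence (fun y => ‖g y‖ * (3 * M)) ?_ ?_ ?_ ?_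
    · intro k
      refine hg.aestronglyMeasurable.mul ?_
      exact ((hρc k).contDiff_convolution_left (n := (⊤ : ℕ∞)) _ (hρ k)
        hHc.locallyIntegrable).continuous.aestronglyMeasurable
    · exact hg.norm.mul_const _
    · intro k
      refine Eventually.of_forall fun y => ?_
      rw [norm_mul]
      gcongr
      have h1 := (b k).dist_normed_convolution_le (μ := volume) (x₀ := y) (g := H) (ε := 2 * M)
        hHc.aestronglyMeasurable (fun z _ => by
          rw [dist_eq_norm]
          refine (norm_sub_le _ _).trans ?_
          linarith [hM z, hM y])
      rw [dist_eq_norm] at h1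
      have h2 := norm_le_norm_add_norm_sub' ((ρ k ⋆[ContinuousLinearMap.lsmul ℝ ℝ, volume] H) y) (H y)
      linarith [hM y]
    · refine Eventually.of_forall fun y => ?_
      exact tendsto_const_nhds.mul
        (ContDiffBump.convolution_tendsto_right_of_continuous hb hHc y)
  simp only [key] at lim2
  exact tendsto_nhds_unique lim2 lim1

end

/-! ### The surface measure and polar coordinates -/

section

variable {n : ℕ}

lemma measurableEmbedding_two_smul :
    MeasurableEmbedding fun z : sphere (0 : E n) 1 => (2 : ℝ) • (z : E n) := by
  have h1 : MeasurableEmbedding fun z : E n => (2 : ℝ) • z :=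
    (Homeomorph.smulOfNeZero (2 : ℝ) two_ne_zero).measurableEmbedding
  exact h1.comp (MeasurableEmbedding.subtype_coe isClosed_sphere.measurableSet)

lemma integral_surfaceMeasure (F : E n → ℝ) :
    ∫ y, F y ∂(surfaceMeasure n) =
      2 ^ (n - 1) * ∫ z : sphere (0 : E n) 1, F ((2 : ℝ) • (z : E n))
        ∂((volume : Measure (E n)).toSphere) := by
  rw [surfaceMeasure, integral_smul_measure, measurableEmbedding_two_smul.integral_map]
  simp

lemma integrable_surfaceMeasure {F : E n → ℝ} (hF : ContinuousOn F (sphere 0 2)) :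
    Integrable F (surfaceMeasure n) := by
  rw [surfaceMeasure]
  refine Integrable.smul_measure ?_ (by simp)
  rw [measurableEmbedding_two_smul.integrable_map_iff]
  have hc : Continuous fun z : sphere (0 : E n) 1 => F ((2 : ℝ) • (z : E n)) := by
    refine hF.comp_continuous (by fun_prop) fun z => ?_
    simp [norm_smul]
  have : CompactSpace (sphere (0 : E n) 1) := isCompact_iff_compactSpace.1 (isCompact_sphere _ _)
  exact hc.integrable_of_hasCompactSupport (HasCompactSupport.of_compactSpace _)

lemma integral_surfaceMeasure_congr {F G : E n → ℝ} (h : EqOn F G (sphere 0 2)) :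
    ∫ y, F y ∂(surfaceMeasure n) = ∫ y, G y ∂(surfaceMeasure n) := by
  rw [integral_surfaceMeasure, integral_surfaceMeasure]
  congr 2
  ext z
  exact h (by simp [norm_smul])

/-- Integration in polar coordinates. -/
lemma integral_eq_integral_Ioi_integral_sphere (hn : 1 ≤ n) {f : E n → ℝ} (hf : Integrable f) :
    ∫ y, f y = ∫ r in Ioi (0 : ℝ), r ^ (n - 1) *
      ∫ z : sphere (0 : E n) 1, f (r • (z : E n)) ∂((volume : Measure (E n)).toSphere) := by
  have hdim : Module.finrank ℝ (E n) = n := by simp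
  have : Nontrivial (E n) := by
    apply Module.nontrivial_of_finrank_pos (R := ℝ); omega
  have hmp := (volume : Measure (E n)).measurePreserving_homeomorphUnitSphereProd
  have hemb := (homeomorphUnitSphereProd (E n)).measurableEmbedding
  let g : sphere (0 : E n) 1 × Ioi (0 : ℝ) → ℝ := fun p => f ((p.2 : ℝ) • (p.1 : E n))
  have hg : ∀ x : ({0}ᶜ : Set (E n)), g (homeomorphUnitSphereProd (E n) x) = f x := by
    intro x
    simp only [g]
    congr 1
    have hx : ‖(x : E n)‖ ≠ 0 := norm_ne_zero_iff.2 x.2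
    simp [homeomorphUnitSphereProd, smul_smul, hx]
  have hint : Integrable g
      ((volume : Measure (E n)).toSphere.prod (Measure.volumeIoiPow (Module.finrank ℝ (E n) - 1))) := by
    rw [← hmp.integrable_comp_emb hemb]
    have : (g ∘ (homeomorphUnitSphereProd (E n))) = fun x : ({0}ᶜ : Set (E n)) => f x := by
      ext x; exact hg x
    rw [this]
    have h2 : Integrable f (volume.restrict ({0}ᶜ : Set (E n))) := hf.restrict
    exact (integrableOn_iff_comap_subtypeVal (measurableSet_singleton _).compl).1 h2
  calc ∫ y, f y = ∫ x : ({0}ᶜ : Set (E n)), f x ∂(volume.comap Subtype.val) := by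
        rw [integral_subtype_comap (measurableSet_singleton _).compl f, restrict_compl_singleton]
    _ = ∫ p, g p ∂((volume : Measure (E n)).toSphere.prod
          (Measure.volumeIoiPow (Module.finrank ℝ (E n) - 1))) := by
        rw [← hmp.integral_comp hemb]
        simp only [hg]
    _ = ∫ r : Ioi (0 : ℝ), (∫ z : sphere (0 : E n) 1, f ((r : ℝ) • (z : E n))
          ∂((volume : Measure (E n)).toSphere)) ∂(Measure.volumeIoiPow (Module.finrank ℝ (E n) - 1)) :=
        integral_prod_symm _ hint
    _ = _ := by
        simp only [Measure.volumeIoiPow, ENNReal.ofReal, hdim]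
        rw [integral_withDensity_eq_integral_smul
          (by exact (measurable_subtype_coe.pow_const _).real_toNNReal),
          integral_subtype_comap measurableSet_Ioi fun a : ℝ ↦ Real.toNNReal (a ^ (n - 1)) •
            ∫ z : sphere (0 : E n) 1, f (a • (z : E n)) ∂((volume : Measure (E n)).toSphere)]
        refine setIntegral_congr_fun measurableSet_Ioi fun x hx => ?_
        beta_reduce
        rw [NNReal.smul_def, Real.coe_toNNReal _ (pow_nonneg (le_of_lt hx) _), smul_eq_mul]

lemma deriv_smoothTransition_of_one_lt {x : ℝ} (hx : 1 < x) :
    deriv Real.smoothTransition x = 0 := by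
  have : Real.smoothTransition =ᶠ[𝓝 x] fun _ => 1 := by
    filter_upwards [lt_mem_nhds hx] with y hy
    exact Real.smoothTransition.one_of_one_le hy.le
  rw [this.deriv_eq]; simp

lemma continuous_deriv_smoothTransition : Continuous (deriv Real.smoothTransition) :=
  (Real.smoothTransition.contDiff (n := 1)).continuous_deriv le_rfl

/-- The negatives of the radial derivatives of the cutoffs `τ(k (4 - |y|²) - 1)`, where `τ` is the
smooth transition from `0` to `1`, concentrate at `r = 2`. -/
lemma tendsto_integral_peak_two {g : ℝ → ℝ} (hg : ContinuousOn g (Icc 0 2)) :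
    Tendsto (fun k : ℕ => ∫ r in Ioc (0 : ℝ) 2,
      (2 * k * r * deriv Real.smoothTransition (k * (4 - r ^ 2) - 1)) • g r) atTop (𝓝 (g 2)) := by
  refine tendsto_setIntegral_peak_smul_of_integrableOn_of_tendsto (x₀ := (2 : ℝ))
    measurableSet_Ioc measurableSet_Ioc subset_rfl self_mem_nhdsWithin
    (by simp) ?_ ?_ ?_ ?_ ?_ ?_
  · refine Eventually.of_forall fun k r hr => ?_
    have h1 := Real.smoothTransition.monotone.deriv_nonneg (x := k * (4 - r ^ 2) - 1)
    have := hr.1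
    positivity
  · intro u hu h2u
    obtain ⟨δ, hδ, hδu⟩ := Metric.isOpen_iff.1 hu 2 h2u
    have hpos : 0 < min δ 1 := lt_min hδ one_pos
    rw [Metric.tendstoUniformlyOn_iff]
    intro ε hε
    obtain ⟨N, hN⟩ := exists_nat_gt (2 / min δ 1)
    filter_upwards [eventually_ge_atTop N] with k hk r hr
    have hr2 : r ≤ 2 - min δ 1 := by
      by_contra hlt
      push Not at hlt
      apply hr.2
      apply hδu
      rw [Metric.mem_ball, Real.dist_eq, abs_lt]
      constructor <;> linarith [hr.1.2, min_le_left δ 1]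
    have hk' : 2 < k * min δ 1 := by
      have : (N : ℝ) ≤ k := by exact_mod_cast hk
      rw [div_lt_iff₀ hpos] at hN
      nlinarith
    have h4 : min δ 1 ≤ 4 - r ^ 2 := by nlinarith [hr.1.1, min_le_right δ 1]
    have : 1 < (k : ℝ) * (4 - r ^ 2) - 1 := by
      have : (k : ℝ) * min δ 1 ≤ k * (4 - r ^ 2) := by gcongr
      linarith
    rw [deriv_smoothTransition_of_one_lt this]
    simpa using hε
  · refine tendsto_const_nhds.congr' ?_
    filter_upwards [eventually_ge_atTop 1] with k hk
    have hk1 : (1 : ℝ) ≤ k := by exact_mod_cast hk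
    rw [← intervalIntegral.integral_of_le (by norm_num : (0 : ℝ) ≤ 2)]
    have hd : ∀ r ∈ uIcc (0 : ℝ) 2, HasDerivAt
        (fun r : ℝ => -Real.smoothTransition (k * (4 - r ^ 2) - 1))
        (2 * k * r * deriv Real.smoothTransition (k * (4 - r ^ 2) - 1)) r := by
      intro r _
      have h1 : HasDerivAt (fun r : ℝ => (k : ℝ) * (4 - r ^ 2) - 1) (k * (-(2 * r))) r := by
        have := (((hasDerivAt_pow 2 r).const_sub 4).const_mul (k : ℝ)).sub_const 1
        simpa using this
      have h2 : HasDerivAt Real.smoothTransition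
          (deriv Real.smoothTransition (k * (4 - r ^ 2) - 1)) (k * (4 - r ^ 2) - 1) :=
        ((Real.smoothTransition.contDiff (n := 1)).differentiable one_ne_zero _).hasDerivAt
      have h3 := (h2.comp r h1).neg
      convert! h3 using 1
      ring
    rw [intervalIntegral.integral_eq_sub_of_hasDerivAt hd]
    · rw [Real.smoothTransition.zero_of_nonpos (x := (k : ℝ) * (4 - 2 ^ 2) - 1) (by norm_num),
        Real.smoothTransition.one_of_one_le (by nlinarith)]
      norm_num
    · refine Continuous.intervalIntegrable ?_ _ _
      exact (by fun_prop : Continuous fun r : ℝ => 2 * (k : ℝ) * r).mul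
        (continuous_deriv_smoothTransition.comp (by fun_prop))
  · refine Eventually.of_forall fun k => Continuous.aestronglyMeasurable ?_
    exact (by fun_prop : Continuous fun r : ℝ => 2 * (k : ℝ) * r).mul
        (continuous_deriv_smoothTransition.comp (by fun_prop))
  · exact (hg.integrableOn_Icc).mono_set Ioc_subset_Icc_self
  · exact (hg 2 (by simp)).mono Ioc_subset_Icc_self

end

/-! ### The divergence theorem on the ball -/

section

variable {n : ℕ}

lemma continuousOn_integral_sphere {F : E n → ℝ} (hF : ContinuousOn F (closedBall 0 2)) :
    ContinuousOn (fun r : ℝ => ∫ z : sphere (0 : E n) 1, F (r • (z : E n))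
      ∂((volume : Measure (E n)).toSphere)) (Icc 0 2) := by
  obtain ⟨C, hC⟩ := (isCompact_closedBall (0 : E n) 2).exists_bound_of_continuousOn hF
  have hmem : ∀ r ∈ Icc (0 : ℝ) 2, ∀ z : sphere (0 : E n) 1, r • (z : E n) ∈ closedBall (0 : E n) 2 := by
    intro r hr z
    simp [norm_smul, abs_of_nonneg hr.1, hr.2]
  refine continuousOn_of_dominated (bound := fun _ => C) ?_ ?_ (integrable_const _) ?_
  · intro r hr
    refine Continuous.aestronglyMeasurable ?_
    exact hF.comp_continuous (by fun_prop) (hmem r hr)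
  · intro r hr
    exact Eventually.of_forall fun z => hC _ (hmem r hr z)
  · refine Eventually.of_forall fun z => ?_
    exact hF.comp (by fun_prop) fun r hr => hmem r hr z

/-- The divergence theorem on the ball of radius `2`, for a vector field which is `C¹` up to the
boundary: integrate by parts against the cutoffs `χ_k = τ(k (4 - |y|²) - 1)`. In polar coordinates
their gradients converge to the surface measure. -/
theorem integral_divergence_ball (hn : 2 ≤ n) {V : Fin n → E n → ℝ}
    (hV : ∀ i, ContDiffOn ℝ 1 (V i) (closedBall 0 2)) :
    ∫ y in ball (0 : E n) 2, ∑ i, fderivWithin ℝ (V i) (closedBall 0 2) y (bv i) =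
      ∫ y, (∑ i, V i y * (y i / 2)) ∂(surfaceMeasure n) := by
  set S := closedBall (0 : E n) 2 with hS
  set D : E n → ℝ := fun y => ∑ i, fderivWithin ℝ (V i) S y (bv i) with hD
  have hDc : ContinuousOn D S := continuousOn_finsetSum _ fun i _ =>
    ((hV i).continuousOn_fderivWithin uniqueDiffOn_closedBall_two le_rfl).clm_apply
      continuousOn_const
  have hDint : IntegrableOn D (ball 0 2) :=
    (hDc.integrableOn_compact (isCompact_closedBall _ _)).mono_set ball_subset_closedBall
  set F : E n → ℝ := fun y => ∑ i, y i * V i y with hF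
  have hFc : ContinuousOn F S := continuousOn_finsetSum _ fun i _ =>
    (by fun_prop : Continuous fun y : E n => y i).continuousOn.mul (hV i).continuousOn
  set τ := Real.smoothTransition with hτ
  set χ : ℕ → E n → ℝ := fun k y => τ (k * (4 - ‖y‖ ^ 2) - 1) with hχ
  have hχs : ∀ k, ContDiff ℝ ∞ (χ k) := by
    intro k
    refine (Real.smoothTransition.contDiff (n := (⊤ : ℕ∞))).comp ?_
    exact (contDiff_const.mul (contDiff_const.sub (contDiff_norm_sq ℝ))).sub contDiff_const
  have hχ0 : ∀ k y, y ∉ ball (0 : E n) 2 → χ k y = 0 := by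
    intro k y hy
    apply Real.smoothTransition.zero_of_nonpos
    have h2 : 2 ≤ ‖y‖ := by simpa using hy
    have : (k : ℝ) * (4 - ‖y‖ ^ 2) ≤ 0 := mul_nonpos_of_nonneg_of_nonpos (by positivity) (by nlinarith)
    linarith
  have hχsupp : ∀ k : ℕ, tsupport (χ k) ⊆ ball 0 2 := by
    intro k
    rcases Nat.eq_zero_or_pos k with rfl | hk
    · have : χ 0 = fun _ => 0 := by
        ext y; simp only [hχ]
        apply Real.smoothTransition.zero_of_nonpos; norm_num
      rw [this, tsupport, Function.support_fun_zero, closure_empty]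
      exact empty_subset _
    · have hk1 : (0 : ℝ) < k := by exact_mod_cast hk
      have hcl : IsClosed {y : E n | 1 ≤ k * (4 - ‖y‖ ^ 2)} :=
        isClosed_le continuous_const (by fun_prop)
      refine (closure_minimal ?_ hcl).trans ?_
      · intro y hy
        by_contra hlt
        simp only [mem_ofPred_eq, not_le] at hlt
        exact hy (Real.smoothTransition.zero_of_nonpos (by linarith))
      · intro y hy
        simp only [mem_ofPred_eq] at hy
        rw [mem_ball_zero_iff]
        by_contra hlt
        push Not at hlt
        have : (k : ℝ) * (4 - ‖y‖ ^ 2) ≤ 0 :=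
          mul_nonpos_of_nonneg_of_nonpos hk1.le (by nlinarith)
        linarith
  have hχc : ∀ k, HasCompactSupport (χ k) := fun k =>
    (isCompact_closedBall (0 : E n) 2).of_isClosed_subset (isClosed_tsupport _)
      ((hχsupp k).trans ball_subset_closedBall)
  have hVb : ∀ i, ContDiffOn ℝ 1 (V i) (ball 0 2) := fun i => (hV i).mono ball_subset_closedBall
  have hχd : ∀ k y i, fderiv ℝ (χ k) y (bv i) =
      -(2 * k * y i * deriv τ (k * (4 - ‖y‖ ^ 2) - 1)) := by
    intro k y i
    have h1 : HasFDerivAt (fun y : E n => (k : ℝ) * (4 - ‖y‖ ^ 2) - 1)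
        ((k : ℝ) • -((2 : ℝ) • (innerSL ℝ y))) y := by
      have h0 : HasFDerivAt (fun y : E n => ‖y‖ ^ 2) ((2 : ℝ) • (innerSL ℝ y)) y := by
        simpa only [two_smul] using (hasStrictFDerivAt_norm_sq y).hasFDerivAt
      exact ((h0.const_sub 4).const_mul (k : ℝ)).sub_const 1
    have h2 : HasDerivAt τ (deriv τ (k * (4 - ‖y‖ ^ 2) - 1)) (k * (4 - ‖y‖ ^ 2) - 1) :=
      ((Real.smoothTransition.contDiff (n := 1)).differentiable one_ne_zero _).hasDerivAt
    have h3 := h2.comp_hasFDerivAt y h1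
    change fderiv ℝ (τ ∘ fun y : E n => (k : ℝ) * (4 - ‖y‖ ^ 2) - 1) y (bv i) = _
    rw [h3.fderiv]
    simp [EuclideanSpace.inner_single_right]
    ring
  set P : ℕ → E n → ℝ := fun k y => 2 * k * deriv τ (k * (4 - ‖y‖ ^ 2) - 1) * F y with hP
  have hPeq : ∀ k y, P k y = -∑ i, fderiv ℝ (χ k) y (bv i) * V i y := by
    intro k y
    simp only [hP, hF, hχd, Finset.mul_sum, ← Finset.sum_neg_distrib]
    exact Finset.sum_congr rfl fun i _ => by ring
  have hint1 : ∀ k i, Integrable fun y => fderiv ℝ (χ k) y (bv i) * V i y := by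
    intro k i
    refine integrable_mul_of_tsupport_subset isOpen_ball ?_
      (hasCompactSupport_fderiv_apply (hχc k) _) ((tsupport_fderiv_apply_subset _).trans (hχsupp k))
      (hVb i).continuousOn
    exact ((hχs k).continuous_fderiv (by simp)).clm_apply continuous_const
  have hint2 : ∀ k i, Integrable fun y => χ k y * fderiv ℝ (V i) y (bv i) := by
    intro k i
    refine integrable_mul_of_tsupport_subset isOpen_ball (hχs k).continuous (hχc k) (hχsupp k) ?_
    exact ((hVb i).continuousOn_fderiv_of_isOpen isOpen_ball le_rfl).clm_apply continuousOn_const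
  have hPint : ∀ k, Integrable (P k) := by
    intro k
    have : P k = fun y => -∑ i, fderiv ℝ (χ k) y (bv i) * V i y := funext (hPeq k)
    rw [this]
    exact (integrable_finsetSum _ fun i _ => hint1 k i).neg
  have hmain : ∀ k, ∫ y in ball (0 : E n) 2, χ k y * D y = ∫ y, P k y := by
    intro k
    have h1 : ∫ y in ball (0 : E n) 2, χ k y * D y =
        ∫ y, ∑ i, χ k y * fderiv ℝ (V i) y (bv i) := by
      rw [← setIntegral_eq_integral_of_forall_compl_eq_zero (s := ball (0 : E n) 2)
        (f := fun y => ∑ i, χ k y * fderiv ℝ (V i) y (bv i))]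
      · refine setIntegral_congr_fun measurableSet_ball fun y hy => ?_
        simp only [hD, Finset.mul_sum]
        refine Finset.sum_congr rfl fun i _ => ?_
        rw [fderivWithin_of_mem_nhds (mem_of_superset (isOpen_ball.mem_nhds hy)
          ball_subset_closedBall)]
      · intro y hy
        simp [hχ0 k y hy]
    rw [h1, integral_finsetSum _ fun i _ => hint2 k i]
    simp only [hPeq]
    rw [integral_neg, integral_finsetSum _ fun i _ => hint1 k i, ← Finset.sum_neg_distrib]
    refine Finset.sum_congr rfl fun i _ => ?_
    exact integral_mul_fderiv_of_tsupport_subset isOpen_ball ((hχs k).of_le (by simp)) (hχc k)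
      (hχsupp k) (hVb i) (bv i)
  have hlim1 : Tendsto (fun k => ∫ y in ball (0 : E n) 2, χ k y * D y) atTop
      (𝓝 (∫ y in ball (0 : E n) 2, D y)) := by
    refine tendsto_integral_of_dominated_convergence (fun y => ‖D y‖) ?_ hDint.norm ?_ ?_
    · intro k
      exact (hχs k).continuous.aestronglyMeasurable.mul hDint.aestronglyMeasurable
    · intro k
      refine Eventually.of_forall fun y => ?_
      rw [norm_mul]
      refine mul_le_of_le_one_left (norm_nonneg _) ?_
      rw [Real.norm_of_nonneg (Real.smoothTransition.nonneg _)]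
      exact Real.smoothTransition.le_one _
    · refine (ae_restrict_iff' measurableSet_ball).2 (Eventually.of_forall fun y hy => ?_)
      refine tendsto_const_nhds.congr' ?_
      have hy2 : ‖y‖ < 2 := by simpa using hy
      have hpos : 0 < 4 - ‖y‖ ^ 2 := by nlinarith [norm_nonneg y]
      obtain ⟨N, hN⟩ := exists_nat_gt (2 / (4 - ‖y‖ ^ 2))
      filter_upwards [eventually_ge_atTop N] with k hk
      rw [div_lt_iff₀ hpos] at hN
      have h1 : (N : ℝ) * (4 - ‖y‖ ^ 2) ≤ k * (4 - ‖y‖ ^ 2) := by gcongr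
      have h2 : χ k y = 1 := Real.smoothTransition.one_of_one_le (by linarith)
      rw [h2, one_mul]
  set A : ℝ → ℝ := fun r => ∫ z : sphere (0 : E n) 1, F (r • (z : E n))
    ∂((volume : Measure (E n)).toSphere) with hA
  have hPpolar : ∀ k, ∫ y, P k y = ∫ r in Ioc (0 : ℝ) 2,
      (2 * k * r * deriv τ (k * (4 - r ^ 2) - 1)) • (r ^ (n - 2) * A r) := by
    intro k
    rw [integral_eq_integral_Ioi_integral_sphere (by omega) (hPint k)]
    have hval : ∀ r ∈ Ioi (0 : ℝ), r ^ (n - 1) * ∫ z : sphere (0 : E n) 1, P k (r • (z : E n))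
        ∂((volume : Measure (E n)).toSphere) =
        (2 * k * r * deriv τ (k * (4 - r ^ 2) - 1)) • (r ^ (n - 2) * A r) := by
      intro r hr
      have hr0 : (0 : ℝ) < r := hr
      have : ∀ z : sphere (0 : E n) 1, P k (r • (z : E n)) =
          2 * k * deriv τ (k * (4 - r ^ 2) - 1) * F (r • (z : E n)) := by
        intro z
        simp [hP, norm_smul]
      simp only [this, integral_const_mul, smul_eq_mul]
      have e : r ^ (n - 1) = r * r ^ (n - 2) := by
        rw [← pow_succ']; congr 1; omega
      rw [e]; simp only [hA]; ring
    rw [setIntegral_congr_fun measurableSet_Ioi hval]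
    refine (setIntegral_eq_of_subset_of_forall_sdiff_eq_zero measurableSet_Ioi
      Ioc_subset_Ioi_self ?_)
    intro r hr
    have hr0 : (0 : ℝ) < r := hr.1
    have hr2 : 2 < r := by
      by_contra h
      exact hr.2 ⟨hr0, not_lt.1 h⟩
    have : deriv τ (k * (4 - r ^ 2) - 1) = 0 := by
      have hneg : (k : ℝ) * (4 - r ^ 2) - 1 < 0 := by
        have : (k : ℝ) * (4 - r ^ 2) ≤ 0 :=
          mul_nonpos_of_nonneg_of_nonpos (by positivity) (by nlinarith)
        linarith
      have : τ =ᶠ[𝓝 ((k : ℝ) * (4 - r ^ 2) - 1)] fun _ => 0 := by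
        filter_upwards [gt_mem_nhds hneg] with y hy
        exact Real.smoothTransition.zero_of_nonpos (le_of_lt hy)
      rw [this.deriv_eq]; simp
    simp [this]
  have hlim2 : Tendsto (fun k => ∫ y, P k y) atTop (𝓝 (2 ^ (n - 2) * A 2)) := by
    simp only [hPpolar]
    exact tendsto_integral_peak_two (g := fun r => r ^ (n - 2) * A r)
      ((by fun_prop : Continuous fun r : ℝ => r ^ (n - 2)).continuousOn.mul
        (continuousOn_integral_sphere hFc))
  have hfin := tendsto_nhds_unique (hlim1.congr hmain) hlim2
  rw [hfin, integral_surfaceMeasure]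
  have e : (2 : ℝ) ^ (n - 1) = 2 ^ (n - 2) * 2 := by
    rw [← pow_succ]; congr 1; omega
  rw [e, mul_assoc, ← integral_const_mul (2 : ℝ)]
  congr 1
  refine integral_congr_ae (Eventually.of_forall fun z => ?_)
  simp only [hF, Finset.mul_sum]
  exact Finset.sum_congr rfl fun i _ => by ring

end

/-! ### Green's identity under the Navier condition -/

section

variable {n : ℕ}

/-- Green's second identity on the ball. The derivatives are one-sided at the boundary, and
`(1/2) y` is the outward unit normal. -/
lemma green_identity_ball (hn : 2 ≤ n) {f g : E n → ℝ} (hf : ContDiffOn ℝ 2 f (closedBall 0 2))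
    (hg : ContDiffOn ℝ 2 g (closedBall 0 2)) :
    ∫ y in ball (0 : E n) 2, (f y * negLaplacianPow (closedBall 0 2) 1 g y -
        g y * negLaplacianPow (closedBall 0 2) 1 f y) =
      ∫ y, (g y * fderivWithin ℝ f (closedBall 0 2) y ((1 / 2 : ℝ) • y) -
        f y * fderivWithin ℝ g (closedBall 0 2) y ((1 / 2 : ℝ) • y)) ∂(surfaceMeasure n) := by
  set S := closedBall (0 : E n) 2 with hS
  have hu : UniqueDiffOn ℝ S := uniqueDiffOn_closedBall_two
  have h1 : ∀ {h : E n → ℝ}, ContDiffOn ℝ 2 h S → ContDiffOn ℝ 1 (fderivWithin ℝ h S) S :=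
    fun hh => hh.fderivWithin hu (by rw [one_add_one_eq_two])
  set V : Fin n → E n → ℝ := fun i y =>
    g y * fderivWithin ℝ f S y (bv i) - f y * fderivWithin ℝ g S y (bv i) with hVdef
  have hV : ∀ i, ContDiffOn ℝ 1 (V i) S := fun i =>
    ((hg.of_le one_le_two).mul ((h1 hf).clm_apply contDiffOn_const)).sub
      ((hf.of_le one_le_two).mul ((h1 hg).clm_apply contDiffOn_const))
  have hder : ∀ y ∈ S, ∀ i, fderivWithin ℝ (V i) S y (bv i) =
      g y * fderivWithin ℝ (fderivWithin ℝ f S) S y (bv i) (bv i) -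
        f y * fderivWithin ℝ (fderivWithin ℝ g S) S y (bv i) (bv i) := by
    intro y hy i
    have d0 : ∀ {h : E n → ℝ}, ContDiffOn ℝ 2 h S →
        HasFDerivWithinAt h (fderivWithin ℝ h S y) S y := fun hh =>
      ((hh.differentiableOn two_ne_zero) y hy).hasFDerivWithinAt
    have d1 : ∀ {h : E n → ℝ}, ContDiffOn ℝ 2 h S →
        HasFDerivWithinAt (fun z => fderivWithin ℝ h S z (bv i))
          ((fderivWithin ℝ (fderivWithin ℝ h S) S y).flip (bv i)) S y := fun hh => by
      have := (((h1 hh).differentiableOn one_ne_zero) y hy).hasFDerivWithinAt.clm_apply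
        (hasFDerivWithinAt_const (bv i) y S)
      simpa using this
    have := ((d0 hg).mul (d1 hf)).sub ((d0 hf).mul (d1 hg))
    have h3 := this.fderivWithin (hu y hy)
    have h4 : fderivWithin ℝ (V i) S y = _ := h3
    rw [h4]
    simp
    ring
  have hdiv := integral_divergence_ball hn hV
  calc ∫ y in ball (0 : E n) 2, (f y * negLaplacianPow S 1 g y - g y * negLaplacianPow S 1 f y)
      = ∫ y in ball (0 : E n) 2, ∑ i, fderivWithin ℝ (V i) S y (bv i) := by
        refine setIntegral_congr_fun measurableSet_ball fun y hy => ?_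
        simp only [hder y (ball_subset_closedBall hy), negLaplacianPow_one,
          Finset.sum_sub_distrib, ← Finset.mul_sum]
        ring
    _ = ∫ y, (∑ i, V i y * (y i / 2)) ∂(surfaceMeasure n) := hdiv
    _ = _ := by
        congr 1
        ext y
        have hy : ∀ A : E n →L[ℝ] ℝ, A ((1 / 2 : ℝ) • y) = ∑ i, A (bv i) * (y i / 2) := by
          intro A
          have hsum : y = ∑ i, y i • bv i := by
            conv_lhs => rw [← (EuclideanSpace.basisFun (Fin n) ℝ).sum_repr y]
            simp
          conv_lhs => rw [hsum]
          rw [map_smul, map_sum, smul_eq_mul, Finset.mul_sum]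
          refine Finset.sum_congr rfl fun i _ => ?_
          rw [map_smul, smul_eq_mul]; ring
        rw [hy, hy, Finset.mul_sum, Finset.mul_sum, ← Finset.sum_sub_distrib]
        refine Finset.sum_congr rfl fun i _ => ?_
        simp only [hVdef]; ring

lemma contDiffOn_negLaplacianPow_closedBall {j m : ℕ} {f : E n → ℝ} (N : ℕ)
    (hf : ContDiffOn ℝ ((2 * m : ℕ) : WithTop ℕ∞) f (closedBall 0 2)) (h : N + 2 * j ≤ 2 * m) :
    ContDiffOn ℝ (N : WithTop ℕ∞) (negLaplacianPow (closedBall 0 2) j f) (closedBall 0 2) :=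
  contDiffOn_negLaplacianPow uniqueDiffOn_closedBall_two j hf (by exact_mod_cast h)

/-- Green's identity for `(-Δ)^m` on the ball, when one function satisfies the homogeneous Navier
boundary condition: the powers of `-Δ` are moved from one function to the other one at a time. -/
lemma green_identity_navier (hn : 2 ≤ n) (m : ℕ) {Γ W : E n → ℝ}
    (hΓ : ContDiffOn ℝ ((2 * m : ℕ) : WithTop ℕ∞) Γ (closedBall 0 2))
    (hW : ContDiffOn ℝ ((2 * m : ℕ) : WithTop ℕ∞) W (closedBall 0 2))
    (hbd : ∀ j < m, ∀ y ∈ sphere (0 : E n) 2, negLaplacianPow (closedBall 0 2) j Γ y = 0) :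
    (∫ y in ball (0 : E n) 2, Γ y * negLaplacianPow (closedBall 0 2) m W y) -
      (∫ y in ball (0 : E n) 2, negLaplacianPow (closedBall 0 2) m Γ y * W y) =
    ∑ i ∈ Finset.Icc 1 m, ∫ y,
      fderivWithin ℝ (negLaplacianPow (closedBall 0 2) (m - i) Γ) (closedBall 0 2) y
        ((1 / 2 : ℝ) • y) * negLaplacianPow (closedBall 0 2) (i - 1) W y ∂(surfaceMeasure n) := by
  set S := closedBall (0 : E n) 2 with hS
  have hc : ∀ {f : E n → ℝ} {j : ℕ}, ContDiffOn ℝ ((2 * m : ℕ) : WithTop ℕ∞) f S → j ≤ m →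
      ContinuousOn (negLaplacianPow S j f) S := fun hf hj =>
    (contDiffOn_negLaplacianPow_closedBall 0 hf (by omega)).continuousOn
  set a : ℕ → ℝ := fun j =>
    ∫ y in ball (0 : E n) 2, negLaplacianPow S j Γ y * negLaplacianPow S (m - j) W y with ha
  have hint : ∀ {f g : E n → ℝ}, ContinuousOn f S → ContinuousOn g S →
      IntegrableOn (fun y => f y * g y) (ball 0 2) := fun hf hg =>
    ((hf.mul hg).integrableOn_compact (isCompact_closedBall _ _)).mono_set ball_subset_closedBall
  have hstep : ∀ j ∈ Finset.range m, a j - a (j + 1) = ∫ y,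
      fderivWithin ℝ (negLaplacianPow S j Γ) S y ((1 / 2 : ℝ) • y) *
        negLaplacianPow S (m - 1 - j) W y ∂(surfaceMeasure n) := by
    intro j hj
    have hj : j < m := Finset.mem_range.1 hj
    have hG := green_identity_ball hn
      (contDiffOn_negLaplacianPow_closedBall (j := j) 2 hΓ (by omega))
      (contDiffOn_negLaplacianPow_closedBall (j := m - 1 - j) 2 hW (by omega))
    rw [← negLaplacianPow_succ, ← negLaplacianPow_succ,
      show m - 1 - j + 1 = m - j by omega] at hG
    have e : ∀ y, negLaplacianPow S (m - 1 - j) W y * negLaplacianPow S (j + 1) Γ y =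
        negLaplacianPow S (j + 1) Γ y * negLaplacianPow S (m - (j + 1)) W y := by
      intro y; rw [show m - 1 - j = m - (j + 1) by omega, mul_comm]
    simp only [← hS, e] at hG
    rw [integral_sub (hint (hc hΓ hj.le) (hc hW (by omega)))
      (hint (hc hΓ hj) (hc hW (by omega)))] at hG
    simp only [ha]
    rw [hG]
    refine integral_surfaceMeasure_congr fun y hy => ?_
    simp only [hbd j hj y hy, zero_mul, sub_zero, mul_comm]
  have htel : a 0 - a m = ∑ j ∈ Finset.range m, (a j - a (j + 1)) :=
    (Finset.sum_range_sub' a m).symm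
  rw [Finset.sum_congr rfl hstep] at htel
  have e0 : a 0 - a m = (∫ y in ball (0 : E n) 2, Γ y * negLaplacianPow S m W y) -
      (∫ y in ball (0 : E n) 2, negLaplacianPow S m Γ y * W y) := by
    simp only [ha, negLaplacianPow_zero, Nat.sub_self, Nat.sub_zero]
  rw [← e0, htel]
  refine Finset.sum_nbij' (fun j => m - j) (fun i => m - i) ?_ ?_ ?_ ?_ ?_
  · intro j hj; simp only [Finset.mem_range, Finset.mem_Icc] at *; omega
  · intro j hj; simp only [Finset.mem_range, Finset.mem_Icc] at *; omega
  · intro j hj; simp only [Finset.mem_range] at *; omega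
  · intro j hj; simp only [Finset.mem_Icc] at *; omega
  · intro j hj
    simp only [Finset.mem_range] at hj
    rw [show m - (m - j) = j by omega, show m - j - 1 = m - 1 - j by omega]

/-- Smooth cutoff functions between a compact set and an open neighbourhood of it. -/
lemma exists_smooth_cutoff {K U : Set (E n)} (hK : IsCompact K) (hU : IsOpen U) (hKU : K ⊆ U) :
    ∃ η : E n → ℝ, ContDiff ℝ ∞ η ∧ HasCompactSupport η ∧ tsupport η ⊆ U ∧
      (∀ᶠ y in 𝓝ˢ K, η y = 1) ∧ ∀ y, η y ∈ Icc (0 : ℝ) 1 := by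
  obtain ⟨K', hK', hKK', hK'U⟩ := exists_compact_between hK hU hKU
  obtain ⟨f, h1, h0, h01⟩ := exists_contMDiffMap_one_nhds_of_subset_interior
    (n := (⊤ : ℕ∞)) (modelWithCornersSelf ℝ (E n)) hK.isClosed hKK'
  have hts : tsupport f ⊆ K' := closure_minimal
    (fun y hy => by by_contra h; exact hy (h0 y h)) hK'.isClosed
  exact ⟨f, f.contMDiff.contDiff, hK'.of_isClosed_subset (isClosed_tsupport _) hts,
    hts.trans hK'U, h1, h01⟩

lemma contDiff_mul_of_tsupport_subset {Ω : Set (E n)} (hΩ : IsOpen Ω) {N : WithTop ℕ∞}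
    {η f : E n → ℝ} (hη : ContDiff ℝ N η) (hs : tsupport η ⊆ Ω) (hf : ContDiffOn ℝ N f Ω) :
    ContDiff ℝ N fun y => η y * f y := by
  rw [contDiff_iff_contDiffAt]
  intro y
  by_cases hy : y ∈ tsupport η
  · exact hη.contDiffAt.mul (hf.contDiffAt (hΩ.mem_nhds (hs hy)))
  · have : (fun y => η y * f y) =ᶠ[𝓝 y] fun _ => 0 := by
      filter_upwards [(isClosed_tsupport η).isOpen_compl.mem_nhds hy] with z hz
      rw [image_eq_zero_of_notMem_tsupport hz, zero_mul]
    exact contDiffAt_const.congr_of_eventuallyEq this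

/-- Away from its pole, a Green function is polyharmonic. -/
lemma IsNavierGreenFunction.ae_negLaplacianPow_eq_zero {m : ℕ} {G : E n → E n → ℝ}
    (hG : IsNavierGreenFunction n m G) {x : E n} (hx : x ∈ ball (0 : E n) 2) :
    ∀ᵐ y, y ∈ ball (0 : E n) 2 \ {x} → negLaplacianPow univ m (G x) y = 0 := by
  have hΩ : IsOpen (ball (0 : E n) 2 \ {x}) := isOpen_ball.sdiff isClosed_singleton
  have hGs : ContDiffOn ℝ ∞ (G x) (ball (0 : E n) 2 \ {x}) :=
    (hG.smooth x hx).mono (sdiff_subset_sdiff_left ball_subset_closedBall)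
  have hLG : ContinuousOn (negLaplacianPow univ m (G x)) (ball (0 : E n) 2 \ {x}) :=
    (contDiffOn_infty_negLaplacianPow hΩ.uniqueDiffOn hGs).continuousOn.congr fun y hy =>
      (negLaplacianPow_eqOn_univ hΩ subset_rfl (fun _ _ => rfl) m hy).symm
  refine hΩ.ae_eq_zero_of_integral_contDiff_smul_eq_zero
    (hLG.locallyIntegrableOn hΩ.measurableSet) fun g hg hgc hgs => ?_
  simp only [smul_eq_mul]
  rw [integral_mul_negLaplacianPow hΩ m hg hgc hgs (contDiffOn_infty.1 hGs _)]
  have h1 := hG.dirac x hx g hg hgc (hgs.trans sdiff_subset)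
  rw [setIntegral_eq_integral_of_forall_compl_eq_zero] at h1
  · simp only [mul_comm (G x _)] at h1
    rw [h1]
    exact image_eq_zero_of_notMem_tsupport fun h => (hgs h).2 rfl
  · intro y hy
    rw [negLaplacianPow_eq_zero_of_notMem_tsupport fun h => hy (hgs h).1, mul_zero]

end

/-! ### The representation formula for regular functions -/

section

variable {n : ℕ}

lemma integrableOn_mul_continuousOn_closedBall {g h : E n → ℝ} (hg : IntegrableOn g (ball 0 2))
    (hh : ContinuousOn h (closedBall 0 2)) : IntegrableOn (fun y => g y * h y) (ball 0 2) := by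
  obtain ⟨C, hC⟩ := (isCompact_closedBall (0 : E n) 2).exists_bound_of_continuousOn hh
  refine Integrable.mul_bdd (c := C) hg ?_ ?_
  · exact (hh.mono ball_subset_closedBall).aestronglyMeasurable measurableSet_ball
  · exact (ae_restrict_iff' measurableSet_ball).2
      (Eventually.of_forall fun y hy => hC y (ball_subset_closedBall hy))

/-- The kernel `H_i(x, ·)` does not see the Green function near its pole. -/
lemma boundaryKernel_eqOn {m : ℕ} {G : E n → E n → ℝ} {x : E n} {Γ : E n → ℝ} {U : Set (E n)}
    (hU : IsOpen U) (hxU : x ∉ U) (h : EqOn (G x) Γ U) (i : ℕ) {y : E n}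
    (hy : y ∈ closedBall (0 : E n) 2 ∩ U) :
    boundaryKernel m G i x y =
      -fderivWithin ℝ (negLaplacianPow (closedBall 0 2) (m - i) Γ) (closedBall 0 2) y
        ((1 / 2 : ℝ) • y) := by
  have hst : (closedBall (0 : E n) 2 \ {x}) ∩ U = closedBall 0 2 ∩ U := by
    ext z
    simp only [mem_inter_iff, Set.mem_sdiff, mem_singleton_iff]
    constructor
    · rintro ⟨⟨h1, _⟩, h2⟩; exact ⟨h1, h2⟩
    · rintro ⟨h1, h2⟩; exact ⟨⟨h1, fun e => hxU (e ▸ h2)⟩, h2⟩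
  have h1 := negLaplacianPow_congr hU hst (f := G x) (g := Γ) (h.mono inter_subset_right) (m - i)
  have h2 := fderivWithin_eqOn_of_inter_eq hU hst h1
  rw [boundaryKernel, h2 (by rw [hst]; exact hy)]

/-- The representation formula for functions which are `C^{2m}` up to the boundary. Near the pole
the equation of `G(x, ·)` is used in its distributional form; away from it, Green's identity. -/
theorem IsNavierGreenFunction.representation (hn : 2 ≤ n) {m : ℕ} {G : E n → E n → ℝ}
    (hG : IsNavierGreenFunction n m G) {x : E n} (hx : x ∈ ball (0 : E n) 2) {W : E n → ℝ}
    (hW : ContDiffOn ℝ ((2 * m : ℕ) : WithTop ℕ∞) W (closedBall 0 2)) :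
    W x = (∫ y in ball (0 : E n) 2, G x y * negLaplacianPow (closedBall 0 2) m W y) +
      ∑ i ∈ Finset.Icc 1 m, ∫ y, boundaryKernel m G i x y *
        negLaplacianPow (closedBall 0 2) (i - 1) W y ∂(surfaceMeasure n) := by
  set S := closedBall (0 : E n) 2 with hS
  have huS : UniqueDiffOn ℝ S := uniqueDiffOn_closedBall_two
  obtain ⟨η, hη, hηc, hηs, hη1, -⟩ := exists_smooth_cutoff (isCompact_singleton (x := x))
    isOpen_ball (singleton_subset_iff.2 hx)
  rw [nhdsSet_singleton] at hη1
  set N := interior {y | η y = 1} with hN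
  have hxN : x ∈ N := mem_interior_iff_mem_nhds.2 hη1
  have hNη : ∀ y ∈ N, η y = 1 := fun y hy => by
    have h : y ∈ {y | η y = 1} := interior_subset hy
    exact h
  -- `W = W₁ + W₂`, where `W₁` is compactly supported in the ball and `W₂` vanishes on the
  -- neighbourhood `N` of `x`; for `W₂` the pole may be cut off, with `θ` supported in `N`
  obtain ⟨θ, hθ, hθc, hθs, hθ1, -⟩ := exists_smooth_cutoff (isCompact_singleton (x := x))
    isOpen_interior (singleton_subset_iff.2 hxN)
  rw [nhdsSet_singleton] at hθ1
  have hθη : tsupport θ ⊆ tsupport η := fun y hy => by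
    refine subset_closure ?_
    rw [Function.mem_support, hNη y (hθs hy)]
    exact one_ne_zero
  set W₁ : E n → ℝ := fun y => η y * W y with hW₁
  set W₂ : E n → ℝ := fun y => W y - W₁ y with hW₂
  set Γ : E n → ℝ := fun y => (1 - θ y) * G x y with hΓdef
  have hW₁s : ContDiff ℝ ((2 * m : ℕ) : WithTop ℕ∞) W₁ :=
    contDiff_mul_of_tsupport_subset isOpen_ball (contDiff_infty.1 hη _) hηs
      (hW.mono ball_subset_closedBall)
  have hW₂s : ContDiffOn ℝ ((2 * m : ℕ) : WithTop ℕ∞) W₂ S := hW.sub hW₁s.contDiffOn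
  have hΓ : ContDiffOn ℝ ((2 * m : ℕ) : WithTop ℕ∞) Γ S := by
    intro y hy
    by_cases hyx : y = x
    · subst hyx
      have : Γ =ᶠ[𝓝 y] fun _ => 0 := by
        filter_upwards [hθ1] with z hz
        simp [hΓdef, hz]
      exact (contDiffAt_const.congr_of_eventuallyEq this).contDiffWithinAt
    · have h1 : ContDiffWithinAt ℝ ((2 * m : ℕ) : WithTop ℕ∞) Γ (S \ {x}) y :=
        (contDiff_const.sub (contDiff_infty.1 hθ _)).contDiffWithinAt.mul
          (contDiffOn_infty.1 (hG.smooth x hx) _ y ⟨hy, hyx⟩)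
      refine h1.mono_of_mem_nhdsWithin ?_
      exact inter_mem self_mem_nhdsWithin (mem_nhdsWithin_of_mem_nhds (isOpen_compl_singleton.mem_nhds hyx))
  -- near the sphere both cutoffs vanish, so that the boundary terms are those of `G` and `W`
  set U : Set (E n) := (tsupport η)ᶜ with hU
  have hUo : IsOpen U := (isClosed_tsupport η).isOpen_compl
  have hxU : x ∉ U := fun h => h (subset_closure (by
    rw [Function.mem_support, hNη x hxN]; exact one_ne_zero))
  have hsphU : ∀ y ∈ sphere (0 : E n) 2, y ∈ S ∩ U := by
    intro y hy
    refine ⟨sphere_subset_closedBall hy, fun h => ?_⟩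
    have h1 := hηs h
    rw [mem_ball] at h1
    rw [mem_sphere] at hy
    linarith
  have hW₂U : EqOn W₂ W U := fun y hy => by
    simp [hW₂, hW₁, image_eq_zero_of_notMem_tsupport hy]
  have hΓU : EqOn (G x) Γ U := fun y hy => by
    simp [hΓdef, image_eq_zero_of_notMem_tsupport fun h => hy (hθη h)]
  have hst : S ∩ U = (S \ {x}) ∩ U := by
    ext z
    simp only [mem_inter_iff, Set.mem_sdiff, mem_singleton_iff]
    constructor
    · rintro ⟨h1, h2⟩; exact ⟨⟨h1, fun e => hxU (e ▸ h2)⟩, h2⟩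
    · rintro ⟨⟨h1, _⟩, h2⟩; exact ⟨h1, h2⟩
  have hbd : ∀ j < m, ∀ y ∈ sphere (0 : E n) 2, negLaplacianPow S j Γ y = 0 := by
    intro j hj y hy
    rw [negLaplacianPow_congr hUo hst (f := Γ) (g := G x)
      (fun z hz => (hΓU hz.2).symm) j (hsphU y hy)]
    exact hG.boundary x hx j hj y hy
  have hgreen := green_identity_navier hn m hΓ hW₂s hbd
  have hsum : ∀ i ∈ Finset.Icc 1 m, ∫ y,
      fderivWithin ℝ (negLaplacianPow S (m - i) Γ) S y ((1 / 2 : ℝ) • y) *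
        negLaplacianPow S (i - 1) W₂ y ∂(surfaceMeasure n) =
      -∫ y, boundaryKernel m G i x y * negLaplacianPow S (i - 1) W y ∂(surfaceMeasure n) := by
    intro i _
    rw [← integral_neg]
    refine integral_surfaceMeasure_congr fun y hy => ?_
    beta_reduce
    rw [boundaryKernel_eqOn hUo hxU hΓU i (hsphU y hy),
      negLaplacianPow_congr_of_eqOn hUo (f := W₂) (g := W)
        (hW₂U.mono inter_subset_right) (i - 1) (hsphU y hy)]
    ring
  rw [Finset.sum_congr rfl hsum, Finset.sum_neg_distrib] at hgreen
  have hzero : ∀ y ∈ N, negLaplacianPow S m W₂ y = 0 ∨ y ∉ S := by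
    intro y hy
    by_cases hyS : y ∈ S
    · left
      rw [negLaplacianPow_congr_of_eqOn isOpen_interior (f := W₂) (g := fun _ => 0)
        (fun z hz => by simp [hW₂, hW₁, hNη z hz.2]) m ⟨hyS, hy⟩, negLaplacianPow_zero_fun]
    · exact Or.inr hyS
  have hvol1 : ∫ y in ball (0 : E n) 2, Γ y * negLaplacianPow S m W₂ y =
      ∫ y in ball (0 : E n) 2, G x y * negLaplacianPow S m W₂ y := by
    refine setIntegral_congr_fun measurableSet_ball fun y hy => ?_
    by_cases hyN : y ∈ N
    · rw [(hzero y hyN).resolve_right fun h => h (ball_subset_closedBall hy), mul_zero, mul_zero]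
    · simp [hΓdef, image_eq_zero_of_notMem_tsupport fun h => hyN (hθs h)]
  have hvol2 : ∫ y in ball (0 : E n) 2, negLaplacianPow S m Γ y * W₂ y = 0 := by
    refine integral_eq_zero_of_ae ((ae_restrict_iff' measurableSet_ball).2 ?_)
    filter_upwards [hG.ae_negLaplacianPow_eq_zero hx] with y hy0 hy
    by_cases hyN : y ∈ N
    · simp [hW₂, hW₁, hNη y hyN]
    · have hyx : y ∉ ({x} : Set (E n)) := fun h => hyN (h ▸ hxN)
      have hopen : IsOpen (ball (0 : E n) 2 ∩ (tsupport θ)ᶜ) :=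
        isOpen_ball.inter (isClosed_tsupport θ).isOpen_compl
      have h1 := negLaplacianPow_eqOn_univ hopen
        (inter_subset_left.trans ball_subset_closedBall) (f := Γ) (g := G x)
        (fun z hz => by simp [hΓdef, image_eq_zero_of_notMem_tsupport hz.2]) m
        ⟨hy, fun h => hyN (hθs h)⟩
      simp only [Pi.zero_apply]
      rw [← hS] at h1
      rw [h1, hy0 ⟨hy, hyx⟩, zero_mul]
  rw [hvol1, hvol2, sub_zero] at hgreen
  have hvol3 : ∫ y in ball (0 : E n) 2, G x y * negLaplacianPow S m W₁ y = W x := by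
    have h1 := integral_mul_negLaplacianPow_eq_of_contDiff (hG.integrable x hx)
      (hG.dirac x hx) hW₁s hηc.mul_right
      ((closure_mono (Function.support_mul_subset_left η W)).trans hηs)
    rw [show W x = W₁ x by simp [hW₁, hNη x hxN], ← h1]
    refine setIntegral_congr_fun measurableSet_ball fun y hy => ?_
    rw [negLaplacianPow_eqOn_univ isOpen_ball ball_subset_closedBall (fun _ _ => rfl) m hy]
  have hadd : ∫ y in ball (0 : E n) 2, G x y * negLaplacianPow S m W y =
      (∫ y in ball (0 : E n) 2, G x y * negLaplacianPow S m W₁ y) +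
        ∫ y in ball (0 : E n) 2, G x y * negLaplacianPow S m W₂ y := by
    rw [← integral_add]
    · refine setIntegral_congr_fun measurableSet_ball fun y hy => ?_
      have h1 := negLaplacianPow_add huS m hW₁s.contDiffOn hW₂s (ball_subset_closedBall hy)
      have h2 : (fun z => W₁ z + W₂ z) = W := by ext z; simp [hW₂]
      rw [h2] at h1
      beta_reduce at h1 ⊢
      rw [h1, mul_add]
    · exact integrableOn_mul_continuousOn_closedBall (hG.integrable x hx)
        (contDiffOn_negLaplacianPow_closedBall 0 hW₁s.contDiffOn (by omega)).continuousOn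
    · exact integrableOn_mul_continuousOn_closedBall (hG.integrable x hx)
        (contDiffOn_negLaplacianPow_closedBall 0 hW₂s (by omega)).continuousOn
  rw [hadd, hvol3, hgreen]
  ring

end

/-! ### Cutoff functions adapted to a scale -/

section

variable {n : ℕ}

/-- The iterated partial derivative `∂_{i_k} ⋯ ∂_{i_1} f`, for the list `i_1, …, i_k`. -/
noncomputable def iterPartial : List (Fin n) → (E n → ℝ) → E n → ℝ
  | [], f => f
  | i :: l, f => iterPartial l fun y => fderiv ℝ f y (bv i)

lemma contDiff_partial {f : E n → ℝ} (hf : ContDiff ℝ ∞ f) (v : E n) :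
    ContDiff ℝ ∞ fun y => fderiv ℝ f y v :=
  (hf.fderiv_right (m := ∞) (by simp)).clm_apply contDiff_const

lemma contDiff_iterPartial (l : List (Fin n)) {f : E n → ℝ} (hf : ContDiff ℝ ∞ f) :
    ContDiff ℝ ∞ (iterPartial l f) := by
  induction l generalizing f with
  | nil => exact hf
  | cons i l ih => exact ih (contDiff_partial hf _)

lemma hasCompactSupport_iterPartial (l : List (Fin n)) {f : E n → ℝ} (hf : HasCompactSupport f) :
    HasCompactSupport (iterPartial l f) := by
  induction l generalizing f with
  | nil => exact hf
  | cons i l ih => exact ih (hasCompactSupport_fderiv_apply hf _)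

lemma iterPartial_add (l : List (Fin n)) {f g : E n → ℝ} (hf : ContDiff ℝ ∞ f)
    (hg : ContDiff ℝ ∞ g) (y : E n) :
    iterPartial l (fun y => f y + g y) y = iterPartial l f y + iterPartial l g y := by
  induction l generalizing f g with
  | nil => rfl
  | cons i l ih =>
    simp only [iterPartial]
    rw [← ih (contDiff_partial hf _) (contDiff_partial hg _)]
    congr 1
    ext z
    rw [fderiv_fun_add (hf.differentiable (by simp) z) (hg.differentiable (by simp) z)]
    rfl

lemma iterPartial_const_mul (l : List (Fin n)) (c : ℝ) {f : E n → ℝ} (hf : ContDiff ℝ ∞ f)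
    (y : E n) : iterPartial l (fun y => c * f y) y = c * iterPartial l f y := by
  induction l generalizing f with
  | nil => rfl
  | cons i l ih =>
    simp only [iterPartial]
    rw [← ih (contDiff_partial hf _)]
    congr 1
    ext z
    rw [fderiv_const_mul (hf.differentiable (by simp) z)]
    rfl

/-- A family of smooth functions indexed by a scale `ε ∈ (0, 1]` whose derivatives of order `k` are
uniformly `O(ε^{-a-k})`. -/
structure ScaleBounded (a : ℕ) (h : ℝ → E n → ℝ) : Prop where
  smooth : ∀ ε ∈ Ioc (0 : ℝ) 1, ContDiff ℝ ∞ (h ε)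
  bound : ∀ l : List (Fin n), ∃ C, ∀ ε ∈ Ioc (0 : ℝ) 1, ∀ y,
    |iterPartial l (h ε) y| ≤ C / ε ^ (a + l.length)

namespace ScaleBounded

variable {a b : ℕ} {h k : ℝ → E n → ℝ}

lemma congr (hh : ScaleBounded a h) (e : ∀ ε ∈ Ioc (0 : ℝ) 1, h ε = k ε) : ScaleBounded a k where
  smooth ε hε := e ε hε ▸ hh.smooth ε hε
  bound l := by
    obtain ⟨C, hC⟩ := hh.bound l
    exact ⟨C, fun ε hε y => e ε hε ▸ hC ε hε y⟩

lemma add (hh : ScaleBounded a h) (hk : ScaleBounded a k) :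
    ScaleBounded a fun ε y => h ε y + k ε y where
  smooth ε hε := (hh.smooth ε hε).add (hk.smooth ε hε)
  bound l := by
    obtain ⟨C, hC⟩ := hh.bound l
    obtain ⟨D, hD⟩ := hk.bound l
    refine ⟨C + D, fun ε hε y => ?_⟩
    rw [iterPartial_add l (hh.smooth ε hε) (hk.smooth ε hε), add_div]
    exact (abs_add_le _ _).trans (add_le_add (hC ε hε y) (hD ε hε y))

lemma const_mul (hh : ScaleBounded a h) (c : ℝ) : ScaleBounded a fun ε y => c * h ε y where
  smooth ε hε := contDiff_const.mul (hh.smooth ε hε)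
  bound l := by
    obtain ⟨C, hC⟩ := hh.bound l
    refine ⟨|c| * C, fun ε hε y => ?_⟩
    rw [iterPartial_const_mul l c (hh.smooth ε hε), abs_mul, mul_div_assoc]
    exact mul_le_mul_of_nonneg_left (hC ε hε y) (abs_nonneg c)

lemma partial_deriv (hh : ScaleBounded a h) (i : Fin n) :
    ScaleBounded (a + 1) fun ε y => fderiv ℝ (h ε) y (bv i) where
  smooth ε hε := contDiff_partial (hh.smooth ε hε) _
  bound l := by
    obtain ⟨C, hC⟩ := hh.bound (i :: l)
    refine ⟨C, fun ε hε y => ?_⟩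
    have := hC ε hε y
    rwa [List.length_cons, show a + (l.length + 1) = a + 1 + l.length by omega] at this

lemma mono (hh : ScaleBounded a h) : ScaleBounded (a + 1) h where
  smooth := hh.smooth
  bound l := by
    obtain ⟨C, hC⟩ := hh.bound l
    refine ⟨C, fun ε hε y => (hC ε hε y).trans ?_⟩
    have h0 : 0 < ε := hε.1
    have hC0 : 0 ≤ C := by
      have := (abs_nonneg _).trans (hC ε hε y)
      rw [div_nonneg_iff] at this
      rcases this with h | h
      · exact h.1
      · exact absurd h.2 (not_le.2 (by positivity))
    refine div_le_div_of_nonneg_left hC0 (by positivity) ?_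
    exact pow_le_pow_of_le_one h0.le hε.2 (by omega)

lemma mul (hh : ScaleBounded a h) (hk : ScaleBounded b k) :
    ScaleBounded (a + b) fun ε y => h ε y * k ε y where
  smooth ε hε := (hh.smooth ε hε).mul (hk.smooth ε hε)
  bound l := by
    induction l generalizing a b h k with
    | nil =>
      obtain ⟨C, hC⟩ := hh.bound []
      obtain ⟨D, hD⟩ := hk.bound []
      refine ⟨C * D, fun ε hε y => ?_⟩
      have h1 := hC ε hε y
      have h2 := hD ε hε y
      simp only [iterPartial, List.length_nil, add_zero] at h1 h2 ⊢
      rw [abs_mul, pow_add, ← div_mul_div_comm]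
      exact mul_le_mul h1 h2 (abs_nonneg _) ((abs_nonneg _).trans h1)
    | cons i l ih =>
      obtain ⟨C, hC⟩ := ih (hh.partial_deriv i) hk
      obtain ⟨D, hD⟩ := ih hh (hk.partial_deriv i)
      refine ⟨C + D, fun ε hε y => ?_⟩
      have e : iterPartial (i :: l) (fun y => h ε y * k ε y) y =
          iterPartial l (fun y => fderiv ℝ (h ε) y (bv i) * k ε y) y +
            iterPartial l (fun y => h ε y * fderiv ℝ (k ε) y (bv i)) y := by
        rw [← iterPartial_add l ((contDiff_partial (hh.smooth ε hε) _).mul (hk.smooth ε hε))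
          ((hh.smooth ε hε).mul (contDiff_partial (hk.smooth ε hε) _))]
        simp only [iterPartial]
        congr 1
        ext z
        rw [fderiv_fun_mul ((hh.smooth ε hε).differentiable (by simp) z)
          ((hk.smooth ε hε).differentiable (by simp) z)]
        simp
        ring
      rw [e, add_div]
      refine (abs_add_le _ _).trans (add_le_add ?_ ?_)
      · have := hC ε hε y
        rwa [show a + 1 + b + l.length = a + b + (i :: l).length by
          rw [List.length_cons]; omega] at this
      · have := hD ε hε y
        rwa [show a + (b + 1) + l.length = a + b + (i :: l).length by
          rw [List.length_cons]; omega] at this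

lemma of_compactSupport {g : E n → ℝ} (hg : ContDiff ℝ ∞ g) (hgc : HasCompactSupport g) :
    ScaleBounded 0 fun _ => g where
  smooth _ _ := hg
  bound l := by
    obtain ⟨C, hC⟩ := (contDiff_iterPartial l hg).continuous.bounded_above_of_compact_support
      (hasCompactSupport_iterPartial l hgc)
    refine ⟨C, fun ε hε y => ?_⟩
    have h0 : 0 < ε := hε.1
    have h1 : |iterPartial l g y| ≤ C := hC y
    refine h1.trans ?_
    rw [le_div_iff₀ (by positivity)]
    exact mul_le_of_le_one_right ((abs_nonneg _).trans h1) (pow_le_one₀ h0.le hε.2)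

lemma zero : ScaleBounded a fun (_ : ℝ) (_ : E n) => (0 : ℝ) := by
  induction a with
  | zero => exact of_compactSupport contDiff_const HasCompactSupport.zero
  | succ a ih => exact ih.mono

lemma sum {ι : Type*} (s : Finset ι) {h : ι → ℝ → E n → ℝ} (hh : ∀ i ∈ s, ScaleBounded a (h i)) :
    ScaleBounded a fun ε y => ∑ i ∈ s, h i ε y := by
  classical
  induction s using Finset.induction_on with
  | empty => simpa using zero
  | insert i s hi ih =>
    simp only [Finset.sum_insert hi]
    exact (hh i (Finset.mem_insert_self _ _)).add
      (ih fun j hj => hh j (Finset.mem_insert_of_mem hj))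

lemma pow {ζ : ℝ → E n → ℝ} (hζ : ScaleBounded 0 ζ) (hk : ScaleBounded a k) (q : ℕ) :
    ScaleBounded a fun ε y => ζ ε y ^ q * k ε y := by
  induction q with
  | zero => simpa using hk
  | succ q ih =>
    have := hζ.mul ih
    rw [zero_add] at this
    refine this.congr fun ε _ => ?_
    ext y; ring

/-- One derivative of `ζ^{q+1} h` costs one power of `ζ` and one power of the scale. -/
lemma exists_partial_pow_mul {ζ : ℝ → E n → ℝ} (hζ : ScaleBounded 0 ζ) (hh : ScaleBounded a h)
    (q : ℕ) (i : Fin n) : ∃ h', ScaleBounded (a + 1) h' ∧ ∀ ε ∈ Ioc (0 : ℝ) 1, ∀ y,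
      fderiv ℝ (fun z => ζ ε z ^ (q + 1) * h ε z) y (bv i) = ζ ε y ^ q * h' ε y := by
  refine ⟨fun ε y => (q + 1) * (fderiv ℝ (ζ ε) y (bv i) * h ε y) +
    ζ ε y * fderiv ℝ (h ε) y (bv i), ?_, ?_⟩
  · refine ScaleBounded.add (ScaleBounded.const_mul ?_ _) ?_
    · have := (hζ.partial_deriv i).mul hh
      rwa [show 0 + 1 + a = a + 1 by omega] at this
    · have := hζ.mul (hh.partial_deriv i)
      rwa [zero_add] at this
  · intro ε hε y
    have hd1 := (hζ.smooth ε hε).differentiable (by simp) y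
    have hd2 := (hh.smooth ε hε).differentiable (by simp) y
    rw [fderiv_fun_mul (hd1.fun_pow _) hd2, fderiv_fun_pow _ hd1]
    simp
    ring

/-- Applying `(-Δ)^m` to `ζ^{q+2m} h` costs `2m` powers of `ζ` and of the scale. -/
lemma exists_negLaplacianPow_pow_mul {ζ : ℝ → E n → ℝ} (hζ : ScaleBounded 0 ζ)
    (hh : ScaleBounded a h) (q m : ℕ) :
    ∃ h', ScaleBounded (a + 2 * m) h' ∧ ∀ ε ∈ Ioc (0 : ℝ) 1, ∀ y,
      negLaplacianPow univ m (fun z => ζ ε z ^ (q + 2 * m) * h ε z) y = ζ ε y ^ q * h' ε y := by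
  induction m generalizing q with
  | zero => exact ⟨h, hh, fun ε hε y => rfl⟩
  | succ m ih =>
    obtain ⟨h₁, hh₁, e₁⟩ := ih (q + 2)
    choose h₂ hh₂ e₂ using fun i => exists_partial_pow_mul hζ hh₁ (q + 1) i
    choose h₃ hh₃ e₃ using fun i => exists_partial_pow_mul hζ (hh₂ i) q i
    refine ⟨fun ε y => (-1) * ∑ i, h₃ i ε y, ?_, ?_⟩
    · rw [show a + 2 * (m + 1) = a + 2 * m + 1 + 1 by omega]
      exact (ScaleBounded.sum _ fun i _ => hh₃ i).const_mul _
    · intro ε hε y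
      have e0 : negLaplacianPow univ m (fun z => ζ ε z ^ (q + 2 * (m + 1)) * h ε z) =
          fun z => ζ ε z ^ (q + 1 + 1) * h₁ ε z := by
        ext z
        rw [← e₁ ε hε z, show q + 2 * (m + 1) = q + 2 + 2 * m by omega]
      rw [negLaplacianPow_succ univ m, e0, negLaplacianPow_one_univ]
      have hsm : ContDiff ℝ ∞ fun z => ζ ε z ^ (q + 1 + 1) * h₁ ε z :=
        (pow hζ hh₁ (q + 1 + 1)).smooth ε hε
      have e4 : ∀ i : Fin n, fderiv ℝ (fderiv ℝ fun z => ζ ε z ^ (q + 1 + 1) * h₁ ε z) y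
          (bv i) (bv i) = ζ ε y ^ q * h₃ i ε y := by
        intro i
        rw [← fderiv_fderiv_apply (differentiableOn_fderiv isOpen_univ
          (contDiff_infty.1 hsm 2).contDiffOn (mem_univ y)), ← e₃ i ε hε y]
        congr 2
        ext z
        exact e₂ i ε hε z
      simp only [e4, ← Finset.mul_sum]
      ring

end ScaleBounded

open scoped Convolution in
/-- Rescaled convolutions of functions bounded by one with a fixed kernel are scale bounded, since
all derivatives fall on the kernel. -/
lemma ScaleBounded.convolution {g : ℝ → E n → ℝ} (hg : ∀ ε, Measurable (g ε))
    (hg1 : ∀ ε y, |g ε y| ≤ 1) {κ : E n → ℝ} (hκ : ContDiff ℝ ∞ κ) (hκc : HasCompactSupport κ) :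
    ScaleBounded 0 fun ε y =>
      (g ε ⋆[ContinuousLinearMap.lsmul ℝ ℝ, volume] κ) (ε⁻¹ • y) := by
  have hloc : ∀ ε, LocallyIntegrable (g ε) := fun ε =>
    (locallyIntegrable_const (1 : ℝ)).mono (hg ε).aestronglyMeasurable
      (Eventually.of_forall fun y => by simpa using hg1 ε y)
  have hsm : ∀ {κ : E n → ℝ}, ContDiff ℝ ∞ κ → HasCompactSupport κ → ∀ ε,
      ContDiff ℝ ∞ (g ε ⋆[ContinuousLinearMap.lsmul ℝ ℝ, volume] κ) := fun h1 h2 ε =>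
    h2.contDiff_convolution_right _ (hloc ε) h1
  refine ⟨fun ε _ => (hsm hκ hκc ε).comp (contDiff_const_smul _), fun l => ?_⟩
  induction l generalizing κ with
  | nil =>
    refine ⟨∫ t, |κ t|, fun ε _ y => ?_⟩
    simp only [iterPartial, List.length_nil, add_zero, pow_zero, div_one, convolution_def,
      ContinuousLinearMap.lsmul_apply, smul_eq_mul]
    have hint : Integrable κ := hκ.continuous.integrable_of_hasCompactSupport hκc
    refine (abs_integral_le_integral_abs).trans ?_
    rw [← integral_sub_left_eq_self (fun t => |κ t|) volume (ε⁻¹ • y)]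
    refine integral_mono_of_nonneg (Eventually.of_forall fun t => abs_nonneg _)
      (hint.comp_sub_left _).abs (Eventually.of_forall fun t => ?_)
    beta_reduce
    rw [abs_mul]
    exact mul_le_of_le_one_left (abs_nonneg _) (hg1 ε t)
  | cons i l ih =>
    obtain ⟨C, hC⟩ := ih (contDiff_partial hκ (bv i)) (hasCompactSupport_fderiv_apply hκc _)
    refine ⟨C, fun ε hε y => ?_⟩
    have h0 : 0 < ε := hε.1
    have e : (fun y => fderiv ℝ (fun y =>
        (g ε ⋆[ContinuousLinearMap.lsmul ℝ ℝ, volume] κ) (ε⁻¹ • y)) y (bv i)) = fun y => ε⁻¹ *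
          (g ε ⋆[ContinuousLinearMap.lsmul ℝ ℝ, volume] fun z => fderiv ℝ κ z (bv i)) (ε⁻¹ • y) := by
      ext z
      rw [← fderiv_convolution_apply (hloc ε) (hκ.of_le (by simp)) hκc]
      have := fderiv_comp_smul (𝕜 := ℝ)
        (f := g ε ⋆[ContinuousLinearMap.lsmul ℝ ℝ, volume] κ) (x := z) ε⁻¹
      rw [this]; rfl
    simp only [iterPartial]
    have hsm' : ContDiff ℝ ∞ fun y => (g ε ⋆[ContinuousLinearMap.lsmul ℝ ℝ, volume]
        fun z => fderiv ℝ κ z (bv i)) (ε⁻¹ • y) :=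
      (hsm (contDiff_partial hκ (bv i)) (hasCompactSupport_fderiv_apply hκc _) ε).comp
        (contDiff_const_smul _)
    rw [e, iterPartial_const_mul l _ hsm', abs_mul, abs_of_pos (inv_pos.2 h0)]
    calc _ ≤ ε⁻¹ * (C / ε ^ (0 + l.length)) := by gcongr; exact hC ε hε y
      _ = C / ε ^ (0 + (i :: l).length) := by
          rw [List.length_cons, ← add_assoc, pow_succ]
          field_simp

open scoped Convolution Pointwise in
/-- Cutoff functions at scale `ε` around a set, with the natural bounds on derivatives: at unit
scale, the indicator function of the complement of the `2`-neighbourhood is mollified. -/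
lemma exists_scaleBounded_cutoff (A : Set (E n)) : ∃ ζ : ℝ → E n → ℝ, ScaleBounded 0 ζ ∧
    ∀ ε ∈ Ioc (0 : ℝ) 1, ∀ y, ζ ε y ∈ Icc (0 : ℝ) 1 ∧ (y ∈ thickening ε A → ζ ε y = 0) ∧
      (y ∉ thickening (3 * ε) A → ζ ε y = 1) := by
  let φ : ContDiffBump (0 : E n) := ⟨1 / 2, 1, by norm_num, by norm_num⟩
  set T : ℝ → Set (E n) := fun ε => (thickening 2 (ε⁻¹ • A))ᶜ with hT
  set g : ℝ → E n → ℝ := fun ε => (T ε).indicator fun _ => 1 with hgdef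
  have hg : ∀ ε, Measurable (g ε) := fun ε =>
    measurable_const.indicator isOpen_thickening.measurableSet.compl
  have hg01 : ∀ ε y, g ε y ∈ Icc (0 : ℝ) 1 := fun ε y => by
    by_cases h : y ∈ T ε <;> simp [hgdef, h]
  have hflip : ∀ ε, (g ε ⋆[ContinuousLinearMap.lsmul ℝ ℝ, volume] φ.normed volume) =
      (φ.normed volume ⋆[ContinuousLinearMap.lsmul ℝ ℝ, volume] g ε) := by
    intro ε
    rw [← convolution_flip]
    congr 1
    ext; simp
  have hval : ∀ ε z c, (∀ w ∈ ball z 1, g ε w = c) →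
      (g ε ⋆[ContinuousLinearMap.lsmul ℝ ℝ, volume] φ.normed volume) z = c := by
    intro ε z c h
    rw [hflip, φ.normed_convolution_eq_right (x₀ := z)]
    · exact h z (mem_ball_self one_pos)
    · intro w hw; rw [h w hw, h z (mem_ball_self one_pos)]
  refine ⟨fun ε y => (g ε ⋆[ContinuousLinearMap.lsmul ℝ ℝ, volume] φ.normed volume) (ε⁻¹ • y),
    ScaleBounded.convolution hg (fun ε y => by
      rw [abs_of_nonneg (hg01 ε y).1]; exact (hg01 ε y).2) φ.contDiff_normed
      φ.hasCompactSupport_normed, ?_⟩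
  intro ε hε y
  have h0 : 0 < ε := hε.1
  have hscale : ∀ a ∈ A, dist (ε⁻¹ • y) (ε⁻¹ • a) = dist y a / ε := by
    intro a _
    rw [dist_smul₀, Real.norm_of_nonneg (inv_pos.2 h0).le]; field_simp
  refine ⟨?_, ?_, ?_⟩
  · have hint : Integrable fun t => g ε t * φ.normed volume (ε⁻¹ • y - t) := by
      refine Integrable.bdd_mul (c := 1) ((φ.integrable_normed).comp_sub_left _)
        (hg ε).aestronglyMeasurable (Eventually.of_forall fun t => ?_)
      rw [Real.norm_of_nonneg (hg01 ε t).1]; exact (hg01 ε t).2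
    simp only [convolution_def, ContinuousLinearMap.lsmul_apply, smul_eq_mul]
    constructor
    · exact integral_nonneg fun t => mul_nonneg (hg01 ε t).1 (φ.nonneg_normed _)
    · calc _ ≤ ∫ t, φ.normed volume (ε⁻¹ • y - t) := by
            refine integral_mono hint (φ.integrable_normed.comp_sub_left _) fun t => ?_
            exact mul_le_of_le_one_left (φ.nonneg_normed _) (hg01 ε t).2
        _ = 1 := by
            rw [integral_sub_left_eq_self (fun t => φ.normed volume t) volume]
            exact φ.integral_normed
  · intro hy
    refine hval ε _ 0 fun w hw => ?_
    obtain ⟨a, ha, hya⟩ := mem_thickening_iff.1 hy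
    have : w ∉ T ε := by
      simp only [hT, mem_compl_iff, not_not]
      refine mem_thickening_iff.2 ⟨ε⁻¹ • a, smul_mem_smul_set ha, ?_⟩
      have h1 := hscale a ha
      have h2 : dist y a / ε < 1 := by rwa [div_lt_one h0]
      have h3 := dist_triangle w (ε⁻¹ • y) (ε⁻¹ • a)
      rw [mem_ball] at hw
      linarith
    simp [hgdef, this]
  · intro hy
    refine hval ε _ 1 fun w hw => ?_
    have : w ∈ T ε := by
      intro hwT
      obtain ⟨b, hb, hwb⟩ := mem_thickening_iff.1 hwT
      obtain ⟨a, ha, rfl⟩ := mem_smul_set.1 hb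
      apply hy
      refine mem_thickening_iff.2 ⟨a, ha, ?_⟩
      have h1 := hscale a ha
      have h3 := dist_triangle (ε⁻¹ • y) w (ε⁻¹ • a)
      rw [mem_ball, dist_comm] at hw
      have : dist y a / ε < 3 := by linarith
      rwa [div_lt_iff₀ h0] at this
    simp [hgdef, this]

end

/-! ### Covering numbers and volumes of neighbourhoods -/

section

variable {n : ℕ}

/-- A set has covering dimension at most `d` if it is covered by `O(r^{-d})` balls of radius `r`
as `r → 0`. -/
def HasCoverBound (d : ℝ) (S : Set (E n)) : Prop :=
  ∃ C : ℝ, ∀ᶠ r : ℝ in 𝓝[>] 0, ∃ t : Finset (E n), (t.card : ℝ) ≤ C * r ^ (-d) ∧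
    S ⊆ ⋃ c ∈ t, ball c r

lemma volume_real_ball (x : E n) {r : ℝ} (hr : 0 < r) :
    volume.real (ball x r) = r ^ n * volume.real (ball (0 : E n) 1) := by
  have h := Measure.addHaar_ball_of_pos (volume : Measure (E n)) x hr
  rw [measureReal_def, h, ENNReal.toReal_mul, ENNReal.toReal_ofReal (by positivity),
    measureReal_def]
  simp

/-- Sets of small covering dimension have neighbourhoods of small volume. -/
lemma HasCoverBound.volume_thickening_le {d : ℝ} {S : Set (E n)} (h : HasCoverBound d S) :
    ∃ C : ℝ, ∀ᶠ r : ℝ in 𝓝[>] 0, volume.real (thickening r S) ≤ C * r ^ ((n : ℝ) - d) := by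
  obtain ⟨C, hC⟩ := h
  refine ⟨C * (2 ^ n * volume.real (ball (0 : E n) 1)), ?_⟩
  filter_upwards [hC, self_mem_nhdsWithin] with r hr hr0
  obtain ⟨t, ht, hSt⟩ := hr
  have hr0 : 0 < r := hr0
  have hsub : thickening r S ⊆ ⋃ c ∈ t, ball c (2 * r) := by
    intro y hy
    obtain ⟨s, hs, hys⟩ := mem_thickening_iff.1 hy
    obtain ⟨c, hc, hsc⟩ := mem_iUnion₂.1 (hSt hs)
    refine mem_iUnion₂.2 ⟨c, hc, ?_⟩
    rw [mem_ball] at hsc ⊢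
    linarith [dist_triangle y s c]
  calc volume.real (thickening r S) ≤ volume.real (⋃ c ∈ t, ball c (2 * r)) := by
        refine measureReal_mono hsub ?_
        exact ((measure_biUnion_finset_le t _).trans_lt
          (ENNReal.sum_lt_top.2 fun c _ => measure_ball_lt_top)).ne
    _ ≤ ∑ c ∈ t, volume.real (ball c (2 * r)) := measureReal_biUnion_finset_le t _
    _ = t.card * ((2 * r) ^ n * volume.real (ball (0 : E n) 1)) := by
        rw [Finset.sum_congr rfl fun c _ => volume_real_ball c (by positivity : 0 < 2 * r)]
        simp
    _ ≤ (C * r ^ (-d)) * ((2 * r) ^ n * volume.real (ball (0 : E n) 1)) := by gcongr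
    _ = C * (2 ^ n * volume.real (ball (0 : E n) 1)) * r ^ ((n : ℝ) - d) := by
        rw [sub_eq_add_neg, Real.rpow_add hr0, Real.rpow_natCast]; ring

lemma HasCoverBound.mono_dim {d d' : ℝ} {S : Set (E n)} (h : HasCoverBound d S) (hd : d ≤ d') :
    HasCoverBound d' S := by
  obtain ⟨C, hC⟩ := h
  refine ⟨|C|, ?_⟩
  filter_upwards [hC, Ioo_mem_nhdsGT one_pos] with r ⟨t, ht, hSt⟩ hr
  refine ⟨t, ht.trans ?_, hSt⟩
  have : r ^ (-d) ≤ r ^ (-d') := Real.rpow_le_rpow_of_exponent_ge hr.1 hr.2.le (by linarith)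
  have h1 := Real.rpow_nonneg hr.1.le (-d)
  calc C * r ^ (-d) ≤ |C| * r ^ (-d) := by gcongr; exact le_abs_self C
    _ ≤ |C| * r ^ (-d') := by gcongr

lemma HasCoverBound.mono {d : ℝ} {S T : Set (E n)} (h : HasCoverBound d T) (hST : S ⊆ T) :
    HasCoverBound d S := by
  obtain ⟨C, hC⟩ := h
  refine ⟨C, ?_⟩
  filter_upwards [hC] with r ⟨t, ht, hSt⟩
  exact ⟨t, ht, hST.trans hSt⟩

lemma HasCoverBound.union {d : ℝ} {S T : Set (E n)} (hS : HasCoverBound d S)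
    (hT : HasCoverBound d T) : HasCoverBound d (S ∪ T) := by
  classical
  obtain ⟨C, hC⟩ := hS
  obtain ⟨D, hD⟩ := hT
  refine ⟨C + D, ?_⟩
  filter_upwards [hC, hD] with r ⟨t, ht, hSt⟩ ⟨t', ht', hSt'⟩
  refine ⟨t ∪ t', ?_, ?_⟩
  · have : ((t ∪ t').card : ℝ) ≤ t.card + t'.card := by exact_mod_cast Finset.card_union_le t t'
    rw [add_mul]; linarith
  · intro y hy
    rcases hy with hy | hy
    · obtain ⟨c, hc, h⟩ := mem_iUnion₂.1 (hSt hy)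
      exact mem_iUnion₂.2 ⟨c, Finset.mem_union_left _ hc, h⟩
    · obtain ⟨c, hc, h⟩ := mem_iUnion₂.1 (hSt' hy)
      exact mem_iUnion₂.2 ⟨c, Finset.mem_union_right _ hc, h⟩

/-- A bounded subset of `ℝᵏ` is covered by `O(r^{-k})` balls of radius `r` centered in the set:
take a maximal `r`-separated subset and compare volumes. -/
lemma exists_cover_of_isBounded {k : ℕ} {S : Set (E k)} (hS : Bornology.IsBounded S) :
    ∃ C : ℝ, ∀ r ∈ Ioc (0 : ℝ) 1, ∃ t : Finset (E k), (↑t ⊆ S) ∧ (t.card : ℝ) ≤ C * r ^ (-(k : ℝ)) ∧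
      S ⊆ ⋃ c ∈ t, ball c r := by
  classical
  obtain ⟨R, hR0, hR⟩ := hS.subset_ball_lt 0 0
  refine ⟨(2 * (R + 1)) ^ k, fun r hr => ?_⟩
  have hr0 : 0 < r := hr.1
  let P : Finset (E k) → Prop := fun t => ↑t ⊆ S ∧ (t : Set (E k)).Pairwise fun a b => r ≤ dist a b
  have hcard : ∀ t, P t → (t.card : ℝ) ≤ (2 * (R + 1)) ^ k * r ^ (-(k : ℝ)) := by
    intro t ht
    have hdisj : (t : Set (E k)).PairwiseDisjoint fun c => ball c (r / 2) := by
      intro a ha b hb hab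
      refine ball_disjoint_ball ?_
      have := ht.2 ha hb hab
      linarith
    have hsub : (⋃ c ∈ t, ball c (r / 2)) ⊆ ball (0 : E k) (R + 1) := by
      intro y hy
      obtain ⟨c, hc, hyc⟩ := mem_iUnion₂.1 hy
      have h1 := hR (ht.1 hc)
      rw [mem_ball] at *
      linarith [dist_triangle y c 0, hr.2]
    have hv : 0 < volume.real (ball (0 : E k) 1) :=
      ENNReal.toReal_pos (measure_ball_pos _ _ one_pos).ne' measure_ball_lt_top.ne
    have h2 : (t.card : ℝ) * ((r / 2) ^ k * volume.real (ball (0 : E k) 1)) ≤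
        (R + 1) ^ k * volume.real (ball (0 : E k) 1) := by
      rw [← volume_real_ball (0 : E k) (by linarith : 0 < R + 1)]
      refine le_trans (le_of_eq ?_) (measureReal_mono hsub measure_ball_lt_top.ne)
      rw [measureReal_biUnion_finset hdisj fun c _ => measurableSet_ball,
        Finset.sum_congr rfl fun c _ => volume_real_ball c (by positivity : 0 < r / 2)]
      simp
    rw [← mul_assoc] at h2
    have h3 := le_of_mul_le_mul_right h2 hv
    rw [Real.rpow_neg hr0.le, Real.rpow_natCast, mul_pow, ← div_eq_mul_inv,
      le_div_iff₀ (by positivity)]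
    rw [div_pow] at h3
    have h4 : (0 : ℝ) < 2 ^ k := by positivity
    calc (t.card : ℝ) * r ^ k = (t.card * (r ^ k / 2 ^ k)) * 2 ^ k := by field_simp
      _ ≤ (R + 1) ^ k * 2 ^ k := by gcongr
      _ = 2 ^ k * (R + 1) ^ k := mul_comm _ _
  let Q : Set ℕ := {N | ∃ t, P t ∧ t.card = N}
  have hQne : Q.Nonempty := ⟨0, ∅, ⟨by simp, by simp⟩, rfl⟩
  have hQb : BddAbove Q := by
    refine ⟨⌈(2 * (R + 1)) ^ k * r ^ (-(k : ℝ))⌉₊, ?_⟩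
    rintro N ⟨t, ht, rfl⟩
    exact_mod_cast (hcard t ht).trans (Nat.le_ceil _)
  obtain ⟨t, ht, htN⟩ := Nat.sSup_mem hQne hQb
  refine ⟨t, ht.1, hcard t ht, fun y hy => ?_⟩
  by_contra hcon
  simp only [mem_iUnion, not_exists, mem_ball, not_lt] at hcon
  have hyt : y ∉ t := fun h => by
    have := hcon y h
    rw [dist_self] at this
    linarith
  have hP : P (insert y t) := by
    refine ⟨?_, ?_⟩
    · rw [Finset.coe_insert]
      exact insert_subset hy ht.1
    · rw [Finset.coe_insert]
      refine ht.2.insert fun b hb _ => ⟨hcon b hb, ?_⟩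
      rw [dist_comm]; exact hcon b hb
  have : (insert y t).card ≤ sSup Q := le_csSup hQb ⟨_, hP, rfl⟩
  rw [Finset.card_insert_of_notMem hyt] at this
  omega

/-- Lipschitz images of bounded subsets of `ℝᵏ` have covering dimension at most `k`. -/
lemma HasCoverBound.of_lipschitzOnWith {k : ℕ} {S : Set (E k)} (hS : Bornology.IsBounded S)
    {f : E k → E n} {L : NNReal} (hf : LipschitzOnWith L f S) : HasCoverBound k (f '' S) := by
  classical
  obtain ⟨C, hC⟩ := exists_cover_of_isBounded hS
  set M : ℝ := L + 1 with hM
  have hM0 : 0 < M := by positivity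
  refine ⟨C * M ^ (k : ℝ), ?_⟩
  filter_upwards [Ioo_mem_nhdsGT hM0] with r hr
  have hr0 : 0 < r := hr.1
  obtain ⟨t, htS, ht, hcov⟩ := hC (r / M) ⟨by positivity, by rw [div_le_one hM0]; exact hr.2.le⟩
  refine ⟨t.image f, ?_, ?_⟩
  · have h1 : ((t.image f).card : ℝ) ≤ t.card := by exact_mod_cast Finset.card_image_le
    refine h1.trans (ht.trans (le_of_eq ?_))
    rw [Real.div_rpow hr0.le hM0.le, Real.rpow_neg hM0.le, div_inv_eq_mul]
    ring
  · rintro _ ⟨y, hy, rfl⟩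
    obtain ⟨c, hc, hyc⟩ := mem_iUnion₂.1 (hcov hy)
    refine mem_iUnion₂.2 ⟨f c, Finset.mem_image_of_mem f hc, ?_⟩
    have h1 := hf.dist_le_mul y hy c (htS hc)
    rw [mem_ball, lt_div_iff₀ hM0] at hyc
    rw [mem_ball]
    have : (0 : ℝ) ≤ L := L.2
    by_cases h0 : dist y c = 0
    · rw [h0, mul_zero] at h1; linarith
    · have : 0 < dist y c := lt_of_le_of_ne dist_nonneg (Ne.symm h0)
      nlinarith

/-- The inclusion of `ℝᵏ` in `ℝⁿ` and the projection onto it. -/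
lemma exists_coordinate_linearMaps {k : ℕ} (hk : k ≤ n) :
    ∃ (ι : E k →ₗ[ℝ] E n) (π : E n →ₗ[ℝ] E k),
      ∀ z : E n, (∀ i : Fin n, k ≤ (i : ℕ) → z i = 0) → ι (π z) = z := by
  let ι : E k →ₗ[ℝ] E n :=
    { toFun := fun w => WithLp.toLp 2 fun i => if h : (i : ℕ) < k then w ⟨i, h⟩ else 0
      map_add' := fun w w' => by
        ext i; by_cases h : (i : ℕ) < k <;> simp [h]
      map_smul' := fun c w => by
        ext i; by_cases h : (i : ℕ) < k <;> simp [h] }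
  let π : E n →ₗ[ℝ] E k :=
    { toFun := fun z => WithLp.toLp 2 fun j => z (Fin.castLE hk j)
      map_add' := fun w w' => by ext i; simp
      map_smul' := fun c w => by ext i; simp }
  refine ⟨ι, π, fun z hz => ?_⟩
  ext i
  by_cases h : (i : ℕ) < k
  · simp [ι, π, h]
  · simp [ι, h, hz i (not_lt.1 h)]

/-- A compact smooth `k`-dimensional submanifold has covering dimension at most `k`: locally it is
a Lipschitz image of a bounded subset of `ℝᵏ`. -/
lemma IsSmoothSubmanifold.hasCoverBound {k : ℕ} {S : Set (E n)} (hS : IsSmoothSubmanifold k S)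
    (hc : IsCompact S) : HasCoverBound k S := by
  refine hc.induction_on (p := fun T => HasCoverBound k T) ?_ (fun _ _ h h' => h'.mono h)
    (fun _ _ => HasCoverBound.union) ?_
  · exact ⟨0, Eventually.of_forall fun r => ⟨∅, by simp, by simp⟩⟩
  intro p hp
  obtain ⟨Φ, hpΦ, -, hsymm, hflat⟩ := hS.2 p hp
  have hΦp : Φ p ∈ Φ.target := Φ.map_source hpΦ
  have hcd : ContDiffAt ℝ 1 Φ.symm (Φ p) :=
    (contDiffOn_infty.1 hsymm 1).contDiffAt (Φ.open_target.mem_nhds hΦp)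
  obtain ⟨L, t, ht, hLip⟩ := hcd.exists_lipschitzOnWith
  obtain ⟨δ, hδ, hδt⟩ := Metric.mem_nhds_iff.1 ht
  obtain ⟨ι, π, hιπ'⟩ := exists_coordinate_linearMaps hS.1
  set F : Set (E n) := {z | z ∈ ball (Φ p) δ ∧ ∀ i : Fin n, k ≤ (i : ℕ) → z i = 0} with hF
  have hιπ : ∀ z ∈ F, ι (π z) = z := by
    intro z hz
    exact hιπ' z hz.2
  have hFb : Bornology.IsBounded (π '' F) := by
    have h1 : Bornology.IsBounded F := isBounded_ball.subset fun z hz => hz.1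
    have := (LinearMap.toContinuousLinearMap π).lipschitz.isBounded_image h1
    simpa using this
  have hmaps : MapsTo ι (π '' F) t := by
    rintro _ ⟨z, hz, rfl⟩
    rw [hιπ z hz]
    exact hδt hz.1
  have hι : LipschitzOnWith ‖LinearMap.toContinuousLinearMap ι‖₊ ι (π '' F) :=
    ((LinearMap.toContinuousLinearMap ι).lipschitz).lipschitzOnWith
  have hcov := HasCoverBound.of_lipschitzOnWith hFb (hLip.comp hι hmaps)
  refine ⟨S ∩ (Φ.source ∩ Φ ⁻¹' ball (Φ p) δ), ?_, hcov.mono ?_⟩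
  · have hmem : p ∈ Φ.source ∩ Φ ⁻¹' ball (Φ p) δ :=
      mem_inter hpΦ (mem_preimage.2 (mem_ball_self hδ))
    exact inter_mem self_mem_nhdsWithin (mem_nhdsWithin_of_mem_nhds
      ((Φ.isOpen_inter_preimage isOpen_ball).mem_nhds hmem))
  · rintro y ⟨hyS, hys, hyb⟩
    have hyF : Φ y ∈ F := ⟨hyb, (hflat y hys).1 hyS⟩
    refine ⟨π (Φ y), mem_image_of_mem π hyF, ?_⟩
    simp only [Function.comp_apply]
    rw [hιπ _ hyF, Φ.left_inv hys]

/-- A bounded set of upper Minkowski dimension less than `D` has covering dimension at most `D`.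
Boundedness guarantees that the infimum defining the dimension is over a nonempty set. -/
lemma hasCoverBound_of_upperMinkowskiDim_lt {S : Set (E n)} (hS : Bornology.IsBounded S) {D : ℝ}
    (hD : upperMinkowskiDim S < D) : HasCoverBound D S := by
  have hne : {d : ℝ | 0 ≤ d ∧
      limsup (fun r : ℝ => minkowskiContent d r S) (𝓝[>] (0 : ℝ)) = 0}.Nonempty := by
    -- a bounded set has Minkowski content `O(r)` in dimension `n + 1`
    refine ⟨(n : ℝ) + 1, by positivity, ?_⟩
    obtain ⟨C, hC⟩ := exists_cover_of_isBounded hS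
    have hle : ∀ᶠ r : ℝ in 𝓝[>] 0, minkowskiContent ((n : ℝ) + 1) r S ≤ ENNReal.ofReal (C * r) := by
      filter_upwards [Ioo_mem_nhdsGT one_pos] with r hr
      obtain ⟨t, htS, ht, hcov⟩ := hC r ⟨hr.1, hr.2.le⟩
      have hcenters : ∃ c : Fin t.card → E n, (∀ k, c k ∈ S) ∧ S ⊆ ⋃ k, ball (c k) r := by
        refine ⟨fun k => t.equivFin.symm k, fun k => htS (t.equivFin.symm k).2, fun y hy => ?_⟩
        obtain ⟨c, hc, hyc⟩ := mem_iUnion₂.1 (hcov hy)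
        exact mem_iUnion.2 ⟨t.equivFin ⟨c, hc⟩, by simpa using hyc⟩
      refine (iInf₂_le t.card hcenters).trans ?_
      rw [← ENNReal.ofReal_natCast, ← ENNReal.ofReal_mul (Nat.cast_nonneg _)]
      refine ENNReal.ofReal_le_ofReal ?_
      calc (t.card : ℝ) * r ^ ((n : ℝ) + 1) ≤ (C * r ^ (-(n : ℝ))) * r ^ ((n : ℝ) + 1) := by
            have := hr.1
            gcongr
        _ = C * r := by
            rw [mul_assoc, ← Real.rpow_add hr.1]
            simp
    have hlim : Tendsto (fun r : ℝ => ENNReal.ofReal (C * r)) (𝓝[>] 0) (𝓝 0) := by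
      have : Tendsto (fun r : ℝ => ENNReal.ofReal (C * r)) (𝓝 0) (𝓝 (ENNReal.ofReal (C * 0))) :=
        (ENNReal.continuous_ofReal.comp (continuous_const.mul continuous_id)).tendsto 0
      simp only [mul_zero, ENNReal.ofReal_zero] at this
      exact this.mono_left nhdsWithin_le_nhds
    exact (tendsto_of_tendsto_of_tendsto_of_le_of_le' tendsto_const_nhds hlim
      (Eventually.of_forall fun _ => zero_le) hle).limsup_eq
  obtain ⟨d, ⟨hd0, hd⟩, hdD⟩ := exists_lt_of_csInf_lt hne hD
  refine HasCoverBound.mono_dim (d := d) ⟨1, ?_⟩ hdD.le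
  have hev : ∀ᶠ r : ℝ in 𝓝[>] 0, minkowskiContent d r S < 1 :=
    eventually_lt_of_limsup_lt (by rw [hd]; exact one_pos)
  classical
  filter_upwards [hev, self_mem_nhdsWithin] with r hr hr0
  have hr0 : 0 < r := hr0
  simp only [minkowskiContent, iInf_lt_iff] at hr
  obtain ⟨l, ⟨c, -, hc⟩, hl⟩ := hr
  refine ⟨Finset.univ.image c, ?_, ?_⟩
  · have h1 : ((Finset.univ.image c).card : ℝ) ≤ l := by
      exact_mod_cast Finset.card_image_le.trans (by simp)
    refine h1.trans ?_
    rw [← ENNReal.ofReal_natCast, ← ENNReal.ofReal_mul (Nat.cast_nonneg _),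
      ENNReal.ofReal_lt_one] at hl
    rw [Real.rpow_neg hr0.le, one_mul, ← one_div, le_div_iff₀ (by positivity)]
    exact hl.le
  · intro y hy
    obtain ⟨k, hk⟩ := mem_iUnion.1 (hc hy)
    exact mem_iUnion₂.2 ⟨c k, Finset.mem_image_of_mem c (Finset.mem_univ k), hk⟩

end

/-! ### Solutions singular on a small set -/

section

variable {n : ℕ}

lemma negLaplacianPow_const {m : ℕ} (hm : 1 ≤ m) (c : ℝ) (y : E n) :
    negLaplacianPow univ m (fun _ => c) y = 0 := by
  obtain ⟨j, rfl⟩ := Nat.exists_eq_add_of_le' hm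
  have h : negLaplacianPow univ 1 (fun _ : E n => c) = fun _ => 0 := by
    funext z
    rw [negLaplacianPow_one_univ]
    simp [fderiv_fun_const]
  rw [negLaplacianPow_succ' univ j, h]
  exact congrFun (negLaplacianPow_zero_fun _ _) y

/-- Young's inequality with a free parameter, in the form used to absorb cutoff errors. -/
lemma young_scaled {p p' : ℝ} (hp : p.HolderConjugate p') (k : ℕ) {s t ε : ℝ} (hs : 0 ≤ s)
    (ht : 0 < t) (hε : 0 < ε) :
    1 / ε ^ k * s ≤ t ^ p * s ^ p + t ^ (-p') * ε ^ (-(k * p')) := by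
  have h := Real.young_inequality_of_nonneg (a := t * s) (b := t⁻¹ * (1 / ε ^ k))
    (by positivity) (by positivity) hp
  have e1 : t * s * (t⁻¹ * (1 / ε ^ k)) = 1 / ε ^ k * s := by field_simp
  have e2 : (t * s) ^ p = t ^ p * s ^ p := Real.mul_rpow ht.le hs
  have e3 : (t⁻¹ * (1 / ε ^ k)) ^ p' = t ^ (-p') * ε ^ (-(k * p')) := by
    rw [Real.mul_rpow (by positivity) (by positivity), Real.inv_rpow ht.le, Real.rpow_neg ht.le,
      one_div, Real.inv_rpow (by positivity), Real.rpow_neg hε.le, Real.rpow_mul hε.le,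
      Real.rpow_natCast]
  rw [e1, e2, e3] at h
  refine h.trans (add_le_add ?_ ?_)
  · exact div_le_self (by positivity) hp.lt.le
  · exact div_le_self (by positivity) hp.symm.lt.le

/-- `v` is `C^{2m}` with compact support off the small compact set `Λ`, and in the
`δ`-neighbourhood of `Λ` it is nonnegative with `κ v^{(n+2m)/(n-2m)} ≤ (-Δ)^m v`. -/
structure IsSingularSupersolution (m : ℕ) (κ δ : ℝ) (Λ : Set (E n)) (v : E n → ℝ) : Prop where
  one_le : 1 ≤ m
  two_mul_lt : 2 * m < n
  isCompact : IsCompact Λ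
  cover : HasCoverBound (((n : ℝ) - 2 * m) / 2) Λ
  smooth : ContDiffOn ℝ ((2 * m : ℕ) : WithTop ℕ∞) v Λᶜ
  supp : HasCompactSupport v
  κ_pos : 0 < κ
  δ_pos : 0 < δ
  near : ∀ y ∈ thickening δ Λ \ Λ, 0 ≤ v y ∧
    κ * v y ^ (((n : ℝ) + 2 * m) / ((n : ℝ) - 2 * m)) ≤ negLaplacianPow univ m v y

namespace IsSingularSupersolution

variable {m : ℕ} {κ δ : ℝ} {Λ : Set (E n)} {v : E n → ℝ}

/-- The conjugate exponent of `(n+2m)/(n-2m)` is `(n+2m)/(4m)`. -/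
lemma holderConjugate (h : IsSingularSupersolution m κ δ Λ v) :
    (((n : ℝ) + 2 * m) / ((n : ℝ) - 2 * m)).HolderConjugate (((n : ℝ) + 2 * m) / (4 * m)) := by
  have h1 : (1 : ℝ) ≤ m := by exact_mod_cast h.one_le
  have h2 : (2 : ℝ) * m < n := by exact_mod_cast h.two_mul_lt
  have h3 : (0 : ℝ) < n - 2 * m := by linarith
  rw [Real.holderConjugate_iff]
  refine ⟨by rw [lt_div_iff₀ h3]; linarith, ?_⟩
  rw [inv_div, inv_div, ← add_div]
  rw [div_eq_one_iff_eq (by positivity)]; ring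

lemma isClosed (h : IsSingularSupersolution m κ δ Λ v) : IsClosed Λ := h.isCompact.isClosed

lemma continuousOn (h : IsSingularSupersolution m κ δ Λ v) :
    ContinuousOn (negLaplacianPow univ m v) Λᶜ := by
  have hΩ : IsOpen Λᶜ := h.isClosed.isOpen_compl
  exact ((contDiffOn_negLaplacianPow hΩ.uniqueDiffOn m (N := 0) h.smooth (by simp)).continuousOn).congr
    fun y hy => (negLaplacianPow_eqOn_univ hΩ subset_rfl (fun _ _ => rfl) m hy).symm

lemma hasCompactSupport (h : IsSingularSupersolution m κ δ Λ v) :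
    HasCompactSupport (negLaplacianPow univ m v) :=
  h.supp.of_isClosed_subset (isClosed_tsupport _) (tsupport_negLaplacianPow_subset v m)

/-- The neighbourhoods of `Λ` are small enough to compensate the cutoff errors: the exponent is
`2m` times the conjugate exponent of `(n+2m)/(n-2m)`. -/
lemma exists_volume_le (h : IsSingularSupersolution m κ δ Λ v) :
    ∃ C : ℝ, 0 ≤ C ∧ ∀ᶠ ε : ℝ in 𝓝[>] 0,
      volume.real (thickening (4 * ε) Λ) ≤ C * ε ^ (((n : ℝ) + 2 * m) / 2) := by
  obtain ⟨C, hC⟩ := h.cover.volume_thickening_le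
  have hlim : Tendsto (fun ε : ℝ => 4 * ε) (𝓝[>] 0) (𝓝[>] 0) := by
    refine tendsto_nhdsWithin_iff.2 ⟨?_, ?_⟩
    · have : Tendsto (fun ε : ℝ => 4 * ε) (𝓝 0) (𝓝 (4 * 0)) :=
        (continuous_const.mul continuous_id).tendsto 0
      rw [mul_zero] at this
      exact this.mono_left nhdsWithin_le_nhds
    · filter_upwards [self_mem_nhdsWithin] with ε hε
      have : (0 : ℝ) < ε := hε
      exact mem_Ioi.2 (by positivity)
  refine ⟨|C| * 4 ^ (((n : ℝ) + 2 * m) / 2), by positivity, ?_⟩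
  filter_upwards [hlim.eventually hC, self_mem_nhdsWithin] with ε hε h0
  have h0 : 0 < ε := h0
  refine hε.trans ?_
  rw [show (n : ℝ) - ((n : ℝ) - 2 * m) / 2 = ((n : ℝ) + 2 * m) / 2 by ring,
    Real.mul_rpow (by norm_num) h0.le, ← mul_assoc]
  gcongr
  exact le_abs_self C

lemma tendsto_volume (h : IsSingularSupersolution m κ δ Λ v) :
    Tendsto (fun ε : ℝ => volume (thickening (4 * ε) Λ)) (𝓝[>] 0) (𝓝 0) := by
  obtain ⟨C, hC0, hC⟩ := h.exists_volume_le
  have hfin : ∀ ε : ℝ, volume (thickening (4 * ε) Λ) ≠ ⊤ := fun ε =>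
    (h.isCompact.isBounded.thickening).measure_lt_top.ne
  have hlim : Tendsto (fun ε : ℝ => ENNReal.ofReal (C * ε ^ (((n : ℝ) + 2 * m) / 2))) (𝓝[>] 0)
      (𝓝 0) := by
    have hn : (0 : ℝ) < ((n : ℝ) + 2 * m) / 2 := by
      have : (1 : ℝ) ≤ m := by exact_mod_cast h.one_le
      positivity
    have h1 : Tendsto (fun ε : ℝ => C * ε ^ (((n : ℝ) + 2 * m) / 2)) (𝓝 0)
        (𝓝 (C * 0 ^ (((n : ℝ) + 2 * m) / 2))) :=
      ((Real.continuousAt_rpow_const 0 _ (Or.inr hn.le)).tendsto).const_mul C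
    rw [Real.zero_rpow hn.ne', mul_zero] at h1
    have h2 := (ENNReal.continuous_ofReal.tendsto 0).comp h1
    rw [ENNReal.ofReal_zero] at h2
    exact h2.mono_left nhdsWithin_le_nhds
  refine tendsto_of_tendsto_of_tendsto_of_le_of_le' tendsto_const_nhds hlim
    (Eventually.of_forall fun _ => zero_le) ?_
  filter_upwards [hC] with ε hε
  rw [← ENNReal.ofReal_toReal (hfin ε)]
  exact ENNReal.ofReal_le_ofReal hε

lemma volume_eq_zero (h : IsSingularSupersolution m κ δ Λ v) : volume Λ = 0 := by
  refine le_antisymm (ge_of_tendsto h.tendsto_volume ?_) zero_le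
  filter_upwards [self_mem_nhdsWithin] with ε hε
  have : (0 : ℝ) < ε := hε
  exact measure_mono (self_subset_thickening (by positivity) Λ)

section Cutoff

variable {ζ : ℝ → E n → ℝ}
  (hζ : ScaleBounded 0 ζ)
  (hζA : ∀ ε ∈ Ioc (0 : ℝ) 1, ∀ y, ζ ε y ∈ Icc (0 : ℝ) 1 ∧
    (y ∈ thickening ε Λ → ζ ε y = 0) ∧ (y ∉ thickening (3 * ε) Λ → ζ ε y = 1))

include hζA in
lemma tsupport_cutoff_subset {ε : ℝ} (hε : ε ∈ Ioc (0 : ℝ) 1) (q : ℕ) (hq : 1 ≤ q) :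
    tsupport (fun y => ζ ε y ^ q) ⊆ Λᶜ := by
  have h1 : tsupport (fun y => ζ ε y ^ q) ⊆ (thickening ε Λ)ᶜ := by
    refine closure_minimal ?_ isOpen_thickening.isClosed_compl
    intro y hy hyt
    apply hy
    simp only [(hζA ε hε y).2.1 hyt]
    exact zero_pow (by omega)
  exact h1.trans (compl_subset_compl.2 (self_subset_thickening hε.1 Λ))

include hζ hζA in
lemma integrable_cutoff_mul (h : IsSingularSupersolution m κ δ Λ v) {ε : ℝ}
    (hε : ε ∈ Ioc (0 : ℝ) 1) (q : ℕ) (hq : 1 ≤ q) :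
    Integrable fun y => ζ ε y ^ q * negLaplacianPow univ m v y :=
  (continuous_mul_of_tsupport_subset h.isClosed.isOpen_compl ((hζ.smooth ε hε).continuous.pow q)
    (tsupport_cutoff_subset hζA hε q hq) h.continuousOn).integrable_of_hasCompactSupport
    h.hasCompactSupport.mul_left

include hζ hζA in
/-- The basic estimate: the error made by integrating by parts against a test function `g` which is
cut off near `Λ` is controlled, through Young's inequality, by the equation itself. Only the region
where the cutoff is not constant contributes, because `v (-Δ)^m g = 0` almost everywhere. The power
`n + 2m` of the cutoff leaves a factor `ζ^n` after `2m` derivatives, and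
`(ζ^n)^{(n+2m)/(n-2m)} ≤ ζ^{n+2m}`. -/
lemma exists_abs_integral_cutoff_le (h : IsSingularSupersolution m κ δ Λ v) {g : E n → ℝ}
    (hg : ContDiff ℝ ∞ g) (hgc : HasCompactSupport g)
    (hvg : ∀ᵐ y, negLaplacianPow univ m g y * v y = 0) :
    ∃ C : ℝ, 0 ≤ C ∧ ∀ t : ℝ, 0 < t → ∀ᶠ ε : ℝ in 𝓝[>] 0,
      |∫ y, ζ ε y ^ (n + 2 * m) * g y * negLaplacianPow univ m v y| ≤
        C * (t ^ (((n : ℝ) + 2 * m) / ((n : ℝ) - 2 * m)) * (κ⁻¹ *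
          ∫ y in thickening (4 * ε) Λ, ζ ε y ^ (n + 2 * m) * negLaplacianPow univ m v y) +
            t ^ (-(((n : ℝ) + 2 * m) / (4 * m)))) := by
  set p : ℝ := ((n : ℝ) + 2 * m) / ((n : ℝ) - 2 * m) with hp
  set p' : ℝ := ((n : ℝ) + 2 * m) / (4 * m) with hp'
  set F := negLaplacianPow univ m v with hF
  have hpp : p.HolderConjugate p' := h.holderConjugate
  have hm1 : (1 : ℝ) ≤ m := by exact_mod_cast h.one_le
  have hmn : (2 : ℝ) * m < n := by exact_mod_cast h.two_mul_lt
  obtain ⟨h', hh', eh'⟩ := ScaleBounded.exists_negLaplacianPow_pow_mul hζ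
    (ScaleBounded.of_compactSupport hg hgc) n m
  obtain ⟨C₁, hC₁⟩ := hh'.bound []
  obtain ⟨C₂, hC₂0, hC₂⟩ := h.exists_volume_le
  refine ⟨|C₁| * (1 + C₂), by positivity, fun t ht => ?_⟩
  filter_upwards [hC₂, Ioo_mem_nhdsGT one_pos,
    Ioo_mem_nhdsGT (show 0 < δ / 4 by have := h.δ_pos; positivity)] with ε hvol hε1 hεδ
  have hε0 : 0 < ε := hε1.1
  have hε : ε ∈ Ioc (0 : ℝ) 1 := ⟨hε1.1, hε1.2.le⟩
  set T := thickening (4 * ε) Λ with hT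
  have hTδ : T ⊆ thickening δ Λ := thickening_mono (by linarith [hεδ.2]) Λ
  set ψ : E n → ℝ := fun y => ζ ε y ^ (n + 2 * m) * g y with hψ
  have hψs : ContDiff ℝ ∞ ψ := ((hζ.smooth ε hε).pow _).mul hg
  have hψc : HasCompactSupport ψ := hgc.mul_left
  have hψt : tsupport ψ ⊆ Λᶜ :=
    (closure_mono (Function.support_mul_subset_left (fun y => ζ ε y ^ (n + 2 * m)) g)).trans
      (tsupport_cutoff_subset hζA hε _ (by have := h.one_le; omega))
  have hibp : ∫ y, ψ y * F y = ∫ y, negLaplacianPow univ m ψ y * v y :=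
    integral_mul_negLaplacianPow h.isClosed.isOpen_compl m hψs hψc hψt h.smooth
  have hTfin : volume T ≠ ⊤ := (h.isCompact.isBounded.thickening).measure_lt_top.ne
  have hTm : MeasurableSet T := isOpen_thickening.measurableSet
  set B : E n → ℝ := fun y => |C₁| * (t ^ p * (κ⁻¹ * (ζ ε y ^ (n + 2 * m) * F y)) +
    t ^ (-p') * ε ^ (-(((2 * m : ℕ) : ℝ) * p'))) with hB
  have hFint := h.integrable_cutoff_mul hζ hζA hε (n + 2 * m) (by have := h.one_le; omega)
  have hBint : IntegrableOn B T := by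
    refine Integrable.const_mul (Integrable.add ?_ (integrableOn_const hTfin)) _
    exact ((hFint.integrableOn).const_mul _).const_mul _
  have hΛT : Λ ⊆ thickening ε Λ := self_subset_thickening hε0 Λ
  have hFnn : ∀ y ∈ T, 0 ≤ ζ ε y ^ (n + 2 * m) * F y := by
    intro y hy
    by_cases hyΛ : y ∈ Λ
    · rw [(hζA ε hε y).2.1 (hΛT hyΛ), zero_pow (by have := h.one_le; omega), zero_mul]
    · obtain ⟨hv, hk⟩ := h.near y ⟨hTδ hy, hyΛ⟩
      refine mul_nonneg (pow_nonneg (hζA ε hε y).1.1 _) (le_trans ?_ hk)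
      exact mul_nonneg h.κ_pos.le (Real.rpow_nonneg hv _)
  have hbound : ∀ᵐ y, ‖negLaplacianPow univ m ψ y * v y‖ ≤ T.indicator B y := by
    filter_upwards [hvg] with y hy0
    by_cases hyT : y ∈ T
    · rw [indicator_of_mem hyT]
      have hB0 : 0 ≤ t ^ (-p') * ε ^ (-(((2 * m : ℕ) : ℝ) * p')) := by positivity
      by_cases hyΛ : y ∈ Λ
      · rw [eh' ε hε y, (hζA ε hε y).2.1 (hΛT hyΛ), zero_pow (by have := h.two_mul_lt; omega)]
        simp only [zero_mul, norm_zero]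
        have := hFnn y hyT
        have := h.κ_pos
        simp only [hB]
        positivity
      · obtain ⟨hv, hk⟩ := h.near y ⟨hTδ hyT, hyΛ⟩
        have hz := (hζA ε hε y).1
        have hzn : 0 ≤ ζ ε y ^ n := pow_nonneg hz.1 _
        have hb := hC₁ ε hε y
        simp only [iterPartial, List.length_nil, add_zero, zero_add] at hb
        rw [eh' ε hε y, norm_mul, norm_mul, Real.norm_of_nonneg hzn, Real.norm_of_nonneg hv]
        have hy := young_scaled hpp (2 * m) (s := ζ ε y ^ n * v y) (mul_nonneg hzn hv) ht hε0
        have hs : (ζ ε y ^ n * v y) ^ p ≤ κ⁻¹ * (ζ ε y ^ (n + 2 * m) * F y) := by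
          rw [Real.mul_rpow hzn hv]
          have h1 : (ζ ε y ^ n) ^ p ≤ ζ ε y ^ (n + 2 * m) := by
            rw [← Real.rpow_natCast, ← Real.rpow_natCast, ← Real.rpow_mul hz.1]
            refine Real.rpow_le_rpow_of_exponent_ge' hz.1 hz.2 (by positivity) ?_
            push_cast
            rw [hp, mul_div_assoc', le_div_iff₀ (by linarith)]
            nlinarith
          have h2 : v y ^ p ≤ κ⁻¹ * F y := by
            rw [inv_mul_eq_div, le_div_iff₀ h.κ_pos, mul_comm]; exact hk
          calc (ζ ε y ^ n) ^ p * v y ^ p ≤ ζ ε y ^ (n + 2 * m) * (κ⁻¹ * F y) := by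
                have := hz.1
                gcongr
            _ = _ := by ring
        calc ζ ε y ^ n * ‖h' ε y‖ * v y ≤ ζ ε y ^ n * (|C₁| / ε ^ (2 * m)) * v y := by
              gcongr
              refine hb.trans ?_
              gcongr
              exact le_abs_self C₁
          _ = |C₁| * (1 / ε ^ (2 * m) * (ζ ε y ^ n * v y)) := by ring
          _ ≤ B y := by
              simp only [hB]
              gcongr
              refine hy.trans ?_
              gcongr
    · rw [indicator_of_notMem hyT]
      have hyc : y ∉ cthickening (3 * ε) Λ := fun hy =>
        hyT (cthickening_subset_thickening' (by positivity) (by linarith) Λ hy)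
      have := negLaplacianPow_congr_of_eqOn (s := univ) (f := ψ) (g := g)
        (isClosed_cthickening (δ := 3 * ε) (E := Λ)).isOpen_compl (fun z hz => by
          have : ζ ε z = 1 := (hζA ε hε z).2.2 fun hz' =>
            hz.2 (thickening_subset_cthickening _ _ hz')
          simp [hψ, this]) m ⟨trivial, hyc⟩
      rw [this, hy0, norm_zero]
  have hmain : |∫ y, ψ y * F y| ≤ ∫ y, T.indicator B y := by
    rw [hibp]
    exact norm_integral_le_of_norm_le ((integrable_indicator_iff hTm).2 hBint) hbound
  refine hmain.trans ?_
  rw [integral_indicator hTm, integral_const_mul, integral_add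
    ((hFint.integrableOn.const_mul _).const_mul _) (integrableOn_const hTfin), integral_const_mul,
    integral_const_mul, setIntegral_const, smul_eq_mul, mul_assoc]
  have hI0 : 0 ≤ ∫ y in T, ζ ε y ^ (n + 2 * m) * F y := setIntegral_nonneg hTm hFnn
  have hexp : ((2 * m : ℕ) : ℝ) * p' = ((n : ℝ) + 2 * m) / 2 := by
    rw [hp']; push_cast; field_simp; ring
  have hvol' : volume.real T * ε ^ (-(((2 * m : ℕ) : ℝ) * p')) ≤ C₂ := by
    rw [hexp, Real.rpow_neg hε0.le, ← div_eq_mul_inv, div_le_iff₀ (by positivity)]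
    exact hvol
  have hκ := h.κ_pos
  have htp : 0 ≤ t ^ (-p') := by positivity
  have hA : 0 ≤ t ^ p * (κ⁻¹ * ∫ y in T, ζ ε y ^ (n + 2 * m) * F y) := by positivity
  gcongr
  calc _ = t ^ p * (κ⁻¹ * ∫ y in T, ζ ε y ^ (n + 2 * m) * F y) +
        t ^ (-p') * (volume.real T * ε ^ (-(((2 * m : ℕ) : ℝ) * p'))) := by ring
    _ ≤ t ^ p * (κ⁻¹ * ∫ y in T, ζ ε y ^ (n + 2 * m) * F y) + t ^ (-p') * C₂ := by gcongr
    _ ≤ _ := by nlinarith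

end Cutoff

lemma integrableOn_of_isClosed (h : IsSingularSupersolution m κ δ Λ v) {A : Set (E n)}
    (hA : IsClosed A) (hAΛ : A ⊆ Λᶜ) : IntegrableOn (negLaplacianPow univ m v) A := by
  have h1 : IntegrableOn (negLaplacianPow univ m v) (A ∩ tsupport v) :=
    (h.continuousOn.mono (inter_subset_left.trans hAΛ)).integrableOn_compact
      (h.supp.isCompact.inter_left hA)
  refine h1.of_forall_sdiff_eq_zero hA.measurableSet fun y hy => ?_
  exact negLaplacianPow_eq_zero_of_notMem_tsupport fun hy' => hy.2 ⟨hy.1, hy'⟩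

/-- The equation is integrable across `Λ`: in the basic estimate, with a test function which is `1`
on the support of `v`, the right-hand side can be absorbed. -/
lemma integrable (h : IsSingularSupersolution m κ δ Λ v) :
    Integrable (negLaplacianPow univ m v) := by
  obtain ⟨ζ, hζ, hζA⟩ := exists_scaleBounded_cutoff Λ
  obtain ⟨g, hg, hgc, -, hg1, -⟩ := exists_smooth_cutoff h.supp.isCompact isOpen_univ
    (subset_univ (tsupport v))
  have hgv : ∀ y ∈ tsupport v, g =ᶠ[𝓝 y] fun _ => 1 := fun y hy => hg1.filter_mono
    (nhds_le_nhdsSet hy)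
  have hvg : ∀ᵐ y, negLaplacianPow univ m g y * v y = 0 := by
    refine Eventually.of_forall fun y => ?_
    by_cases hy : y ∈ tsupport v
    · obtain ⟨V, hV, hVo, hyV⟩ := _root_.eventually_nhds_iff.1 (hgv y hy)
      rw [negLaplacianPow_congr_of_eqOn (s := univ) (g := fun _ => (1 : ℝ)) hVo
        (fun z hz => hV z hz.2) m ⟨trivial, hyV⟩, negLaplacianPow_const h.one_le, zero_mul]
    · rw [image_eq_zero_of_notMem_tsupport hy, mul_zero]
  set F := negLaplacianPow univ m v with hF
  have hgF : ∀ y, g y * F y = F y := fun y => by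
    by_cases hy : y ∈ tsupport v
    · rw [(hgv y hy).self_of_nhds, one_mul]
    · rw [hF, negLaplacianPow_eq_zero_of_notMem_tsupport hy, mul_zero]
  obtain ⟨C, hC0, hC⟩ := h.exists_abs_integral_cutoff_le hζ hζA hg hgc hvg
  set p : ℝ := ((n : ℝ) + 2 * m) / ((n : ℝ) - 2 * m) with hp
  set p' : ℝ := ((n : ℝ) + 2 * m) / (4 * m) with hp'
  have hpp : p.HolderConjugate p' := h.holderConjugate
  have hκ := h.κ_pos
  have hδ := h.δ_pos
  have hm := h.one_le
  -- `t` is chosen so that the leading term on the right is absorbed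
  set t : ℝ := (κ / (2 * (C + 1))) ^ (p⁻¹) with ht
  have ht0 : 0 < t := by positivity
  have htp : t ^ p = κ / (2 * (C + 1)) := by
    rw [ht, ← Real.rpow_mul (by positivity), inv_mul_cancel₀ hpp.pos.ne', Real.rpow_one]
  set D := thickening δ Λ with hD
  have hDm : MeasurableSet D := isOpen_thickening.measurableSet
  have hDc : IntegrableOn F Dᶜ := h.integrableOn_of_isClosed isOpen_thickening.isClosed_compl
    (compl_subset_compl.2 (self_subset_thickening hδ Λ))
  set M := ∫ y in Dᶜ, ‖F y‖ with hM
  set ε : ℕ → ℝ := fun k => 1 / ((k : ℝ) + 1) with hεdef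
  have hε0 : ∀ k, 0 < ε k := fun k => by positivity
  have hεI : ∀ k, ε k ∈ Ioc (0 : ℝ) 1 := fun k =>
    ⟨hε0 k, div_le_one_of_le₀
      (by linarith [Nat.cast_nonneg (α := ℝ) k]) (by positivity)⟩
  have hεlim : Tendsto ε atTop (𝓝[>] 0) := tendsto_nhdsWithin_iff.2
    ⟨tendsto_one_div_add_atTop_nhds_zero_nat, Eventually.of_forall hε0⟩
  have hφ : AECover volume atTop fun k => (thickening (3 * ε k) Λ)ᶜ := by
    refine ⟨?_, fun k => isOpen_thickening.measurableSet.compl⟩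
    filter_upwards [compl_mem_ae_iff.2 h.volume_eq_zero] with y hy
    obtain ⟨r, hr, hyr⟩ := Metric.isOpen_iff.1 h.isClosed.isOpen_compl y hy
    have := hεlim.eventually (Ioo_mem_nhdsGT (show 0 < r / 3 by positivity))
    filter_upwards [this] with k hk hyk
    obtain ⟨z, hz, hyz⟩ := mem_thickening_iff.1 hyk
    exact hyr (mem_ball'.2 (hyz.trans (by linarith [hk.2]))) hz
  refine hφ.integrable_of_integral_norm_bounded (2 * (C * t ^ (-p') + M) + M) (fun k =>
    h.integrableOn_of_isClosed isOpen_thickening.isClosed_compl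
      (compl_subset_compl.2 (self_subset_thickening (by have := hε0 k; positivity) Λ))) ?_
  filter_upwards [hεlim.eventually (hC t ht0),
    hεlim.eventually (Ioo_mem_nhdsGT (show 0 < δ / 4 by positivity))] with k hk hkδ
  have hFk := h.integrable_cutoff_mul hζ hζA (hεI k) (n + 2 * m) (by omega)
  have hζk : ∀ y, ζ (ε k) y ^ (n + 2 * m) ∈ Icc (0 : ℝ) 1 := fun y =>
    ⟨pow_nonneg (hζA _ (hεI k) y).1.1 _,
      pow_le_one₀ (hζA _ (hεI k) y).1.1 (hζA _ (hεI k) y).1.2⟩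
  have hnn : ∀ y ∈ D, 0 ≤ ζ (ε k) y ^ (n + 2 * m) * F y := by
    intro y hy
    by_cases hyΛ : y ∈ Λ
    · rw [(hζA _ (hεI k) y).2.1 (self_subset_thickening (hε0 k) Λ hyΛ),
        zero_pow (by omega), zero_mul]
    · obtain ⟨hv, hk⟩ := h.near y ⟨hy, hyΛ⟩
      exact mul_nonneg (hζk y).1 (le_trans (mul_nonneg hκ.le (Real.rpow_nonneg hv _)) hk)
  set I := ∫ y in D, ζ (ε k) y ^ (n + 2 * m) * F y with hI
  have hIT : ∫ y in thickening (4 * ε k) Λ, ζ (ε k) y ^ (n + 2 * m) * F y ≤ I := by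
    refine setIntegral_mono_set hFk.integrableOn ((ae_restrict_iff' hDm).2
      (Eventually.of_forall hnn)) (LE.le.eventuallyLE ?_)
    exact thickening_mono (by linarith [hkδ.2]) Λ
  have hout : ∫ y in Dᶜ, ‖ζ (ε k) y ^ (n + 2 * m) * F y‖ ≤ M := by
    refine setIntegral_mono hFk.norm.integrableOn hDc.norm fun y => ?_
    rw [norm_mul, Real.norm_of_nonneg (hζk y).1]
    exact mul_le_of_le_one_left (norm_nonneg _) (hζk y).2
  have hsplit := integral_add_compl hDm hFk
  have hout' := (norm_integral_le_integral_norm _).trans hout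
  rw [Real.norm_eq_abs] at hout'
  have hk' : |∫ y, ζ (ε k) y ^ (n + 2 * m) * F y| ≤ I / 2 + C * t ^ (-p') := by
    have e : ∀ y, ζ (ε k) y ^ (n + 2 * m) * g y * F y = ζ (ε k) y ^ (n + 2 * m) * F y :=
      fun y => by rw [mul_assoc, hgF]
    rw [← hF] at hk
    simp only [e] at hk
    refine hk.trans ?_
    rw [htp, mul_add]
    gcongr
    have hI0 : 0 ≤ I := setIntegral_nonneg hDm hnn
    calc _ ≤ C * (κ / (2 * (C + 1)) * (κ⁻¹ * I)) := by gcongr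
      _ = C / (C + 1) * (I / 2) := by field_simp
      _ ≤ 1 * (I / 2) := by
        gcongr
        exact div_le_one_of_le₀ (by linarith) (by linarith)
      _ = I / 2 := one_mul _
  have hIle : I ≤ 2 * (C * t ^ (-p') + M) := by
    have h1 := (abs_le.1 hk').2
    have h2 := (abs_le.1 hout').1
    linarith
  calc ∫ y in (thickening (3 * ε k) Λ)ᶜ, ‖F y‖
      = ∫ y in (thickening (3 * ε k) Λ)ᶜ, ‖ζ (ε k) y ^ (n + 2 * m) * F y‖ := by
        refine setIntegral_congr_fun isOpen_thickening.measurableSet.compl fun y hy => ?_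
        simp only [(hζA _ (hεI k) y).2.2 hy, one_pow, one_mul]
    _ ≤ ∫ y, ‖ζ (ε k) y ^ (n + 2 * m) * F y‖ :=
        setIntegral_le_integral hFk.norm (Eventually.of_forall fun _ => norm_nonneg _)
    _ = I + ∫ y in Dᶜ, ‖ζ (ε k) y ^ (n + 2 * m) * F y‖ := by
        rw [← integral_add_compl hDm hFk.norm]
        congr 1
        exact setIntegral_congr_fun hDm fun y hy => Real.norm_of_nonneg (hnn y hy)
    _ ≤ _ := add_le_add hIle hout

/-- Integration by parts holds across `Λ`: the equation of `v` has no singular part on `Λ`. In the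
basic estimate one lets first `ε → 0` and then `t → ∞`. -/
lemma integral_mul_eq_zero (h : IsSingularSupersolution m κ δ Λ v) {g : E n → ℝ}
    (hg : ContDiff ℝ ∞ g) (hgc : HasCompactSupport g)
    (hvg : ∀ᵐ y, negLaplacianPow univ m g y * v y = 0) :
    ∫ y, g y * negLaplacianPow univ m v y = 0 := by
  obtain ⟨ζ, hζ, hζA⟩ := exists_scaleBounded_cutoff Λ
  obtain ⟨C, hC0, hC⟩ := h.exists_abs_integral_cutoff_le hζ hζA hg hgc hvg
  have hFint := h.integrable
  set F := negLaplacianPow univ m v with hF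
  set p : ℝ := ((n : ℝ) + 2 * m) / ((n : ℝ) - 2 * m) with hp
  set p' : ℝ := ((n : ℝ) + 2 * m) / (4 * m) with hp'
  have hpp : p.HolderConjugate p' := h.holderConjugate
  have hm := h.one_le
  have hIoc : ∀ᶠ ε : ℝ in 𝓝[>] 0, ε ∈ Ioc (0 : ℝ) 1 := by
    filter_upwards [Ioo_mem_nhdsGT one_pos] with ε hε using ⟨hε.1, hε.2.le⟩
  have hgF : Integrable fun y => g y * F y := by
    obtain ⟨B, hB⟩ := hg.continuous.bounded_above_of_compact_support hgc
    exact hFint.bdd_mul hg.continuous.aestronglyMeasurable (Eventually.of_forall hB)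
  have hζ1 : ∀ ε ∈ Ioc (0 : ℝ) 1, ∀ y, ‖ζ ε y ^ (n + 2 * m)‖ ≤ 1 := fun ε hε y => by
    rw [norm_pow, Real.norm_of_nonneg (hζA ε hε y).1.1]
    exact pow_le_one₀ (hζA ε hε y).1.1 (hζA ε hε y).1.2
  have hlim1 : Tendsto (fun ε => ∫ y, ζ ε y ^ (n + 2 * m) * g y * F y) (𝓝[>] 0)
      (𝓝 (∫ y, g y * F y)) := by
    refine tendsto_integral_filter_of_dominated_convergence (fun y => ‖g y * F y‖) ?_ ?_
      hgF.norm ?_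
    · filter_upwards [hIoc] with ε hε
      simp only [mul_assoc]
      exact (((hζ.smooth ε hε).continuous.pow _).aestronglyMeasurable).mul
        hgF.aestronglyMeasurable
    · filter_upwards [hIoc] with ε hε
      refine Eventually.of_forall fun y => ?_
      rw [mul_assoc, norm_mul]
      exact mul_le_of_le_one_left (norm_nonneg _) (hζ1 ε hε y)
    · filter_upwards [compl_mem_ae_iff.2 h.volume_eq_zero] with y hy
      refine Tendsto.congr' ?_ tendsto_const_nhds
      obtain ⟨r, hr, hyr⟩ := Metric.isOpen_iff.1 h.isClosed.isOpen_compl y hy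
      filter_upwards [hIoc, Ioo_mem_nhdsGT (show 0 < r / 3 by positivity)] with ε hε hεr
      rw [(hζA ε hε y).2.2, one_pow, one_mul]
      intro hyk
      obtain ⟨z, hz, hyz⟩ := mem_thickening_iff.1 hyk
      exact hyr (mem_ball'.2 (hyz.trans (by linarith [hεr.2]))) hz
  have hlim2 : Tendsto (fun ε => ∫ y in thickening (4 * ε) Λ, ‖F y‖) (𝓝[>] 0) (𝓝 0) :=
    hFint.norm.tendsto_setIntegral_nhds_zero h.tendsto_volume
  have hbound : ∀ t : ℝ, 0 < t → |∫ y, g y * F y| ≤ C * t ^ (-p') := by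
    intro t ht
    have hl : Tendsto (fun ε => C * (t ^ p * (κ⁻¹ * ∫ y in thickening (4 * ε) Λ, ‖F y‖) +
        t ^ (-p'))) (𝓝[>] 0) (𝓝 (C * (t ^ p * (κ⁻¹ * 0) + t ^ (-p')))) :=
      (((hlim2.const_mul _).const_mul _).add_const _).const_mul C
    rw [mul_zero, mul_zero, zero_add] at hl
    refine le_of_tendsto_of_tendsto hlim1.abs hl ?_
    filter_upwards [hC t ht, hIoc] with ε hε hεI
    refine hε.trans ?_
    have hκ := h.κ_pos
    gcongr
    · refine (h.integrable_cutoff_mul hζ hζA hεI (n + 2 * m) (by omega)).integrableOn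
    · exact hFint.norm.integrableOn
    · exact isOpen_thickening.measurableSet.nullMeasurableSet
    · refine (le_abs_self _).trans ?_
      rw [abs_mul]
      exact mul_le_of_le_one_left (abs_nonneg _) (hζ1 ε hεI y)
  have hlim3 : Tendsto (fun t : ℝ => C * t ^ (-p')) atTop (𝓝 (C * 0)) :=
    (tendsto_rpow_neg_atTop hpp.symm.pos).const_mul C
  rw [mul_zero] at hlim3
  have := ge_of_tendsto hlim3 (by filter_upwards [eventually_gt_atTop 0] with t ht using hbound t ht)
  exact abs_nonpos_iff.1 this

end IsSingularSupersolution

end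

/-! ### The Laplacian of functions of quadratic polynomials -/

section

variable {n : ℕ}

/-- The quadratic function `α |y|² + ⟨b, y⟩ + γ`. -/
noncomputable def quad (α γ : ℝ) (b y : E n) : ℝ := α * ‖y‖ ^ 2 + inner ℝ b y + γ

lemma hasFDerivAt_quad (α γ : ℝ) (b y : E n) :
    HasFDerivAt (quad α γ b) (innerSL ℝ ((2 * α) • y + b)) y := by
  have h1 : HasFDerivAt (fun z : E n => ‖z‖ ^ 2) (2 • innerSL ℝ y) y :=
    (hasStrictFDerivAt_norm_sq y).hasFDerivAt
  have h2 : HasFDerivAt (fun z : E n => inner ℝ b z) (innerSL ℝ b) y := (innerSL ℝ b).hasFDerivAt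
  refine (((h1.const_mul α).add h2).add_const γ).congr_fderiv ?_
  ext v
  simp
  ring

lemma contDiff_quad (α γ : ℝ) (b : E n) : ContDiff ℝ ∞ (quad α γ b) := by
  exact ((contDiff_const.mul (contDiff_norm_sq ℝ)).add (innerSL ℝ b).contDiff).add contDiff_const

lemma sum_inner_bv_mul (w v : E n) : ∑ i, inner ℝ w (bv i) * inner ℝ v (bv i) = inner ℝ w v := by
  rw [← (EuclideanSpace.basisFun (Fin n) ℝ).sum_inner_mul_inner w v]
  refine Finset.sum_congr rfl fun i _ => ?_
  rw [EuclideanSpace.basisFun_apply, real_inner_comm v]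

/-- The Laplacian of a function of a quadratic function. -/
lemma negLaplacianPow_one_comp_quad {α γ : ℝ} {b y : E n} {F F' : ℝ → ℝ} {F'' : ℝ}
    (hF : ∀ᶠ t in 𝓝 (quad α γ b y), HasDerivAt F (F' t) t)
    (hF' : HasDerivAt F' F'' (quad α γ b y)) :
    negLaplacianPow univ 1 (fun z => F (quad α γ b z)) y =
      -(F' (quad α γ b y) * (2 * α * n) +
        F'' * (4 * α * quad α γ b y + (‖b‖ ^ 2 - 4 * α * γ))) := by
  have h1 : fderiv ℝ (fun z => F (quad α γ b z)) =ᶠ[𝓝 y]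
      fun z => F' (quad α γ b z) • innerSL ℝ ((2 * α) • z + b) := by
    filter_upwards [(contDiff_quad α γ b).continuous.continuousAt.eventually hF] with z hz
    exact (hz.comp_hasFDerivAt z (hasFDerivAt_quad α γ b z)).fderiv
  have h2 : HasFDerivAt (fun z : E n => innerSL ℝ ((2 * α) • z + b))
      ((innerSL ℝ).comp ((2 * α) • ContinuousLinearMap.id ℝ (E n))) y :=
    (innerSL ℝ).hasFDerivAt.comp y (((hasFDerivAt_id y).const_smul (2 * α)).add_const b)
  have h3 := ((hF'.comp_hasFDerivAt y (hasFDerivAt_quad α γ b y)).smul h2).congr_of_eventuallyEq h1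
  rw [negLaplacianPow_one_univ, h3.fderiv]
  have h4 : ∀ i : Fin n, inner ℝ (bv i : E n) (bv i) = (1 : ℝ) := fun i => by simp
  simp only [_root_.add_apply, _root_.smul_apply,
    ContinuousLinearMap.smulRight_apply, ContinuousLinearMap.comp_apply, innerSL_apply_apply,
    ContinuousLinearMap.id_apply, inner_smul_left, Finset.sum_add_distrib, h4, smul_eq_mul,
    Function.comp_apply, Finset.sum_const, Finset.card_univ, Fintype.card_fin, nsmul_eq_mul]
  have h5 : ∑ i : Fin n, F'' * inner ℝ ((2 * α) • y + b) (bv i : E n) *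
      inner ℝ ((2 * α) • y + b) (bv i : E n) = F'' * ‖(2 * α) • y + b‖ ^ 2 := by
    simp only [mul_assoc]
    rw [← Finset.mul_sum, sum_inner_bv_mul, real_inner_self_eq_norm_sq]
  rw [h5, norm_add_sq_real, norm_smul, inner_smul_left, real_inner_comm]
  simp only [quad, mul_pow, Real.norm_eq_abs, sq_abs, conj_trivial]
  ring

/-- The Laplacian of a real power of a quadratic function. -/
lemma negLaplacianPow_one_quad_rpow {α γ : ℝ} {b y : E n} (a : ℝ) (hq : quad α γ b y ≠ 0) :
    negLaplacianPow univ 1 (fun z => quad α γ b z ^ a) y =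
      -(2 * a * α * (n + 2 * a - 2) * quad α γ b y ^ (a - 1) +
        a * (a - 1) * (‖b‖ ^ 2 - 4 * α * γ) * quad α γ b y ^ (a - 2)) := by
  rw [negLaplacianPow_one_comp_quad (F := fun t => t ^ a) (F' := fun t => a * t ^ (a - 1))
    (F'' := a * ((a - 1) * quad α γ b y ^ (a - 1 - 1)))]
  · have h : quad α γ b y ^ (a - 1) = quad α γ b y ^ (a - 2) * quad α γ b y := by
      rw [← Real.rpow_add_one hq]; ring_nf
    rw [show a - 1 - 1 = a - 2 by ring, h]
    ring
  · filter_upwards [isOpen_ne.mem_nhds hq] with t ht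
    exact Real.hasDerivAt_rpow_const (Or.inl ht)
  · exact (Real.hasDerivAt_rpow_const (Or.inl hq)).const_mul a

/-- The Laplacian of a product. -/
lemma negLaplacianPow_one_mul {f g : E n → ℝ} {y : E n} (hf : ContDiffAt ℝ 2 f y)
    (hg : ContDiffAt ℝ 2 g y) :
    negLaplacianPow univ 1 (fun z => f z * g z) y =
      f y * negLaplacianPow univ 1 g y + g y * negLaplacianPow univ 1 f y -
        2 * ∑ i, fderiv ℝ f y (bv i) * fderiv ℝ g y (bv i) := by
  have h1 : fderiv ℝ (fun z => f z * g z) =ᶠ[𝓝 y]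
      fun z => f z • fderiv ℝ g z + g z • fderiv ℝ f z := by
    filter_upwards [hf.eventually (by simp), hg.eventually (by simp)] with z hfz hgz
    exact fderiv_fun_mul (hfz.differentiableAt (by simp)) (hgz.differentiableAt (by simp))
  have hf1 := (hf.differentiableAt (by simp)).hasFDerivAt
  have hg1 := (hg.differentiableAt (by simp)).hasFDerivAt
  have hf2 := ((hf.fderiv_right (m := 1) (by norm_num)).differentiableAt (by simp)).hasFDerivAt
  have hg2 := ((hg.fderiv_right (m := 1) (by norm_num)).differentiableAt (by simp)).hasFDerivAt
  have h3 := ((hf1.smul hg2).add (hg1.smul hf2)).congr_of_eventuallyEq h1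
  simp only [negLaplacianPow_one_univ]
  rw [h3.fderiv]
  simp only [_root_.add_apply, _root_.smul_apply,
    ContinuousLinearMap.smulRight_apply, smul_eq_mul, Finset.sum_add_distrib, ← Finset.mul_sum]
  have h6 : ∑ i, fderiv ℝ g y (bv i) * fderiv ℝ f y (bv i) =
      ∑ i, fderiv ℝ f y (bv i) * fderiv ℝ g y (bv i) :=
    Finset.sum_congr rfl fun i _ => mul_comm _ _
  rw [h6]
  ring

lemma sum_inner_bv_mul_apply (w : E n) (A : E n →L[ℝ] ℝ) :
    ∑ i, inner ℝ w (bv i) * A (bv i) = A w := by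
  have h := (EuclideanSpace.basisFun (Fin n) ℝ).sum_repr w
  conv_rhs => rw [← h]
  rw [map_sum]
  refine Finset.sum_congr rfl fun i _ => ?_
  rw [map_smul, smul_eq_mul, EuclideanSpace.basisFun_repr, EuclideanSpace.basisFun_apply,
    EuclideanSpace.inner_single_right]
  simp

/-- `Δ(|y|^{2(j+1)} k) = (2j+2) |y|^{2j} ((2j+n) k + 2 y·∇k)` for harmonic `k`. -/
lemma negLaplacianPow_one_norm_pow_mul (j : ℕ) {k : E n → ℝ} {y : E n} (hk : ContDiffAt ℝ 2 k y)
    (hk0 : negLaplacianPow univ 1 k y = 0) :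
    negLaplacianPow univ 1 (fun z => (‖z‖ ^ 2) ^ (j + 1) * k z) y =
      -((2 * j + 2) * ((‖y‖ ^ 2) ^ j * ((2 * j + n) * k y + 2 * fderiv ℝ k y y))) := by
  have hq : ∀ z : E n, quad 1 0 0 z = ‖z‖ ^ 2 := fun z => by simp [quad]
  have hd : ∀ t : ℝ, HasDerivAt (fun t : ℝ => t ^ (j + 1)) ((j + 1 : ℕ) * t ^ j) t := fun t => by
    simpa using hasDerivAt_pow (j + 1) t
  have h1 := negLaplacianPow_one_comp_quad (n := n) (α := 1) (γ := 0) (b := 0) (y := y)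
    (F := fun t => t ^ (j + 1)) (F' := fun t => (j + 1 : ℕ) * t ^ j)
    (F'' := (j + 1 : ℕ) * (j * (‖y‖ ^ 2) ^ (j - 1))) (Eventually.of_forall hd)
    (by rw [hq]; exact (hasDerivAt_pow j (‖y‖ ^ 2)).const_mul _)
  have h2 : HasFDerivAt (fun z : E n => (‖z‖ ^ 2) ^ (j + 1))
      (((j + 1 : ℕ) * (‖y‖ ^ 2) ^ j) • innerSL ℝ ((2 : ℝ) • y)) y := by
    have := (hd (quad 1 0 0 y)).comp_hasFDerivAt y (hasFDerivAt_quad 1 0 0 y)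
    simpa [Function.comp_def, hq] using this
  simp only [hq] at h1
  rw [negLaplacianPow_one_mul ((contDiff_norm_sq ℝ).pow _).contDiffAt hk, hk0, h1, h2.fderiv]
  simp only [_root_.smul_apply, innerSL_apply_apply, smul_eq_mul, mul_assoc,
    ← Finset.mul_sum, sum_inner_bv_mul_apply, map_smul]
  rcases j with _ | j
  · simp; ring
  · simp only [norm_zero, Nat.add_sub_cancel, pow_succ]
    push_cast
    ring

end

/-! ### Radial means -/

section

variable {n : ℕ}

/-- The weighted radial mean `∫₀¹ t^β h(ty) dt`. -/
noncomputable def radialMean {F : Type} [NormedAddCommGroup F] [NormedSpace ℝ F] (β : ℝ)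
    (h : E n → F) (y : E n) : F :=
  ∫ t in (0 : ℝ)..1, t ^ β • h (t • y)

section

variable {F : Type} [NormedAddCommGroup F] [NormedSpace ℝ F] {R β : ℝ} {h : E n → F} {y : E n}

lemma smul_mem_ball_zero {t r : ℝ} (ht : t ∈ Icc (0 : ℝ) 1) (hy : y ∈ ball (0 : E n) r) :
    t • y ∈ ball (0 : E n) r := by
  rw [mem_ball_zero_iff] at *
  rw [norm_smul, Real.norm_of_nonneg ht.1]
  exact (mul_le_of_le_one_left (norm_nonneg _) ht.2).trans_lt hy

lemma continuousOn_radial_integrand (hβ : 0 ≤ β) (hh : ContinuousOn h (ball 0 R))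
    (hy : y ∈ ball 0 R) : ContinuousOn (fun t : ℝ => t ^ β • h (t • y)) (Icc 0 1) := by
  refine ContinuousOn.smul (Real.continuous_rpow_const hβ).continuousOn
    (hh.comp (by fun_prop) fun t ht => smul_mem_ball_zero ht hy)

lemma intervalIntegrable_radial_integrand (hβ : 0 ≤ β) (hh : ContinuousOn h (ball 0 R))
    (hy : y ∈ ball 0 R) :
    IntervalIntegrable (fun t : ℝ => t ^ β • h (t • y)) volume 0 1 :=
  (by simpa using continuousOn_radial_integrand hβ hh hy :
    ContinuousOn _ (uIcc (0 : ℝ) 1)).intervalIntegrable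

lemma hasFDerivAt_radialMean (hβ : 0 ≤ β) (hh : ContDiffOn ℝ 1 h (ball 0 R)) (hy : y ∈ ball 0 R) :
    HasFDerivAt (radialMean β h) (radialMean (β + 1) (fderiv ℝ h) y) y := by
  have hfd : ContinuousOn (fderiv ℝ h) (ball 0 R) :=
    hh.continuousOn_fderiv_of_isOpen isOpen_ball le_rfl
  obtain ⟨r, hyr, hrR⟩ := exists_between (mem_ball_zero_iff.1 hy)
  have hrU : closedBall (0 : E n) r ⊆ ball 0 R := closedBall_subset_ball hrR
  obtain ⟨C, hC⟩ := (isCompact_closedBall (0 : E n) r).exists_bound_of_continuousOn (hfd.mono hrU)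
  have hC0 : 0 ≤ C := (norm_nonneg _).trans (hC 0 (mem_closedBall_self ((norm_nonneg _).trans hyr.le)))
  have hI : uIoc (0 : ℝ) 1 ⊆ Icc 0 1 := by
    rw [uIoc_of_le zero_le_one]; exact Ioc_subset_Icc_self
  have hmeas : ∀ {G : Type} [NormedAddCommGroup G] [NormedSpace ℝ G] {g : E n → G} {b : ℝ},
      0 ≤ b → ContinuousOn g (ball 0 R) → ∀ z ∈ ball (0 : E n) R,
      AEStronglyMeasurable (fun t : ℝ => t ^ b • g (t • z)) (volume.restrict (uIoc 0 1)) :=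
    fun hb hg z hz => ((continuousOn_radial_integrand hb hg hz).mono
      hI).aestronglyMeasurable measurableSet_uIoc
  refine intervalIntegral.hasFDerivAt_integral_of_dominated_of_fderiv_le (bound := fun _ => C)
    (F' := fun z t => t ^ (β + 1) • fderiv ℝ h (t • z)) (isOpen_ball.mem_nhds
      (mem_ball_zero_iff.2 hyr)) ?_ (intervalIntegrable_radial_integrand hβ hh.continuousOn hy)
      (hmeas (by linarith) hfd y hy) ?_ intervalIntegrable_const ?_
  · filter_upwards [isOpen_ball.mem_nhds hy] with z hz using hmeas hβ hh.continuousOn z hz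
  · refine Eventually.of_forall fun t ht z hz => ?_
    have ht' := hI ht
    rw [norm_smul, Real.norm_of_nonneg (Real.rpow_nonneg ht'.1 _)]
    have h1 := hC (t • z) (ball_subset_closedBall (smul_mem_ball_zero ht' hz))
    exact (mul_le_of_le_one_left (norm_nonneg _)
      (Real.rpow_le_one ht'.1 ht'.2 (by linarith))).trans h1
  · refine Eventually.of_forall fun t ht z hz => ?_
    have ht' := hI ht
    have ht0 : 0 < t := by rw [uIoc_of_le zero_le_one] at ht; exact ht.1
    have hzU : t • z ∈ ball (0 : E n) R :=
      hrU (ball_subset_closedBall (smul_mem_ball_zero ht' hz))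
    have h1 : HasFDerivAt h (fderiv ℝ h (t • z)) (t • z) :=
      ((hh.contDiffAt (isOpen_ball.mem_nhds hzU)).differentiableAt (by simp)).hasFDerivAt
    have h2 := (h1.comp z ((hasFDerivAt_id z).const_smul t)).const_smul (t ^ β)
    refine h2.congr_fderiv ?_
    ext v
    simp [Real.rpow_add_one ht0.ne', mul_smul]

end

lemma contDiffOn_radialMean {R : ℝ} (N : ℕ) : ∀ {F : Type} [NormedAddCommGroup F]
    [NormedSpace ℝ F] {β : ℝ} {h : E n → F}, 0 ≤ β → ContDiffOn ℝ ∞ h (ball 0 R) →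
    ContDiffOn ℝ N (radialMean β h) (ball 0 R) := by
  induction N with
  | zero =>
    intro F _ _ β h hβ hh
    exact contDiffOn_zero.2 fun y hy => (hasFDerivAt_radialMean hβ (contDiffOn_infty.1 hh 1)
      hy).continuousAt.continuousWithinAt
  | succ N ih =>
    intro F _ _ β h hβ hh
    have h1 : ∀ y ∈ ball (0 : E n) R, HasFDerivAt (radialMean β h)
      (radialMean (β + 1) (fderiv ℝ h) y) y :=
      fun y hy => hasFDerivAt_radialMean hβ (contDiffOn_infty.1 hh 1) hy
    have h2 : ContDiffOn ℝ ∞ (fderiv ℝ h) (ball 0 R) :=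
      ((contDiffOn_infty_iff_fderiv_of_isOpen isOpen_ball).1 hh).2
    push_cast
    refine (contDiffOn_succ_iff_fderiv_of_isOpen isOpen_ball).2
      ⟨fun y hy => (h1 y hy).differentiableAt.differentiableWithinAt, by simp, ?_⟩
    exact (ih (by linarith) h2).congr fun y hy => (h1 y hy).fderiv

section

variable {R β : ℝ} {h : E n → ℝ} {y : E n}

lemma fderiv_radialMean_apply (hβ : 0 ≤ β) (hh : ContDiffOn ℝ ∞ h (ball 0 R))
    (hy : y ∈ ball 0 R) (v : E n) :
    fderiv ℝ (radialMean β h) y v = radialMean (β + 1) (fun z => fderiv ℝ h z v) y := by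
  have hh1 : ContDiffOn ℝ ∞ (fderiv ℝ h) (ball 0 R) :=
    ((contDiffOn_infty_iff_fderiv_of_isOpen isOpen_ball).1 hh).2
  rw [(hasFDerivAt_radialMean hβ (contDiffOn_infty.1 hh 1) hy).fderiv]
  exact ((ContinuousLinearMap.apply ℝ ℝ v).intervalIntegral_comp_comm
    (intervalIntegrable_radial_integrand (by linarith) hh1.continuousOn hy)).symm

lemma negLaplacianPow_one_radialMean (hβ : 0 ≤ β) (hh : ContDiffOn ℝ ∞ h (ball 0 R))
    (hy : y ∈ ball 0 R) : negLaplacianPow univ 1 (radialMean β h) y =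
      radialMean (β + 2) (negLaplacianPow univ 1 h) y := by
  have hh1 : ContDiffOn ℝ ∞ (fderiv ℝ h) (ball 0 R) :=
    ((contDiffOn_infty_iff_fderiv_of_isOpen isOpen_ball).1 hh).2
  have hhi : ∀ i, ContDiffOn ℝ ∞ (fun z => fderiv ℝ h z (bv i)) (ball 0 R) := fun i =>
    hh1.clm_apply contDiffOn_const
  have hhii : ∀ i, ContDiffOn ℝ ∞ (fun z => fderiv ℝ (fun z => fderiv ℝ h z (bv i)) z (bv i))
      (ball 0 R) := fun i =>
    ((contDiffOn_infty_iff_fderiv_of_isOpen isOpen_ball).1 (hhi i)).2.clm_apply contDiffOn_const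
  have hk : ContDiffOn ℝ 2 (radialMean β h) (ball 0 R) := contDiffOn_radialMean 2 hβ hh
  have h2 : ∀ z ∈ ball (0 : E n) R, negLaplacianPow univ 1 h z =
      -∑ i, fderiv ℝ (fun z => fderiv ℝ h z (bv i)) z (bv i) := fun z hz => by
    rw [negLaplacianPow_one_univ]
    congr 1
    refine Finset.sum_congr rfl fun i _ => ?_
    rw [fderiv_fderiv_apply (differentiableOn_fderiv isOpen_ball (contDiffOn_infty.1 hh 2) hz)]
  have h3 : radialMean (β + 2) (negLaplacianPow univ 1 h) y = radialMean (β + 2)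
      (fun z => -∑ i, fderiv ℝ (fun z => fderiv ℝ h z (bv i)) z (bv i)) y := by
    refine intervalIntegral.integral_congr fun t ht => ?_
    rw [uIcc_of_le zero_le_one] at ht
    simp only [h2 _ (smul_mem_ball_zero ht hy)]
  rw [negLaplacianPow_one_univ, h3]
  simp only [radialMean, smul_eq_mul, mul_neg, Finset.mul_sum, intervalIntegral.integral_neg]
  rw [intervalIntegral.integral_finsetSum fun i _ => by
    simpa using intervalIntegrable_radial_integrand (by linarith) (hhii i).continuousOn hy]
  congr 1
  refine Finset.sum_congr rfl fun i _ => ?_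
  rw [← fderiv_fderiv_apply (differentiableOn_fderiv isOpen_ball hk hy)]
  have h4 : (fun z => fderiv ℝ (radialMean β h) z (bv i)) =ᶠ[𝓝 y]
      radialMean (β + 1) (fun z => fderiv ℝ h z (bv i)) := by
    filter_upwards [isOpen_ball.mem_nhds hy] with z hz
    exact fderiv_radialMean_apply hβ hh hz _
  rw [h4.fderiv_eq, fderiv_radialMean_apply (by linarith) (hhi i) hy, add_assoc,
    one_add_one_eq_two]
  rfl

/-- The radial mean inverts a first order operator:
`(β + 1) k + y·∇k = h` for `k = ∫₀¹ t^β h(ty) dt`. -/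
lemma radialMean_ode (hβ : 0 ≤ β) (hh : ContDiffOn ℝ ∞ h (ball 0 R)) (hy : y ∈ ball 0 R) :
    (β + 1) * radialMean β h y + fderiv ℝ (radialMean β h) y y = h y := by
  have hh1 : ContDiffOn ℝ ∞ (fderiv ℝ h) (ball 0 R) :=
    ((contDiffOn_infty_iff_fderiv_of_isOpen isOpen_ball).1 hh).2
  have hint1 := intervalIntegrable_radial_integrand hβ hh.continuousOn hy
  have hint2 : IntervalIntegrable (fun t : ℝ => t ^ (β + 1) • fderiv ℝ h (t • y)) volume 0 1 :=
    intervalIntegrable_radial_integrand (by linarith) hh1.continuousOn hy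
  have hint3 : IntervalIntegrable (fun t : ℝ => t ^ (β + 1) • fderiv ℝ h (t • y) y) volume 0 1 :=
    ⟨(ContinuousLinearMap.apply ℝ ℝ y).integrable_comp hint2.1,
      (ContinuousLinearMap.apply ℝ ℝ y).integrable_comp hint2.2⟩
  rw [(hasFDerivAt_radialMean hβ (contDiffOn_infty.1 hh 1) hy).fderiv]
  have h1 : radialMean (β + 1) (fderiv ℝ h) y y =
      ∫ t in (0 : ℝ)..1, t ^ (β + 1) • fderiv ℝ h (t • y) y :=
    ((ContinuousLinearMap.apply ℝ ℝ y).intervalIntegral_comp_comm hint2).symm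
  rw [h1, radialMean, ← intervalIntegral.integral_const_mul,
    ← intervalIntegral.integral_add (hint1.const_mul _) hint3]
  have hint4 := (hint1.const_mul (β + 1)).add hint3
  have hcont : ContinuousOn (fun t : ℝ => t ^ (β + 1) * h (t • y)) (Icc 0 1) :=
    continuousOn_radial_integrand (by linarith) hh.continuousOn hy
  have hderiv : ∀ t ∈ Ioo (0 : ℝ) 1, HasDerivAt (fun t : ℝ => t ^ (β + 1) * h (t • y))
      ((β + 1) * (t ^ β • h (t • y)) + t ^ (β + 1) • fderiv ℝ h (t • y) y) t := by
    intro t ht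
    have hzU := smul_mem_ball_zero ⟨ht.1.le, ht.2.le⟩ hy
    have e1 : HasFDerivAt h (fderiv ℝ h (t • y)) (t • y) :=
      ((hh.contDiffAt (isOpen_ball.mem_nhds hzU)).differentiableAt (by simp)).hasFDerivAt
    have e2 : HasDerivAt (fun t : ℝ => t • y) y t := by
      simpa using (hasDerivAt_id t).smul_const y
    have e3 := (Real.hasDerivAt_rpow_const (p := β + 1) (Or.inl ht.1.ne')).mul
      (e1.comp_hasDerivAt t e2)
    refine e3.congr_deriv ?_
    simp only [add_sub_cancel_right, smul_eq_mul, Function.comp_apply]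
    ring
  have := intervalIntegral.integral_eq_sub_of_hasDerivAt_of_le zero_le_one hcont hderiv hint4
  rw [this, Real.zero_rpow (by linarith)]
  simp

end

end

/-! ### The Dirichlet problem in the Almansi class -/

section

variable {n : ℕ} {R : ℝ}

/-- Smooth harmonic functions on `B_R`. -/
structure IsHarmonicOnBall (R : ℝ) (h : E n → ℝ) : Prop where
  smooth : ContDiffOn ℝ ∞ h (ball 0 R)
  harmonic : ∀ y ∈ ball (0 : E n) R, negLaplacianPow univ 1 h y = 0

/-- The functions which on `B_R` are finite sums of products `|y|^{2j} h` with `h` harmonic. -/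
inductive IsAlmansi (R : ℝ) : (E n → ℝ) → Prop
  | mul (j : ℕ) {h : E n → ℝ} (hh : IsHarmonicOnBall R h) : IsAlmansi R fun y => (‖y‖ ^ 2) ^ j * h y
  | add {f g : E n → ℝ} (hf : IsAlmansi R f) (hg : IsAlmansi R g) : IsAlmansi R fun y => f y + g y
  | congr {f g : E n → ℝ} (hf : IsAlmansi R f) (hfg : EqOn f g (ball 0 R)) : IsAlmansi R g

lemma negLaplacianPow_one_const_mul {f : E n → ℝ} {y : E n} (c : ℝ) :
    negLaplacianPow univ 1 (fun z => c * f z) y = c * negLaplacianPow univ 1 f y :=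
  negLaplacianPow_const_smul uniqueDiffOn_univ c f 1 (mem_univ y)

lemma negLaplacianPow_one_add {f g : E n → ℝ} {U : Set (E n)} (hU : IsOpen U)
    (hf : ContDiffOn ℝ ∞ f U) (hg : ContDiffOn ℝ ∞ g U) {y : E n} (hy : y ∈ U) :
    negLaplacianPow univ 1 (fun z => f z + g z) y =
      negLaplacianPow univ 1 f y + negLaplacianPow univ 1 g y := by
  have h := negLaplacianPow_add hU.uniqueDiffOn 1 (contDiffOn_infty.1 hf 2)
    (contDiffOn_infty.1 hg 2) hy
  dsimp only at h
  rwa [negLaplacianPow_eqOn_univ hU subset_rfl (fun _ _ => rfl) 1 hy,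
    negLaplacianPow_eqOn_univ hU subset_rfl (g := f) (fun _ _ => rfl) 1 hy,
    negLaplacianPow_eqOn_univ hU subset_rfl (g := g) (fun _ _ => rfl) 1 hy] at h

lemma IsHarmonicOnBall.const_mul {h : E n → ℝ} (hh : IsHarmonicOnBall R h) (c : ℝ) :
    IsHarmonicOnBall R fun y => c * h y :=
  ⟨contDiffOn_const.mul hh.smooth, fun y hy => by
    rw [negLaplacianPow_one_const_mul, hh.harmonic y hy, mul_zero]⟩

lemma IsHarmonicOnBall.isAlmansi {h : E n → ℝ} (hh : IsHarmonicOnBall R h) : IsAlmansi R h :=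
  (IsAlmansi.mul 0 hh).congr fun y _ => by simp

lemma isAlmansi_zero : IsAlmansi R (fun _ : E n => 0) :=
  IsHarmonicOnBall.isAlmansi ⟨contDiffOn_const, fun y _ => negLaplacianPow_const le_rfl 0 y⟩

lemma IsAlmansi.const_mul {f : E n → ℝ} (hf : IsAlmansi R f) (c : ℝ) :
    IsAlmansi R fun y => c * f y := by
  induction hf with
  | mul j hh => exact (IsAlmansi.mul j (hh.const_mul c)).congr fun y _ => by ring
  | add _ _ h1 h2 => exact (h1.add h2).congr fun y _ => by ring
  | congr _ h h1 => exact h1.congr fun y hy => by simp only [h hy]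

lemma IsAlmansi.contDiffOn {f : E n → ℝ} (hf : IsAlmansi R f) : ContDiffOn ℝ ∞ f (ball 0 R) := by
  induction hf with
  | mul j hh => exact ((contDiff_norm_sq ℝ).pow j).contDiffOn.mul hh.smooth
  | add _ _ h1 h2 => exact h1.add h2
  | congr _ h h1 => exact h1.congr h.symm

/-- The Dirichlet problem `-Δw = f` in `B_2`, `w = 0` on `∂B_2`, is solvable in the Almansi class:
for `f = |y|^{2j} h` one takes `w = -(|y|^{2j+2} - 4^{j+1}) k / (2j + 2)`, where `k` is the harmonic
function with `(2j + n) k + 2 y·∇k = h`. -/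
lemma IsAlmansi.exists_dirichlet (hn : 2 ≤ n) {f : E n → ℝ} (hf : IsAlmansi R f) :
    ∃ w, IsAlmansi R w ∧ (∀ y ∈ ball (0 : E n) R, negLaplacianPow univ 1 w y = f y) ∧
      ∀ y ∈ sphere (0 : E n) 2, w y = 0 := by
  induction hf with
  | @mul j h hh =>
    have hn' : (2 : ℝ) ≤ n := by exact_mod_cast hn
    set β : ℝ := j + n / 2 - 1 with hβ
    have hβ0 : 0 ≤ β := by have : (0 : ℝ) ≤ j := j.cast_nonneg; linarith
    set k : E n → ℝ := fun y => 1 / 2 * radialMean β h y with hk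
    have hkh : IsHarmonicOnBall R k := by
      refine IsHarmonicOnBall.const_mul ⟨contDiffOn_infty.2 fun N =>
        contDiffOn_radialMean N hβ0 hh.smooth, fun y hy => ?_⟩ _
      rw [negLaplacianPow_one_radialMean hβ0 hh.smooth hy, radialMean]
      have : EqOn (fun t : ℝ => t ^ (β + 2) • negLaplacianPow univ 1 h (t • y)) (fun _ => 0)
          (uIcc 0 1) := fun t ht => by
        rw [uIcc_of_le zero_le_one] at ht
        simp only [hh.harmonic _ (smul_mem_ball_zero ht hy), smul_zero]
      rw [intervalIntegral.integral_congr this, intervalIntegral.integral_zero]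
    have hode : ∀ y ∈ ball (0 : E n) R, (2 * j + n) * k y + 2 * fderiv ℝ k y y = h y := by
      intro y hy
      have h1 := radialMean_ode hβ0 hh.smooth hy
      have h2 : fderiv ℝ k y = (1 / 2 : ℝ) • fderiv ℝ (radialMean β h) y :=
        fderiv_const_mul (hasFDerivAt_radialMean hβ0 (contDiffOn_infty.1 hh.smooth 1)
          hy).differentiableAt _
      rw [h2, ← h1]
      simp only [hk, hβ, _root_.smul_apply, smul_eq_mul]
      ring
    set w : E n → ℝ := fun y => (-(1 / (2 * j + 2 : ℝ))) * ((‖y‖ ^ 2) ^ (j + 1) * k y) +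
      (4 ^ (j + 1) / (2 * j + 2 : ℝ)) * k y with hw
    have hw1 : IsAlmansi R fun y : E n => (-(1 / (2 * j + 2 : ℝ))) * ((‖y‖ ^ 2) ^ (j + 1) * k y) :=
      (IsAlmansi.mul (j + 1) hkh).const_mul _
    have hw2 : IsAlmansi R fun y : E n => (4 ^ (j + 1) / (2 * j + 2 : ℝ)) * k y :=
      (hkh.const_mul _).isAlmansi
    refine ⟨w, hw1.add hw2, fun y hy => ?_, fun y hy => ?_⟩
    · rw [hw, negLaplacianPow_one_add isOpen_ball hw1.contDiffOn hw2.contDiffOn hy,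
        negLaplacianPow_one_const_mul, negLaplacianPow_one_const_mul, hkh.harmonic y hy,
        negLaplacianPow_one_norm_pow_mul j ((contDiffOn_infty.1 hkh.smooth 2).contDiffAt
          (isOpen_ball.mem_nhds hy)) (hkh.harmonic y hy), hode y hy]
      field_simp
      ring
    · simp only [hw, mem_sphere_zero_iff_norm.1 hy]
      rw [show ((2 : ℝ) ^ 2) ^ (j + 1) = 4 ^ (j + 1) by norm_num]
      ring
  | add hf hg h1 h2 =>
    obtain ⟨w, hw, hwf, hw0⟩ := h1
    obtain ⟨w', hw', hwf', hw0'⟩ := h2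
    refine ⟨_, hw.add hw', fun y hy => ?_, fun y hy => ?_⟩
    · rw [negLaplacianPow_one_add isOpen_ball hw.contDiffOn hw'.contDiffOn hy, hwf y hy, hwf' y hy]
    · rw [hw0 y hy, hw0' y hy, add_zero]
  | congr _ h h1 =>
    obtain ⟨w, hw, hwf, hw0⟩ := h1
    exact ⟨w, hw, fun y hy => by rw [hwf y hy, h hy], hw0⟩

section Reflection

/-! ### Polyharmonic functions with the boundary values of the fundamental solutions -/

variable {x : E n}

/-- The quadratic function which agrees with `|y - x|²` for `|y| = 2` and vanishes only at the
reflection of `x` in that sphere. -/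
noncomputable def reflectedSq (x : E n) : E n → ℝ := quad (‖x‖ ^ 2 / 4) 4 ((-2 : ℝ) • x)

lemma reflectedSq_pos {y : E n} (h : ‖x‖ * ‖y‖ < 4) : 0 < reflectedSq x y := by
  have h1 : inner ℝ x y ≤ ‖x‖ * ‖y‖ := real_inner_le_norm x y
  have h2 : 0 ≤ ‖x‖ * ‖y‖ := by positivity
  simp only [reflectedSq, quad, inner_smul_left]
  simp only [map_neg, map_ofNat]
  nlinarith [mul_pos (sub_pos.2 h) (sub_pos.2 h)]

lemma reflectedSq_eq {y : E n} (hy : y ∈ sphere (0 : E n) 2) :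
    reflectedSq x y = ‖y - x‖ ^ 2 := by
  rw [norm_sub_sq_real, mem_sphere_zero_iff_norm.1 hy, real_inner_comm]
  simp only [reflectedSq, quad, inner_smul_left, mem_sphere_zero_iff_norm.1 hy]
  simp only [map_neg, map_ofNat]
  ring

lemma negLaplacianPow_one_reflectedSq_rpow {y : E n} (a : ℝ) (h : ‖x‖ * ‖y‖ < 4) :
    negLaplacianPow univ 1 (fun z => reflectedSq x z ^ a) y =
      -(2 * a * (‖x‖ ^ 2 / 4) * (n + 2 * a - 2)) * reflectedSq x y ^ (a - 1) := by
  have := negLaplacianPow_one_quad_rpow a (reflectedSq_pos h).ne'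
  rw [show (fun z => reflectedSq x z ^ a) = fun z => quad (‖x‖ ^ 2 / 4) 4 ((-2 : ℝ) • x) z ^ a
    from rfl, this, norm_smul]
  simp only [norm_neg, Real.norm_ofNat]
  rw [reflectedSq]
  ring

lemma norm_mul_lt_four (hR : ‖x‖ * R < 4) {y : E n} (hy : y ∈ ball (0 : E n) R) :
    ‖x‖ * ‖y‖ < 4 :=
  (mul_le_mul_of_nonneg_left (mem_ball_zero_iff.1 hy).le (norm_nonneg x)).trans_lt hR

lemma contDiffOn_reflectedSq_rpow (hR : ‖x‖ * R < 4) (a : ℝ) :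
    ContDiffOn ℝ ∞ (fun y => reflectedSq x y ^ a) (ball 0 R) :=
  (contDiff_quad _ _ _).contDiffOn.rpow_const_of_ne fun _ hy =>
    (reflectedSq_pos (norm_mul_lt_four hR hy)).ne'

/-- Powers of `reflectedSq x` of exponent `s + 1 - n/2` are in the Almansi class and have harmonic
extensions from `∂B_2` to `B_R`. For `s = 0` they are harmonic themselves (Kelvin transform); in
general the Laplacian lowers `s` by one. -/
lemma isAlmansi_reflectedSq_rpow (hn : 2 ≤ n) (hR : ‖x‖ * R < 4) (s : ℕ) :
    (IsAlmansi R fun y : E n => reflectedSq x y ^ (((s + 1 : ℕ) : ℝ) - n / 2)) ∧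
      ∃ H : E n → ℝ, IsHarmonicOnBall R H ∧
        ∀ y ∈ sphere (0 : E n) 2, H y = reflectedSq x y ^ (((s + 1 : ℕ) : ℝ) - n / 2) := by
  induction s with
  | zero =>
    have : IsHarmonicOnBall R fun y : E n => reflectedSq x y ^ (((0 + 1 : ℕ) : ℝ) - n / 2) := by
      refine ⟨contDiffOn_reflectedSq_rpow hR _, fun y hy => ?_⟩
      rw [negLaplacianPow_one_reflectedSq_rpow _ (norm_mul_lt_four hR hy)]
      push_cast
      ring
    exact ⟨this.isAlmansi, _, this, fun _ _ => rfl⟩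
  | succ s ih =>
    set a : ℝ := ((s + 1 + 1 : ℕ) : ℝ) - n / 2 with ha
    obtain ⟨w, hw, hwf, hw0⟩ := (ih.1.const_mul
      (-(2 * a * (‖x‖ ^ 2 / 4) * (n + 2 * a - 2)))).exists_dirichlet hn
    have hsm := contDiffOn_reflectedSq_rpow hR a
    have hw' : ContDiffOn ℝ ∞ (fun y => (-1) * w y) (ball 0 R) := contDiffOn_const.mul hw.contDiffOn
    have hH : IsHarmonicOnBall R fun y => reflectedSq x y ^ a + (-1) * w y := by
      refine ⟨hsm.add hw', fun y hy => ?_⟩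
      rw [negLaplacianPow_one_add isOpen_ball hsm hw' hy, negLaplacianPow_one_const_mul, hwf y hy,
        negLaplacianPow_one_reflectedSq_rpow _ (norm_mul_lt_four hR hy), ha]
      push_cast
      ring_nf
    exact ⟨(hw.add hH.isAlmansi).congr fun y _ => by ring, _, hH, fun y hy => by
      rw [hw0 y hy]; ring⟩

lemma norm_sub_sq_eq_quad (x y : E n) : ‖y - x‖ ^ 2 = quad 1 (‖x‖ ^ 2) ((-2 : ℝ) • x) y := by
  rw [norm_sub_sq_real, real_inner_comm]
  simp only [quad, inner_smul_left, map_neg, map_ofNat]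
  ring

/-- The Laplacian of a power of the distance to `x`. -/
lemma negLaplacianPow_one_norm_sub_rpow {y : E n} (a : ℝ) (h : y ≠ x) :
    negLaplacianPow univ 1 (fun z => (‖z - x‖ ^ 2) ^ a) y =
      -(2 * a * (n + 2 * a - 2)) * (‖y - x‖ ^ 2) ^ (a - 1) := by
  have hne : ‖y - x‖ ^ 2 ≠ 0 := by
    have := norm_pos_iff.2 (sub_ne_zero.2 h)
    positivity
  simp only [norm_sub_sq_eq_quad] at *
  rw [negLaplacianPow_one_quad_rpow a hne, norm_smul]
  simp only [norm_neg, Real.norm_ofNat]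
  ring

lemma contDiffOn_norm_sub_rpow (x : E n) (a : ℝ) :
    ContDiffOn ℝ ∞ (fun y => (‖y - x‖ ^ 2) ^ a) {x}ᶜ := by
  refine ContDiffOn.rpow_const_of_ne ?_ fun y hy => ?_
  · exact ((contDiff_norm_sq ℝ).comp (contDiff_id.sub contDiff_const)).contDiffOn
  · have := norm_pos_iff.2 (sub_ne_zero.2 hy)
    positivity

/-- The regular part of the Green function, up to a factor: an `s`-harmonic function with the Navier boundary values
of the fundamental solution of `(-Δ)^s`. -/
lemma exists_regularPart (hn : 2 ≤ n) (hR : ‖x‖ * R < 4) (hR2 : 2 < R) (hx : ‖x‖ < 2) (s : ℕ) :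
    ∃ f : E n → ℝ, IsAlmansi R f ∧ (∀ y ∈ ball (0 : E n) R, negLaplacianPow univ s f y = 0) ∧
      ∀ j < s, ∀ y ∈ sphere (0 : E n) 2, negLaplacianPow univ j f y =
        negLaplacianPow univ j (fun z => (‖z - x‖ ^ 2) ^ ((s : ℝ) - n / 2)) y := by
  induction s with
  | zero => exact ⟨_, isAlmansi_zero, fun _ _ => rfl, fun j hj => absurd hj (by omega)⟩
  | succ s ih =>
    obtain ⟨f, hf, hf0, hfj⟩ := ih
    obtain ⟨-, H, hH, hHb⟩ := isAlmansi_reflectedSq_rpow hn hR s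
    set a : ℝ := ((s + 1 : ℕ) : ℝ) - n / 2 with ha
    set κ : ℝ := -(2 * a * (n + 2 * a - 2)) with hκ
    obtain ⟨w, hw, hwf, hw0⟩ := (hf.const_mul κ).exists_dirichlet hn
    have hL : EqOn (negLaplacianPow univ 1 fun y => H y + w y) (fun y => κ * f y) (ball 0 R) :=
      fun y hy => by
        rw [negLaplacianPow_one_add isOpen_ball hH.smooth hw.contDiffOn hy, hH.harmonic y hy,
          hwf y hy, zero_add]
    have hLj : ∀ j, ∀ y ∈ ball (0 : E n) R, negLaplacianPow univ (j + 1) (fun y => H y + w y) y =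
        κ * negLaplacianPow univ j f y := fun j y hy => by
      rw [negLaplacianPow_succ' univ j, negLaplacianPow_congr_of_eqOn (s := univ) isOpen_ball
        (fun z hz => hL hz.2) j ⟨trivial, hy⟩]
      exact negLaplacianPow_const_smul uniqueDiffOn_univ κ f j (mem_univ y)
    refine ⟨fun y => H y + w y, hH.isAlmansi.add hw, fun y hy => by
      rw [hLj s y hy, hf0 y hy, mul_zero], fun j hj y hy => ?_⟩
    rcases j with _ | j
    · simp only [negLaplacianPow_zero]
      rw [hHb y hy, hw0 y hy, add_zero, reflectedSq_eq hy]
    · have hyR : y ∈ ball (0 : E n) R := by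
        rw [mem_ball_zero_iff, mem_sphere_zero_iff_norm.1 hy]; exact hR2
      have hyx : y ∈ ({x}ᶜ : Set (E n)) := fun h => by
        rw [mem_singleton_iff.1 h] at hy
        exact hx.ne (mem_sphere_zero_iff_norm.1 hy)
      rw [hLj j y hyR, hfj j (by omega) y hy, negLaplacianPow_succ' univ j,
        negLaplacianPow_congr_of_eqOn (s := univ) (U := {x}ᶜ)
          (f := negLaplacianPow univ 1 fun z => (‖z - x‖ ^ 2) ^ a)
          (g := fun z => κ * (‖z - x‖ ^ 2) ^ ((s : ℝ) - n / 2)) isOpen_compl_singleton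
          (fun z hz => ?_) j ⟨trivial, hyx⟩]
      · exact (negLaplacianPow_const_smul uniqueDiffOn_univ κ _ j (mem_univ y)).symm
      · rw [negLaplacianPow_one_norm_sub_rpow a hz.2,
          show a - 1 = (s : ℝ) - n / 2 by rw [ha]; push_cast; ring]

end Reflection

end

/-! ### Fundamental solutions -/

section

variable {n : ℕ} {x : E n} {a : ℝ} {ψ : E n → ℝ}

lemma rpow_sq_norm (y : E n) (a : ℝ) : (‖y‖ ^ 2) ^ a = ‖y‖ ^ (2 * a) := by
  rw [Real.rpow_mul (norm_nonneg y), Real.rpow_two]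

lemma integrable_norm_sub_rpow_mul (hn : 1 ≤ n) (ha : -(n : ℝ) < 2 * a) (x : E n)
    (hψ : Continuous ψ) (hψc : HasCompactSupport ψ) :
    Integrable fun y => (‖y - x‖ ^ 2) ^ a * ψ y := by
  have h1 : LocallyIntegrable (fun y : E n => ‖y‖ ^ (2 * a)) volume := by
    refine locallyIntegrable_of_norm_le_rpow (C := 1) (α := -(2 * a)) (by simpa using hn)
      (by simp; linarith) (Eventually.of_forall fun y => ?_)
      (continuous_norm.measurable.pow_const _).aestronglyMeasurable
    rw [Real.norm_of_nonneg (by positivity), neg_neg, one_mul]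
  have h2 : Integrable fun z : E n => ψ (z + x) • ‖z‖ ^ (2 * a) := by
    refine h1.integrable_smul_left_of_hasCompactSupport (by fun_prop) ?_
    exact hψc.comp_homeomorph (Homeomorph.addRight x)
  refine (h2.comp_sub_right x).congr (Eventually.of_forall fun y => ?_)
  simp only [sub_add_cancel, smul_eq_mul, rpow_sq_norm, mul_comm]

lemma ae_ne (hn : 1 ≤ n) (x : E n) : ∀ᵐ y : E n, y ≠ x := by
  have : Nontrivial (E n) := by
    have : Nonempty (Fin n) := ⟨⟨0, hn⟩⟩
    exact inferInstance
  exact compl_mem_ae_iff.2 (measure_singleton x)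

lemma norm_sub_sq_pos {y : E n} (h : y ≠ x) : 0 < ‖y - x‖ ^ 2 := by
  have := norm_pos_iff.2 (sub_ne_zero.2 h)
  positivity

lemma continuous_regularized (x : E n) (a : ℝ) {ε : ℝ} (hε : 0 < ε) :
    Continuous fun y => (‖y - x‖ ^ 2 + ε ^ 2) ^ a :=
  Continuous.rpow_const (by fun_prop) fun y => Or.inl (by positivity)

lemma tendsto_integral_regularized (hn : 1 ≤ n) (ha : -(n : ℝ) < 2 * a) (ha0 : a ≤ 0) (x : E n)
    (hψ : Continuous ψ) (hψc : HasCompactSupport ψ) :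
    Tendsto (fun ε : ℝ => ∫ y, (‖y - x‖ ^ 2 + ε ^ 2) ^ a * ψ y) (𝓝[>] 0)
      (𝓝 (∫ y, (‖y - x‖ ^ 2) ^ a * ψ y)) := by
  refine tendsto_integral_filter_of_dominated_convergence
    (fun y => ‖(‖y - x‖ ^ 2) ^ a * ψ y‖) ?_ ?_
    (integrable_norm_sub_rpow_mul hn ha x hψ hψc).norm ?_
  · filter_upwards [self_mem_nhdsWithin] with ε hε
    exact ((continuous_regularized x a hε).mul hψ).aestronglyMeasurable
  · refine Eventually.of_forall fun ε => ?_
    filter_upwards [ae_ne hn x] with y hy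
    rw [norm_mul, norm_mul, Real.norm_of_nonneg (show 0 ≤ (‖y - x‖ ^ 2 + ε ^ 2) ^ a by positivity),
      Real.norm_of_nonneg (show 0 ≤ (‖y - x‖ ^ 2) ^ a by positivity)]
    gcongr ?_ * _
    exact Real.rpow_le_rpow_of_nonpos (norm_sub_sq_pos hy) (le_add_of_nonneg_right (sq_nonneg ε)) ha0
  · filter_upwards [ae_ne hn x] with y hy
    refine Tendsto.mul_const _ ?_
    have h1 : Tendsto (fun ε : ℝ => ‖y - x‖ ^ 2 + ε ^ 2) (𝓝[>] 0) (𝓝 (‖y - x‖ ^ 2 + 0 ^ 2)) :=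
      Tendsto.mono_left (Continuous.tendsto (by fun_prop) 0) nhdsWithin_le_nhds
    rw [zero_pow two_ne_zero, add_zero] at h1
    exact h1.rpow_const (Or.inl (norm_sub_sq_pos hy).ne')

/-- The error term in the Laplacian of `(|y - x|² + ε²)^{a+2}` disappears as `ε → 0`. -/
lemma tendsto_integral_regularized_error (hn : 1 ≤ n) (ha : -(n : ℝ) < 2 * (a + 1))
    (ha0 : a + 1 ≤ 0) (x : E n) (hψ : Continuous ψ) (hψc : HasCompactSupport ψ) :
    Tendsto (fun ε : ℝ => ∫ y, ε ^ 2 * (‖y - x‖ ^ 2 + ε ^ 2) ^ a * ψ y) (𝓝[>] 0) (𝓝 0) := by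
  rw [show 𝓝 (0 : ℝ) = 𝓝 (∫ _ : E n, (0 : ℝ)) by simp]
  refine tendsto_integral_filter_of_dominated_convergence
    (fun y => ‖(‖y - x‖ ^ 2) ^ (a + 1) * ψ y‖) ?_ ?_
    (integrable_norm_sub_rpow_mul hn ha x hψ hψc).norm ?_
  · filter_upwards [self_mem_nhdsWithin] with ε hε
    exact ((continuous_const.mul (continuous_regularized x a hε)).mul hψ).aestronglyMeasurable
  · filter_upwards [self_mem_nhdsWithin] with ε hε
    have hε : 0 < ε := hε
    filter_upwards [ae_ne hn x] with y hy
    rw [norm_mul _ (ψ y), norm_mul _ (ψ y),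
      Real.norm_of_nonneg (show 0 ≤ ε ^ 2 * (‖y - x‖ ^ 2 + ε ^ 2) ^ a by positivity),
      Real.norm_of_nonneg (show 0 ≤ (‖y - x‖ ^ 2) ^ (a + 1) by positivity)]
    gcongr ?_ * _
    calc ε ^ 2 * (‖y - x‖ ^ 2 + ε ^ 2) ^ a
        ≤ (‖y - x‖ ^ 2 + ε ^ 2) * (‖y - x‖ ^ 2 + ε ^ 2) ^ a := by
          gcongr; nlinarith [norm_sub_sq_pos hy]
      _ = (‖y - x‖ ^ 2 + ε ^ 2) ^ (a + 1) := by
          rw [Real.rpow_add_one (by positivity), mul_comm]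
      _ ≤ _ := Real.rpow_le_rpow_of_nonpos (norm_sub_sq_pos hy) (le_add_of_nonneg_right (sq_nonneg ε)) ha0
  · filter_upwards [ae_ne hn x] with y hy
    have h1 : Tendsto (fun ε : ℝ => ‖y - x‖ ^ 2 + ε ^ 2) (𝓝[>] 0) (𝓝 (‖y - x‖ ^ 2 + 0 ^ 2)) :=
      Tendsto.mono_left (Continuous.tendsto (by fun_prop) 0) nhdsWithin_le_nhds
    rw [zero_pow two_ne_zero, add_zero] at h1
    have h2 : Tendsto (fun ε : ℝ => ε ^ 2) (𝓝[>] 0) (𝓝 (0 ^ 2)) :=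
      Tendsto.mono_left (Continuous.tendsto (by fun_prop) 0) nhdsWithin_le_nhds
    have h3 := (h2.mul (h1.rpow_const (p := a) (Or.inl (norm_sub_sq_pos hy).ne'))).mul_const (ψ y)
    simpa using h3

lemma integrable_bubble : Integrable fun z : E n => (1 + ‖z‖ ^ 2) ^ (-1 - (n : ℝ) / 2) := by
  have h := integrable_rpow_neg_one_add_norm_sq (E := E n) (μ := volume) (r := (n : ℝ) + 2)
    (by simp)
  refine h.congr (Eventually.of_forall fun z => ?_)
  simp only
  congr 1
  ring

lemma integral_bubble_pos : 0 < ∫ z : E n, (1 + ‖z‖ ^ 2) ^ (-1 - (n : ℝ) / 2) := by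
  rw [integral_pos_iff_support_of_nonneg (fun z => by positivity) integrable_bubble]
  have : Function.support (fun z : E n => (1 + ‖z‖ ^ 2) ^ (-1 - (n : ℝ) / 2)) = univ :=
    eq_univ_of_forall fun z => (by positivity : (0 : ℝ) < _).ne'
  rw [this]
  exact isOpen_univ.measure_pos volume univ_nonempty

lemma integral_regularized_rescale (x : E n) {ε : ℝ} (hε : 0 < ε) :
    ∫ y, ε ^ 2 * (‖y - x‖ ^ 2 + ε ^ 2) ^ (-1 - (n : ℝ) / 2) * ψ y =
      ∫ z : E n, (1 + ‖z‖ ^ 2) ^ (-1 - (n : ℝ) / 2) * ψ (ε • z + x) := by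
  set g : E n → ℝ := fun z => ε ^ 2 * (‖z‖ ^ 2 + ε ^ 2) ^ (-1 - (n : ℝ) / 2) * ψ (z + x) with hg
  have h1 : ∫ y, ε ^ 2 * (‖y - x‖ ^ 2 + ε ^ 2) ^ (-1 - (n : ℝ) / 2) * ψ y = ∫ z, g z := by
    rw [← integral_sub_right_eq_self g x]
    simp [hg]
  have h2 := Measure.integral_comp_smul (volume : Measure (E n)) g ε
  rw [finrank_euclideanSpace_fin, abs_of_pos (by positivity), smul_eq_mul, eq_inv_mul_iff_mul_eq₀
    (by positivity), ← integral_const_mul] at h2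
  rw [h1, ← h2]
  refine integral_congr_ae (Eventually.of_forall fun z => ?_)
  simp only [hg, norm_smul, Real.norm_of_nonneg hε.le]
  rw [show (ε * ‖z‖) ^ 2 + ε ^ 2 = ε ^ 2 * (1 + ‖z‖ ^ 2) by ring,
    Real.mul_rpow (by positivity) (by positivity)]
  have h3 : ε ^ n * (ε ^ 2 * (ε ^ 2) ^ (-1 - (n : ℝ) / 2)) = 1 := by
    rw [← Real.rpow_natCast ε n, ← Real.rpow_two, ← Real.rpow_mul hε.le, ← Real.rpow_add hε,
      ← Real.rpow_add hε]
    ring_nf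
    simp
  calc _ = (ε ^ n * (ε ^ 2 * (ε ^ 2) ^ (-1 - (n : ℝ) / 2))) *
        ((1 + ‖z‖ ^ 2) ^ (-1 - (n : ℝ) / 2) * ψ (ε • z + x)) := by ring
    _ = _ := by rw [h3, one_mul]

/-- In the critical case the error term concentrates at `x`. -/
lemma tendsto_integral_bubble (x : E n) (hψ : Continuous ψ) (hψc : HasCompactSupport ψ) :
    Tendsto (fun ε : ℝ => ∫ y, ε ^ 2 * (‖y - x‖ ^ 2 + ε ^ 2) ^ (-1 - (n : ℝ) / 2) * ψ y) (𝓝[>] 0)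
      (𝓝 ((∫ z : E n, (1 + ‖z‖ ^ 2) ^ (-1 - (n : ℝ) / 2)) * ψ x)) := by
  obtain ⟨B, hB⟩ := hψ.bounded_above_of_compact_support hψc
  rw [← integral_mul_const]
  refine Tendsto.congr' (f₁ := fun ε : ℝ => ∫ z : E n, (1 + ‖z‖ ^ 2) ^ (-1 - (n : ℝ) / 2) *
    ψ (ε • z + x)) ?_ ?_
  · filter_upwards [self_mem_nhdsWithin] with ε hε
    exact (integral_regularized_rescale x hε).symm
  refine tendsto_integral_filter_of_dominated_convergence
    (fun z => (1 + ‖z‖ ^ 2) ^ (-1 - (n : ℝ) / 2) * B) ?_ ?_ (integrable_bubble.mul_const B) ?_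
  · refine Eventually.of_forall fun ε => ?_
    exact integrable_bubble.aestronglyMeasurable.mul (by fun_prop : Continuous fun z =>
      ψ (ε • z + x)).aestronglyMeasurable
  · refine Eventually.of_forall fun ε => Eventually.of_forall fun z => ?_
    rw [norm_mul, Real.norm_of_nonneg (by positivity)]
    gcongr
    exact hB _
  · refine Eventually.of_forall fun z => Tendsto.const_mul _ ?_
    have h1 : Tendsto (fun ε : ℝ => ψ (ε • z + x)) (𝓝 0) (𝓝 (ψ ((0 : ℝ) • z + x))) :=
      Continuous.tendsto (by fun_prop) 0
    rw [zero_smul, zero_add] at h1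
    exact h1.mono_left nhdsWithin_le_nhds

/-- Integration by parts against the regularized power `(|y - x|² + ε²)^a`. -/
lemma integral_regularized_mul_negLaplacianPow (x : E n) (a : ℝ) {ε : ℝ} (hε : 0 < ε)
    (hψ : ContDiff ℝ ∞ ψ) (hψc : HasCompactSupport ψ) :
    ∫ y, (‖y - x‖ ^ 2 + ε ^ 2) ^ a * negLaplacianPow univ 1 ψ y =
      -(2 * a * (n + 2 * a - 2)) * (∫ y, (‖y - x‖ ^ 2 + ε ^ 2) ^ (a - 1) * ψ y) +
        4 * a * (a - 1) * ∫ y, ε ^ 2 * (‖y - x‖ ^ 2 + ε ^ 2) ^ (a - 2) * ψ y := by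
  have hq : ∀ y : E n, ‖y - x‖ ^ 2 + ε ^ 2 = quad 1 (‖x‖ ^ 2 + ε ^ 2) ((-2 : ℝ) • x) y := fun y => by
    rw [norm_sub_sq_eq_quad, quad, quad]; ring
  have hpos : ∀ y : E n, 0 < ‖y - x‖ ^ 2 + ε ^ 2 := fun y => by positivity
  have hsm : ContDiff ℝ ∞ fun y : E n => (‖y - x‖ ^ 2 + ε ^ 2) ^ a := by
    simp only [hq] at *
    exact (contDiff_quad _ _ _).rpow_const_of_ne fun y => (hpos y).ne'
  have h1 := integral_mul_negLaplacianPow isOpen_univ 1 hψ hψc (subset_univ _)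
    (f := fun y => (‖y - x‖ ^ 2 + ε ^ 2) ^ a) (contDiff_infty.1 hsm _).contDiffOn
  have h2 : ∀ y : E n, negLaplacianPow univ 1 (fun y => (‖y - x‖ ^ 2 + ε ^ 2) ^ a) y =
      -(2 * a * (n + 2 * a - 2)) * (‖y - x‖ ^ 2 + ε ^ 2) ^ (a - 1) +
        4 * a * (a - 1) * (ε ^ 2 * (‖y - x‖ ^ 2 + ε ^ 2) ^ (a - 2)) := fun y => by
    have h3 := hpos y
    simp only [hq] at h3 ⊢
    rw [negLaplacianPow_one_quad_rpow a h3.ne', norm_smul]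
    simp only [norm_neg, Real.norm_ofNat]
    ring
  have hi : ∀ b : ℝ, Integrable fun y => (‖y - x‖ ^ 2 + ε ^ 2) ^ b * ψ y := fun b =>
    ((continuous_regularized x b hε).mul hψ.continuous).integrable_of_hasCompactSupport hψc.mul_left
  have hi2 : Integrable fun y => ε ^ 2 * (‖y - x‖ ^ 2 + ε ^ 2) ^ (a - 2) * ψ y := by
    simpa only [mul_assoc] using (hi (a - 2)).const_mul (ε ^ 2)
  rw [← integral_const_mul, ← integral_const_mul, ← integral_add ((hi _).const_mul _)
    (hi2.const_mul _)]
  calc _ = ∫ y, negLaplacianPow univ 1 ψ y * (‖y - x‖ ^ 2 + ε ^ 2) ^ a := by simp only [mul_comm]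
    _ = _ := h1.symm
    _ = _ := by
      refine integral_congr_ae (Eventually.of_forall fun y => ?_)
      simp only [h2]
      ring

lemma integral_norm_rpow_mul_negLaplacianPow_one (hn : 3 ≤ n) (x : E n) (hψ : ContDiff ℝ ∞ ψ)
    (hψc : HasCompactSupport ψ) :
    ∫ y, (‖y - x‖ ^ 2) ^ (1 - (n : ℝ) / 2) * negLaplacianPow univ 1 ψ y =
      n * (n - 2) * (∫ z : E n, (1 + ‖z‖ ^ 2) ^ (-1 - (n : ℝ) / 2)) * ψ x := by
  have hn' : (3 : ℝ) ≤ n := by exact_mod_cast hn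
  set a : ℝ := 1 - (n : ℝ) / 2 with ha
  have hL : ContDiff ℝ ∞ (negLaplacianPow univ 1 ψ) := contDiff_infty_negLaplacianPow hψ
  have hLc : HasCompactSupport (negLaplacianPow univ 1 ψ) :=
    hψc.of_isClosed_subset (isClosed_tsupport _) (tsupport_negLaplacianPow_subset ψ 1)
  have h1 := tendsto_integral_regularized (a := a) (by omega) (by linarith) (by linarith) x
    hL.continuous hLc
  have h2 := (tendsto_integral_bubble x hψ.continuous hψc).const_mul (4 * a * (a - 1))
  refine (tendsto_nhds_unique h1 (h2.congr' ?_)).trans (by rw [ha]; ring)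
  filter_upwards [self_mem_nhdsWithin] with ε hε
  rw [integral_regularized_mul_negLaplacianPow x a hε hψ hψc,
    show (n : ℝ) + 2 * a - 2 = 0 by rw [ha]; ring, show a - 2 = -1 - (n : ℝ) / 2 by rw [ha]; ring]
  ring

lemma integral_norm_rpow_mul_negLaplacianPow_step {s : ℕ} (hs : 1 ≤ s) (hn : 2 * (s + 1) < n)
    (x : E n) (hψ : ContDiff ℝ ∞ ψ) (hψc : HasCompactSupport ψ) :
    ∫ y, (‖y - x‖ ^ 2) ^ (((s + 1 : ℕ) : ℝ) - (n : ℝ) / 2) * negLaplacianPow univ 1 ψ y =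
      (2 * s * (n - 2 * (s + 1))) * ∫ y, (‖y - x‖ ^ 2) ^ ((s : ℝ) - (n : ℝ) / 2) * ψ y := by
  have hs' : (1 : ℝ) ≤ s := by exact_mod_cast hs
  have hn' : (2 : ℝ) * (s + 1) < n := by exact_mod_cast hn
  set a : ℝ := ((s + 1 : ℕ) : ℝ) - (n : ℝ) / 2 with ha
  have ha' : a = s + 1 - (n : ℝ) / 2 := by rw [ha]; push_cast; ring
  have hL : ContDiff ℝ ∞ (negLaplacianPow univ 1 ψ) := contDiff_infty_negLaplacianPow hψ
  have hLc : HasCompactSupport (negLaplacianPow univ 1 ψ) :=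
    hψc.of_isClosed_subset (isClosed_tsupport _) (tsupport_negLaplacianPow_subset ψ 1)
  have h1 := tendsto_integral_regularized (a := a) (by omega) (by linarith) (by linarith) x
    hL.continuous hLc
  have h2 := (tendsto_integral_regularized (a := a - 1) (by omega) (by linarith) (by linarith) x
    hψ.continuous hψc).const_mul (-(2 * a * (n + 2 * a - 2)))
  have h3 := (tendsto_integral_regularized_error (a := a - 2) (by omega) (by linarith)
    (by linarith) x hψ.continuous hψc).const_mul (4 * a * (a - 1))
  refine (tendsto_nhds_unique h1 ((h2.add h3).congr' ?_)).trans ?_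
  · filter_upwards [self_mem_nhdsWithin] with ε hε
    rw [integral_regularized_mul_negLaplacianPow x a hε hψ hψc]
  · rw [show a - 1 = (s : ℝ) - n / 2 by rw [ha']; ring, ha']
    ring

/-- `|y - x|^{2s-n}` is a multiple of the fundamental solution of `(-Δ)^s`. -/
lemma exists_fundamentalSolution {s : ℕ} (hs : 1 ≤ s) (hn : 2 * s < n) :
    ∃ c : ℝ, 0 < c ∧ ∀ (x : E n) (φ : E n → ℝ), ContDiff ℝ ∞ φ → HasCompactSupport φ →
      ∫ y, (‖y - x‖ ^ 2) ^ ((s : ℝ) - (n : ℝ) / 2) * negLaplacianPow univ s φ y = c * φ x := by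
  induction s, hs using Nat.le_induction with
  | base =>
    have hn' : (2 : ℝ) < n := by exact_mod_cast hn
    refine ⟨n * (n - 2) * ∫ z : E n, (1 + ‖z‖ ^ 2) ^ (-1 - (n : ℝ) / 2), ?_,
      fun x φ hφ hφc => ?_⟩
    · have := integral_bubble_pos (n := n)
      have : 0 < (n : ℝ) - 2 := by linarith
      positivity
    · rw [Nat.cast_one]
      exact integral_norm_rpow_mul_negLaplacianPow_one (by omega) x hφ hφc
  | succ s hs ih =>
    obtain ⟨c, hc, h⟩ := ih (by omega)
    have hn' : (2 : ℝ) * (s + 1) < n := by exact_mod_cast hn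
    refine ⟨2 * s * (n - 2 * (s + 1)) * c, ?_, fun x φ hφ hφc => ?_⟩
    · have : 0 < (n : ℝ) - 2 * (s + 1) := by linarith
      have : (0 : ℝ) < s := by exact_mod_cast hs
      positivity
    · rw [negLaplacianPow_succ univ s, integral_norm_rpow_mul_negLaplacianPow_step hs hn x
        (contDiff_infty_negLaplacianPow hφ) (hφc.of_isClosed_subset (isClosed_tsupport _)
          (tsupport_negLaplacianPow_subset φ s)), h x φ hφ hφc]
      ring

end

/-! ### Existence of the Green function -/

section

variable {n : ℕ}

/-- For functions which are smooth near `s`, one-sided and usual derivatives agree on `s`. -/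
lemma negLaplacianPow_eqOn_of_contDiffOn {s V : Set (E n)} (hs : UniqueDiffOn ℝ s) (hV : IsOpen V)
    (hsV : s ⊆ V) {f : E n → ℝ} (hf : ContDiffOn ℝ ∞ f V) (j : ℕ) :
    EqOn (negLaplacianPow s j f) (negLaplacianPow univ j f) s := by
  induction j with
  | zero => exact fun _ _ => rfl
  | succ j ih =>
    intro y hy
    set g := negLaplacianPow univ j f with hg
    have hgs : ContDiffOn ℝ 2 g V := contDiffOn_infty.1
      ((contDiffOn_infty_negLaplacianPow hV.uniqueDiffOn (j := j) hf).congr fun z hz =>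
        (negLaplacianPow_eqOn_univ hV subset_rfl (fun _ _ => rfl) j hz).symm) 2
    have h1 : ∀ z ∈ s, fderivWithin ℝ g s z = fderiv ℝ g z := fun z hz =>
      fderivWithin_eq_fderiv (hs z hz)
        ((hgs.contDiffAt (hV.mem_nhds (hsV hz))).differentiableAt (by simp))
    rw [negLaplacianPow_succ s j, negLaplacianPow_succ univ j, ← hg,
      negLaplacianPow_congr_of_eqOn isOpen_univ (g := g) (fun z hz => ih hz.1) 1 ⟨hy, trivial⟩,
      negLaplacianPow_one, negLaplacianPow_one_univ, fderivWithin_congr h1 (h1 y hy),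
      fderivWithin_eq_fderiv (hs y hy) (differentiableOn_fderiv hV hgs (hsV hy))]

/-- The Green function is a multiple of `|y - x|^{2m-n}` minus its regular part. -/
theorem exists_isNavierGreenFunction {m : ℕ} (hm : 1 ≤ m) (hmn : 2 * m < n) :
    ∃ G : E n → E n → ℝ, IsNavierGreenFunction n m G := by
  obtain ⟨c, hc, hfund⟩ := exists_fundamentalSolution hm hmn
  have hmn' : (2 : ℝ) * m < n := by exact_mod_cast hmn
  have hm' : (1 : ℝ) ≤ m := by exact_mod_cast hm
  have key : ∀ x : E n, ∃ g : E n → ℝ, x ∈ ball (0 : E n) 2 →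
      ContDiffOn ℝ ∞ g (closedBall 0 2 \ {x}) ∧ IntegrableOn g (ball 0 2) ∧
      (∀ φ : E n → ℝ, ContDiff ℝ ∞ φ → HasCompactSupport φ → tsupport φ ⊆ ball 0 2 →
        ∫ y in ball (0 : E n) 2, g y * negLaplacianPow univ m φ y = φ x) ∧
      ∀ j < m, ∀ y ∈ sphere (0 : E n) 2, negLaplacianPow (closedBall 0 2 \ {x}) j g y = 0 := by
    intro x
    by_cases hx : x ∈ ball (0 : E n) 2
    swap
    · exact ⟨0, fun h => absurd h hx⟩
    have hx2 : ‖x‖ < 2 := mem_ball_zero_iff.1 hx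
    -- `2 < R`, and the reflection of `x`, at distance `4 / |x|` from the origin, is outside `B_R`
    set R : ℝ := 8 / (2 + ‖x‖) with hRdef
    have hpos : 0 < 2 + ‖x‖ := by positivity
    have hR2 : 2 < R := by rw [hRdef, lt_div_iff₀ hpos]; linarith
    have hR : ‖x‖ * R < 4 := by
      rw [hRdef, mul_div_assoc', div_lt_iff₀ hpos]; linarith
    obtain ⟨f, hfA, hf0, hfj⟩ := exists_regularPart (by omega : 2 ≤ n) hR hR2 hx2 m
    have hf := hfA.contDiffOn
    set N : E n → ℝ := fun y => (‖y - x‖ ^ 2) ^ ((m : ℝ) - n / 2) with hN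
    have hNs : ContDiffOn ℝ ∞ N {x}ᶜ := contDiffOn_norm_sub_rpow x _
    set V : Set (E n) := ball 0 R ∩ {x}ᶜ with hV
    have hVo : IsOpen V := isOpen_ball.inter isOpen_compl_singleton
    have hcV : closedBall (0 : E n) 2 \ {x} ⊆ V := fun y hy =>
      ⟨closedBall_subset_ball hR2 hy.1, hy.2⟩
    have hNV : ContDiffOn ℝ ∞ N V := hNs.mono inter_subset_right
    have hfV : ContDiffOn ℝ ∞ f V := hf.mono inter_subset_left
    have hg : ContDiffOn ℝ ∞ (fun y => c⁻¹ * (N y - f y)) V := contDiffOn_const.mul (hNV.sub hfV)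
    refine ⟨fun y => c⁻¹ * (N y - f y), fun _ => ⟨hg.mono hcV, ?_, ?_, ?_⟩⟩
    · obtain ⟨η, hη, hηc, -, hη1, -⟩ := exists_smooth_cutoff (isCompact_closedBall (0 : E n) 2)
        isOpen_univ (subset_univ _)
      have h1 : IntegrableOn N (ball 0 2) := by
        refine (integrable_norm_sub_rpow_mul (a := (m : ℝ) - n / 2) (by omega) (by linarith) x
          hη.continuous hηc).integrableOn.congr_fun (fun y hy => ?_) measurableSet_ball
        simp only [hη1.self_of_nhdsSet y (ball_subset_closedBall hy), mul_one, hN]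
      have h2 : IntegrableOn f (ball 0 2) :=
        ((hf.continuousOn.mono (closedBall_subset_ball hR2)).integrableOn_compact
          (isCompact_closedBall _ _)).mono_set ball_subset_closedBall
      exact (h1.sub h2).const_mul _
    · intro φ hφ hφc hφb
      have hφL : ∀ y, y ∉ ball (0 : E n) 2 →
          c⁻¹ * (N y - f y) * negLaplacianPow univ m φ y = 0 := fun y hy => by
        rw [negLaplacianPow_eq_zero_of_notMem_tsupport fun h => hy (hφb h), mul_zero]
      have hL : ContDiff ℝ ∞ (negLaplacianPow univ m φ) := contDiff_infty_negLaplacianPow hφ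
      have hLt : tsupport (negLaplacianPow univ m φ) ⊆ tsupport φ :=
        tsupport_negLaplacianPow_subset φ m
      have hLc : HasCompactSupport (negLaplacianPow univ m φ) :=
        hφc.of_isClosed_subset (isClosed_tsupport _) hLt
      have hbR : tsupport φ ⊆ ball 0 R := hφb.trans (ball_subset_ball hR2.le)
      have hi1 : Integrable fun y => N y * negLaplacianPow univ m φ y :=
        integrable_norm_sub_rpow_mul (by omega) (by linarith) x hL.continuous hLc
      have hi2 : Integrable fun y => negLaplacianPow univ m φ y * f y :=
        integrable_mul_of_tsupport_subset isOpen_ball hL.continuous hLc (hLt.trans hbR)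
          hf.continuousOn
      have h0 : ∫ y, negLaplacianPow univ m φ y * f y = 0 := by
        rw [← integral_mul_negLaplacianPow isOpen_ball m hφ hφc hbR (contDiffOn_infty.1 hf _)]
        refine integral_eq_zero_of_ae (Eventually.of_forall fun y => ?_)
        by_cases hy : y ∈ tsupport φ
        · simp only [hf0 y (hbR hy), mul_zero, Pi.zero_apply]
        · simp only [image_eq_zero_of_notMem_tsupport hy, zero_mul, Pi.zero_apply]
      rw [setIntegral_eq_integral_of_forall_compl_eq_zero hφL]
      calc _ = ∫ y, c⁻¹ * (N y * negLaplacianPow univ m φ y - negLaplacianPow univ m φ y * f y) :=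
            integral_congr_ae (Eventually.of_forall fun y => by ring)
        _ = c⁻¹ * (c * φ x - 0) := by
            rw [integral_const_mul, integral_sub hi1 hi2, h0, hfund x φ hφ hφc]
        _ = φ x := by rw [sub_zero, inv_mul_cancel_left₀ hc.ne']
    · intro j hj y hy
      have hyx : y ∈ closedBall (0 : E n) 2 \ {x} := ⟨sphere_subset_closedBall hy, fun h => by
        rw [mem_singleton_iff.1 h] at hy
        exact hx2.ne (mem_sphere_zero_iff_norm.1 hy)⟩
      have hyV := hcV hyx
      have hun : ∀ g : E n → ℝ, negLaplacianPow V j g y = negLaplacianPow univ j g y := fun g =>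
        negLaplacianPow_eqOn_univ hVo subset_rfl (fun _ _ => rfl) j hyV
      rw [negLaplacianPow_eqOn_of_contDiffOn (uniqueDiffOn_closedBall_sdiff isClosed_singleton) hVo
        hcV hg j hyx, ← hun, negLaplacianPow_const_smul hVo.uniqueDiffOn _ _ j hyV]
      simp only
      rw [negLaplacianPow_sub hVo.uniqueDiffOn j (contDiffOn_infty.1 hNV _)
        (contDiffOn_infty.1 hfV _) hyV]
      simp only
      rw [hun, hun, hfj j hj y hy, sub_self, mul_zero]
  choose G hG using key
  exact ⟨G, fun x hx => (hG x hx).1, fun x hx => (hG x hx).2.1, fun x hx => (hG x hx).2.2.1,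
    fun x hx => (hG x hx).2.2.2⟩

end

/-! ### The representation formula for singular solutions -/

section

variable {n m : ℕ}

/-- The Green function does not see the singular set: tested against `G(x, ·)`, a singular
supersolution supported away from the pole behaves like a smooth compactly supported function. -/
lemma IsSingularSupersolution.integral_green_mul_eq_zero {κ δ : ℝ} {Λ : Set (E n)} {v : E n → ℝ}
    (h : IsSingularSupersolution m κ δ Λ v) {G : E n → E n → ℝ} (hG : IsNavierGreenFunction n m G)
    {x : E n} (hx : x ∈ ball (0 : E n) 2) (hv : tsupport v ⊆ ball 0 2 \ {x}) :
    (Integrable fun y => G x y * negLaplacianPow univ m v y) ∧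
      ∫ y, G x y * negLaplacianPow univ m v y = 0 := by
  have hΩ : IsOpen (ball (0 : E n) 2 \ {x}) := isOpen_ball.sdiff isClosed_singleton
  obtain ⟨θ, hθ, hθc, hθs, hθ1, -⟩ := exists_smooth_cutoff h.supp.isCompact hΩ hv
  have hθv : ∀ y ∈ tsupport v, θ =ᶠ[𝓝 y] fun _ => 1 := fun y hy =>
    hθ1.filter_mono (nhds_le_nhdsSet hy)
  have hg : ContDiff ℝ ∞ fun y => θ y * G x y := contDiff_mul_of_tsupport_subset hΩ hθ hθs
    ((hG.smooth x hx).mono (sdiff_subset_sdiff_left ball_subset_closedBall))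
  have hgc : HasCompactSupport fun y => θ y * G x y := hθc.mul_right
  have heq : ∀ y, θ y * G x y * negLaplacianPow univ m v y = G x y * negLaplacianPow univ m v y := by
    intro y
    by_cases hy : y ∈ tsupport v
    · rw [(hθv y hy).self_of_nhds, one_mul]
    · rw [negLaplacianPow_eq_zero_of_notMem_tsupport hy, mul_zero, mul_zero]
  have hvg : ∀ᵐ y, negLaplacianPow univ m (fun y => θ y * G x y) y * v y = 0 := by
    filter_upwards [hG.ae_negLaplacianPow_eq_zero hx] with y hy0
    by_cases hy : y ∈ tsupport v
    · obtain ⟨V, hV, hVo, hyV⟩ := _root_.eventually_nhds_iff.1 (hθv y hy)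
      rw [negLaplacianPow_congr_of_eqOn (s := univ) (g := G x) hVo
        (fun z hz => by rw [hV z hz.2, one_mul]) m ⟨trivial, hyV⟩, hy0 (hv hy), zero_mul]
    · rw [image_eq_zero_of_notMem_tsupport hy, mul_zero]
  obtain ⟨B, hB⟩ := hg.continuous.bounded_above_of_compact_support hgc
  have hint := h.integrable.bdd_mul hg.continuous.aestronglyMeasurable (Eventually.of_forall hB)
  have hzero := h.integral_mul_eq_zero hg hgc hvg
  simp only [heq] at hint hzero
  exact ⟨hint, hzero⟩

lemma continuousOn_boundaryKernel {G : E n → E n → ℝ} (hG : IsNavierGreenFunction n m G) {x : E n}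
    (hx : x ∈ ball (0 : E n) 2) (i : ℕ) :
    ContinuousOn (boundaryKernel m G i x) (closedBall 0 2 \ {x}) := by
  have hu : UniqueDiffOn ℝ (closedBall (0 : E n) 2 \ {x}) :=
    uniqueDiffOn_closedBall_sdiff isClosed_singleton
  have h := (contDiffOn_infty_negLaplacianPow hu (j := m - i) (hG.smooth x hx)).continuousOn_fderivWithin
    hu (by simp)
  exact (h.clm_apply (continuousOn_id.const_smul (1 / 2 : ℝ))).neg

/-- The singular set is small enough under either hypothesis. -/
lemma hasCoverBound_of_dim {Λ : Set (E n)} (hΛc : IsCompact Λ)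
    (hdim : upperMinkowskiDim Λ < ((n : ℝ) - 2 * m) / 2 ∨
      ∃ k : ℕ, (k : ℝ) ≤ ((n : ℝ) - 2 * m) / 2 ∧ IsSmoothSubmanifold k Λ) :
    HasCoverBound (((n : ℝ) - 2 * m) / 2) Λ := by
  rcases hdim with h | ⟨k, hk, hS⟩
  · exact hasCoverBound_of_upperMinkowskiDim_lt hΛc.isBounded h
  · exact (hS.hasCoverBound hΛc).mono_dim hk

/-- Cutting off a positive singular solution near its singular set gives a singular
supersolution. -/
lemma isSingularSupersolution_cutoff (hm : 1 ≤ m) (hmn : 2 * m < n) {Λ O : Set (E n)}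
    (hΛc : IsCompact Λ) (hcov : HasCoverBound (((n : ℝ) - 2 * m) / 2) Λ)
    {K u η : E n → ℝ} (hK : ContinuousOn K (closedBall 0 2))
    (hKpos : ∀ x ∈ closedBall (0 : E n) 2, 0 < K x)
    (hu : ContDiffOn ℝ ((2 * m : ℕ) : WithTop ℕ∞) u (ball 0 2 \ Λ))
    (hupos : ∀ x ∈ ball (0 : E n) 2 \ Λ, 0 < u x)
    (hueq : ∀ x ∈ ball (0 : E n) 2 \ Λ, negLaplacianPow (ball 0 2 \ Λ) m u x =
      K x * u x ^ (((n : ℝ) + 2 * m) / ((n : ℝ) - 2 * m)))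
    (hη : ContDiff ℝ ∞ η) (hηc : HasCompactSupport η) (hηs : tsupport η ⊆ ball 0 2)
    (hO : IsOpen O) (hΛO : Λ ⊆ O) (hη1 : ∀ y ∈ O, η y = 1) :
    ∃ κ δ : ℝ, IsSingularSupersolution m κ δ Λ fun y => η y * u y := by
  have hΩ : IsOpen (ball (0 : E n) 2 \ Λ) := isOpen_ball.sdiff hΛc.isClosed
  have hOb : O ⊆ ball 0 2 := fun y hy => hηs (subset_tsupport η (by
    rw [Function.mem_support, hη1 y hy]; exact one_ne_zero))
  obtain ⟨δ, hδ, hδO⟩ := hΛc.exists_thickening_subset_open hO hΛO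
  obtain ⟨y₀, hy₀, hmin⟩ := (isCompact_closedBall (0 : E n) 2).exists_isMinOn
    (nonempty_closedBall.2 (by norm_num)) hK
  refine ⟨K y₀, δ, hm, hmn, hΛc, hcov, ?_, hηc.mul_right, hKpos _ hy₀, hδ, ?_⟩
  · intro y hy
    by_cases hyη : y ∈ tsupport η
    · exact (((contDiff_infty.1 hη _).contDiffAt).mul
        (hu.contDiffAt (hΩ.mem_nhds ⟨hηs hyη, hy⟩))).contDiffWithinAt
    · have : (fun y => η y * u y) =ᶠ[𝓝 y] fun _ => 0 := by
        filter_upwards [(isClosed_tsupport η).isOpen_compl.mem_nhds hyη] with z hz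
        rw [image_eq_zero_of_notMem_tsupport hz, zero_mul]
      exact (contDiffAt_const.congr_of_eventuallyEq this).contDiffWithinAt
  · rintro y ⟨hyδ, hyΛ⟩
    have hyO := hδO hyδ
    have hyΩ : y ∈ ball (0 : E n) 2 \ Λ := ⟨hOb hyO, hyΛ⟩
    have hL := negLaplacianPow_eqOn_univ (s := ball (0 : E n) 2 \ Λ) (U := O \ Λ)
      (hO.sdiff hΛc.isClosed) (sdiff_subset_sdiff_left hOb) (f := u) (g := fun y => η y * u y)
      (fun z hz => by simp only [hη1 z hz.1, one_mul]) m ⟨hyO, hyΛ⟩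
    rw [← hL, hueq y hyΩ]
    simp only [hη1 y hyO, one_mul]
    refine ⟨(hupos y hyΩ).le, ?_⟩
    have := hupos y hyΩ
    gcongr
    exact hmin (ball_subset_closedBall (hOb hyO))

end

end SingularPoly

open SingularPoly in
theorem proposition2p2 (n m : ℕ) (hm : 1 ≤ m) (hmn : 2 * m < n)
    (Λ : Set (SingularPoly.E n)) (hΛc : IsCompact Λ) (hΛ : Λ ⊆ ball 0 (1 / 2))
    (hdim : SingularPoly.upperMinkowskiDim Λ < ((n : ℝ) - 2 * m) / 2 ∨
      ∃ k : ℕ, (k : ℝ) ≤ ((n : ℝ) - 2 * m) / 2 ∧ SingularPoly.IsSmoothSubmanifold k Λ)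
    (K : SingularPoly.E n → ℝ) (hK : ContinuousOn K (closedBall 0 2))
    (hKpos : ∀ x ∈ closedBall (0 : SingularPoly.E n) 2, 0 < K x)
    (u : SingularPoly.E n → ℝ)
    (hu : ContDiffOn ℝ ((2 * m : ℕ) : WithTop ℕ∞) u (closedBall 0 2 \ Λ))
    (hupos : ∀ x ∈ ball (0 : SingularPoly.E n) 2 \ Λ, 0 < u x)
    (hueq : ∀ x ∈ ball (0 : SingularPoly.E n) 2 \ Λ,
      SingularPoly.negLaplacianPow (ball 0 2 \ Λ) m u x =
        K x * u x ^ (((n : ℝ) + 2 * m) / ((n : ℝ) - 2 * m))) :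
    (∃ G : SingularPoly.E n → SingularPoly.E n → ℝ, SingularPoly.IsNavierGreenFunction n m G) ∧
    ∀ G : SingularPoly.E n → SingularPoly.E n → ℝ, SingularPoly.IsNavierGreenFunction n m G →
      ∀ x ∈ ball (0 : SingularPoly.E n) 2 \ Λ,
        IntegrableOn
          (fun y => G x y * (K y * u y ^ (((n : ℝ) + 2 * m) / ((n : ℝ) - 2 * m)))) (ball 0 2) ∧
        (∀ i ∈ Finset.Icc 1 m,
          Integrable
            (fun y => SingularPoly.boundaryKernel m G i x y *
              SingularPoly.negLaplacianPow (closedBall 0 2 \ Λ) (i - 1) u y)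
            (SingularPoly.surfaceMeasure n)) ∧
        u x =
          (∫ y in ball (0 : SingularPoly.E n) 2,
            G x y * (K y * u y ^ (((n : ℝ) + 2 * m) / ((n : ℝ) - 2 * m)))) +
          ∑ i ∈ Finset.Icc 1 m,
            ∫ y, SingularPoly.boundaryKernel m G i x y *
              SingularPoly.negLaplacianPow (closedBall 0 2 \ Λ) (i - 1) u y
              ∂(SingularPoly.surfaceMeasure n) := by
  refine ⟨exists_isNavierGreenFunction hm hmn, fun G hG x hx => ?_⟩
  have hcov := hasCoverBound_of_dim hΛc hdim
  set p : ℝ := ((n : ℝ) + 2 * m) / ((n : ℝ) - 2 * m) with hp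
  have hΛb : Λ ⊆ ball 0 2 := hΛ.trans (ball_subset_ball (by norm_num))
  have hΩ : IsOpen (ball (0 : E n) 2 \ Λ) := isOpen_ball.sdiff hΛc.isClosed
  have hΩ' : IsOpen (ball (0 : E n) 2 \ {x}) := isOpen_ball.sdiff isClosed_singleton
  have hΩc : ball (0 : E n) 2 \ Λ ⊆ closedBall 0 2 \ Λ :=
    sdiff_subset_sdiff_left ball_subset_closedBall
  obtain ⟨η, hη, hηc, hηs, hη1, -⟩ := exists_smooth_cutoff hΛc hΩ'
    (fun y hy => ⟨hΛb hy, fun h => hx.2 (mem_singleton_iff.1 h ▸ hy)⟩)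
  obtain ⟨O, hO, hΛO, hηO⟩ := mem_nhdsSet_iff_exists.1 hη1
  have hηO : ∀ y ∈ O, η y = 1 := fun y hy => hηO hy
  have huΩ := hu.mono hΩc
  obtain ⟨κ, δ, hv⟩ := isSingularSupersolution_cutoff hm hmn hΛc hcov hK hKpos huΩ hupos hueq hη hηc
    (hηs.trans sdiff_subset) hO hΛO hηO
  set v : E n → ℝ := fun y => η y * u y with hvdef
  have hvη : tsupport v ⊆ tsupport η :=
    closure_mono (Function.support_mul_subset_left η u)
  obtain ⟨hGF, hGF0⟩ := hv.integral_green_mul_eq_zero hG hx.1 (hvη.trans hηs)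
  set F := negLaplacianPow univ m v with hF
  -- `u = W + v` off `Λ`, and `W` is regular up to the boundary because it vanishes near `Λ`
  set W : E n → ℝ := fun y => (1 - η y) * u y with hW
  have hWs : ContDiffOn ℝ ((2 * m : ℕ) : WithTop ℕ∞) W (closedBall 0 2) := by
    intro y hy
    by_cases hyΛ : y ∈ Λ
    · have : W =ᶠ[𝓝 y] fun _ => 0 := by
        filter_upwards [hO.mem_nhds (hΛO hyΛ)] with z hz
        rw [hW]
        simp only [hηO z hz, sub_self, zero_mul]
      exact (contDiffAt_const.congr_of_eventuallyEq this).contDiffWithinAt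
    · have h1 : ContDiffWithinAt ℝ ((2 * m : ℕ) : WithTop ℕ∞) u (closedBall 0 2) y :=
        (hu y ⟨hy, hyΛ⟩).mono_of_mem_nhdsWithin
          (inter_mem self_mem_nhdsWithin
            (mem_nhdsWithin_of_mem_nhds (hΛc.isClosed.isOpen_compl.mem_nhds hyΛ)))
      exact ((contDiff_const.sub (contDiff_infty.1 hη _)).contDiffWithinAt).mul h1
  have hrep := hG.representation (by omega : 2 ≤ n) hx.1 hWs
  have hWx : W x = u x := by
    have : η x = 0 := image_eq_zero_of_notMem_tsupport fun h => (hηs h).2 rfl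
    simp [hW, this]
  have hsub : ∀ y ∈ ball (0 : E n) 2 \ Λ,
      negLaplacianPow (closedBall 0 2) m W y = K y * u y ^ p - F y := by
    intro y hy
    rw [← hueq y hy, negLaplacianPow_eqOn_univ hΩ
      (sdiff_subset.trans ball_subset_closedBall) (g := W) (fun _ _ => rfl) m hy,
      ← negLaplacianPow_eqOn_univ hΩ subset_rfl (f := fun z => u z - v z)
        (fun z _ => by simp only [hW, hvdef]; ring) m hy,
      negLaplacianPow_sub hΩ.uniqueDiffOn m huΩ
        (hv.smooth.mono fun z hz => hz.2) hy, hF,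
      ← negLaplacianPow_eqOn_univ hΩ subset_rfl (fun _ _ => rfl) m hy]
  have hae : ∀ᵐ y ∂(volume.restrict (ball (0 : E n) 2)),
      G x y * negLaplacianPow (closedBall 0 2) m W y + G x y * F y = G x y * (K y * u y ^ p) := by
    rw [ae_restrict_iff' measurableSet_ball]
    filter_upwards [compl_mem_ae_iff.2 hv.volume_eq_zero] with y hyΛ hy
    rw [hsub y ⟨hy, hyΛ⟩]
    ring
  have hWint : IntegrableOn (fun y => G x y * negLaplacianPow (closedBall 0 2) m W y) (ball 0 2) :=
    integrableOn_mul_continuousOn_closedBall (hG.integrable x hx.1)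
      (contDiffOn_negLaplacianPow uniqueDiffOn_closedBall_two m (N := 0) hWs
        (by simp)).continuousOn
  have hGFb : ∫ y in ball (0 : E n) 2, G x y * F y = 0 := by
    rw [setIntegral_eq_integral_of_forall_compl_eq_zero fun y hy => ?_, hGF0]
    rw [hF, negLaplacianPow_eq_zero_of_notMem_tsupport fun h => hy (hηs (hvη h)).1, mul_zero]
  have hbd : ∀ i, EqOn (fun y => boundaryKernel m G i x y *
      negLaplacianPow (closedBall 0 2) (i - 1) W y) (fun y => boundaryKernel m G i x y *
      negLaplacianPow (closedBall 0 2 \ Λ) (i - 1) u y) (sphere 0 2) := by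
    intro i y hy
    have hU : IsOpen (tsupport η)ᶜ := (isClosed_tsupport η).isOpen_compl
    have hΛη : Λ ⊆ tsupport η := fun z hz => subset_tsupport η (by
      rw [Function.mem_support, hηO z (hΛO hz)]; exact one_ne_zero)
    have hst : closedBall (0 : E n) 2 ∩ (tsupport η)ᶜ =
        (closedBall 0 2 \ Λ) ∩ (tsupport η)ᶜ := by
      ext z
      exact ⟨fun h => ⟨⟨h.1, fun hz => h.2 (hΛη hz)⟩, h.2⟩, fun h => ⟨h.1.1, h.2⟩⟩
    have := negLaplacianPow_congr hU hst (f := W) (g := u) (fun z hz => by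
      simp only [hW, image_eq_zero_of_notMem_tsupport hz.2, sub_zero, one_mul]) (i - 1)
      (x := y) ⟨sphere_subset_closedBall hy, fun h =>
        (mem_ball_zero_iff.1 (hηs h).1).ne (mem_sphere_zero_iff_norm.1 hy)⟩
    simp only [this]
  refine ⟨(hWint.add hGF.integrableOn).congr hae, fun i hi => ?_, ?_⟩
  · have hi := Finset.mem_Icc.1 hi
    refine integrable_surfaceMeasure (ContinuousOn.mul ((continuousOn_boundaryKernel hG hx.1 i).mono
      fun y hy => ⟨sphere_subset_closedBall hy, fun h => ?_⟩) (ContinuousOn.mono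
      (contDiffOn_negLaplacianPow (uniqueDiffOn_closedBall_sdiff hΛc.isClosed) (i - 1) (N := 0) hu
        ?_).continuousOn fun y hy => ⟨sphere_subset_closedBall hy, fun h => ?_⟩))
    · rw [mem_singleton_iff.1 h] at hy
      exact (mem_ball_zero_iff.1 hx.1).ne (mem_sphere_zero_iff_norm.1 hy)
    · exact_mod_cast (by omega : 0 + 2 * (i - 1) ≤ 2 * m)
    · exact (mem_ball_zero_iff.1 (hΛb h)).ne (mem_sphere_zero_iff_norm.1 hy)
  · rw [← hWx, hrep, ← integral_congr_ae hae, integral_add hWint hGF.integrableOn, hGFb, add_zero]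
    congr 1
    exact Finset.sum_congr rfl fun i _ => integral_surfaceMeasure_congr (hbd i)
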